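/- Let $S=S[1]\cdots S[n]$ be a stream of natural numbers. For $m\in\{1,\dots,n\}$ let $\ell(m)$ be the largest $\ell\ge 0$ with $\ell\le m\le n-\ell$ and $S[m-i+1]=S[m+i]$ for all $1\le i\le \ell$ (the length of the longest even palindrome of $S$ with midpoint $m$; length means half the number of symbols), and let $\ell_{\max}=\max_m \ell(m)$. The computation model is a randomized one-pass word RAM. The symbols of $S$ arrive one at a time, can be read once and in this order only; the memory consists of registers of $O(\log n)$ bits; reading a symbol, drawing a uniformly random word, adding, subtracting, multiplying, dividing or reducing two words, copying directly or indirectly addressed registers, comparing two words and outputting a word take one time step each. Space is the number of registers, and the output is write-only and not counted as space. Symbols fit into $O(\log n)$ bits, and the program is given $n$ and $\min(\lceil 1/\varepsilon\rceil,n)$ at the start. Theorem (ApproxLog). For every $a\in\mathbb N$ there are a single program, a word length of $O(\log n)$ bits and a constant $C$ (all depending on $a$ only) such that for every $n\ge 2$, every $\varepsilon\in(0,1]$ and every stream $S$ of length $n$ whose symbols have at most $a(\lfloor\log_2 n\rfloor+1)$ bits, the following holds. For every outcome of the random words the program makes one pass over $S$ and terminates after at most $$C\,\frac{n\log n}{\varepsilon\log(1+\varepsilon)}\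 \text{ steps, using at most }\ C\,\frac{\log n}{\varepsilon\log(1+\varepsilon)}\ \text{ registers.}$$ With probability at least $1-\frac1n$ it reports a palindrome of length at least $\ell_{\max}/(1+\varepsilon)$, that is, it outputs a midpoint $m\in\{1,\dots,n\}$ and a length $\tilde\ell$ with $$\frac{\ell_{\max}}{1+\varepsilon}\le\tilde\ell\le\ell(m).$$ -/

import Mathlib

namespace PalStream

/-! ## Palindromes

A stream is a list `S` of natural numbers. Indices are 1-based, so the `j`-th symbol of `S` is
`S[j - 1]?` in Lean. -/

/-- `S` contains an even palindrome of length `l` with midpoint `m`: with `n = S.length`,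
`l ≤ m ≤ n - l`, and the symbols number `m - i + 1` and `m + i` agree for all `i = 1, …, l`. -/
def IsPal (S : List ℕ) (m l : ℕ) : Prop :=
  l ≤ m ∧ m + l ≤ S.length ∧ ∀ i, 1 ≤ i → i ≤ l → S[m - i]? = S[m + i - 1]?

/-- The length of the longest even palindrome in `S` with midpoint `m`. The set is bounded by
`S.length`; for `m > S.length` it is empty and the value is `0`. -/
noncomputable def ell (S : List ℕ) (m : ℕ) : ℕ := sSup {l | IsPal S m l}

/-- The length of the longest even palindrome in `S`. -/
noncomputable def ellMax (S : List ℕ) : ℕ := (Finset.range (S.length + 1)).sup (ell S)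

/-! ## Randomized one-pass word RAM

The memory is an array of registers, each holding a number below `W` (a machine word). A program
refers to registers by fixed addresses, and to arbitrary registers through `load` and `store`.
The stream and the random words can only be consumed from the front; the output is write-only. -/

/-- Arithmetic operations on words. Results are taken modulo `W`; subtraction stops at `0`. -/
inductive Op where
  | add | sub | mul | div | mod

/-- The value of an operation before truncation to a word. -/
def Op.eval : Op → ℕ → ℕ → ℕ
  | .add, x, y => x + y
  | .sub, x, y => x - y
  | .mul, x, y => x * y
  | .div, x, y => x / y
  | .mod, x, y => x % y

/-- Programs. Below, `R[d]` is the register with address `d`. -/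
inductive Program where
  /-- do nothing -/
  | skip : Program
  /-- `R[d] := k` -/
  | const (d k : ℕ) : Program
  /-- `R[d] := R[x] o R[y]` -/
  | arith (o : Op) (d x y : ℕ) : Program
  /-- `R[d] := R[R[x]]` -/
  | load (d x : ℕ) : Program
  /-- `R[R[x]] := R[y]` -/
  | store (x y : ℕ) : Program
  /-- `R[d] :=` the next symbol of the stream -/
  | read (d : ℕ) : Program
  /-- `R[d] :=` a fresh uniformly random word -/
  | rand (d : ℕ) : Program
  /-- append `R[x]` to the output -/
  | output (x : ℕ) : Program
  /-- first `p`, then `q` -/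
  | seq (p q : Program) : Program
  /-- if `R[x] < R[y]` then `p` else `q` -/
  | ite (x y : ℕ) (p q : Program) : Program
  /-- while `R[x] < R[y]` do `p` -/
  | while (x y : ℕ) (p : Program) : Program

/-- A configuration: register contents, unread part of the stream, unused random words, output. -/
structure State where
  mem : ℕ → ℕ
  inp : List ℕ
  rnd : List ℕ
  out : List ℕ

/-- Write the value `v`, truncated to a word, to the register with address `d`. -/
def State.set (W : ℕ) (σ : State) (d v : ℕ) : State :=
  { σ with mem := Function.update σ.mem d (v % W) }

/-- `Exec W s P σ σ' t`: with words below `W` and only the registers `0, …, s - 1`, the program `P`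
started in `σ` terminates in `σ'` after `t` time steps. Every instruction and every evaluation of a
test takes one step. There is no rule for touching a register with address `≥ s`, for reading
beyond the end of the stream, or for drawing a random word when none is left: then the machine is
stuck and does not terminate. The rules are deterministic. -/
inductive Exec (W s : ℕ) : Program → State → State → ℕ → Prop where
  | skip (σ : State) : Exec W s .skip σ σ 0
  | const (σ : State) (d k : ℕ) (hd : d < s) : Exec W s (.const d k) σ (σ.set W d k) 1
  | arith (σ : State) (o : Op) (d x y : ℕ) (hd : d < s) (hx : x < s) (hy : y < s) :
      Exec W s (.arith o d x y) σ (σ.set W d (o.eval (σ.mem x) (σ.mem y))) 1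
  | load (σ : State) (d x : ℕ) (hd : d < s) (hx : x < s) (h : σ.mem x < s) :
      Exec W s (.load d x) σ (σ.set W d (σ.mem (σ.mem x))) 1
  | store (σ : State) (x y : ℕ) (hx : x < s) (hy : y < s) (h : σ.mem x < s) :
      Exec W s (.store x y) σ (σ.set W (σ.mem x) (σ.mem y)) 1
  | read (σ : State) (d v : ℕ) (rest : List ℕ) (hd : d < s) (h : σ.inp = v :: rest) :
      Exec W s (.read d) σ ({ σ with inp := rest }.set W d v) 1
  | rand (σ : State) (d v : ℕ) (rest : List ℕ) (hd : d < s) (h : σ.rnd = v :: rest) :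
      Exec W s (.rand d) σ ({ σ with rnd := rest }.set W d v) 1
  | output (σ : State) (x : ℕ) (hx : x < s) :
      Exec W s (.output x) σ { σ with out := σ.out ++ [σ.mem x] } 1
  | seq (p q : Program) (σ σ' σ'' : State) (t t' : ℕ) (hp : Exec W s p σ σ' t)
      (hq : Exec W s q σ' σ'' t') : Exec W s (.seq p q) σ σ'' (t + t')
  | ite_true (x y : ℕ) (p q : Program) (σ σ' : State) (t : ℕ) (hx : x < s) (hy : y < s)
      (h : σ.mem x < σ.mem y) (hp : Exec W s p σ σ' t) : Exec W s (.ite x y p q) σ σ' (t + 1)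
  | ite_false (x y : ℕ) (p q : Program) (σ σ' : State) (t : ℕ) (hx : x < s) (hy : y < s)
      (h : ¬ σ.mem x < σ.mem y) (hq : Exec W s q σ σ' t) : Exec W s (.ite x y p q) σ σ' (t + 1)
  | while_true (x y : ℕ) (p : Program) (σ σ' σ'' : State) (t t' : ℕ) (hx : x < s) (hy : y < s)
      (h : σ.mem x < σ.mem y) (hp : Exec W s p σ σ' t) (hw : Exec W s (.while x y p) σ' σ'' t') :
      Exec W s (.while x y p) σ σ'' (t + t' + 1)
  | while_false (x y : ℕ) (p : Program) (σ : State) (hx : x < s) (hy : y < s)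
      (h : ¬ σ.mem x < σ.mem y) : Exec W s (.while x y p) σ σ 1

/-- The number of words representable with `c * (⌊log₂ n⌋ + 1)` bits, that is, with `c` blocks of
as many bits as the binary expansion of `n ≥ 1` has. -/
def wordBound (c n : ℕ) : ℕ := 2 ^ (c * (Nat.log 2 n + 1))

/-- The error parameter as an integer in one register: `⌈1/ε⌉`, or `n` if that is smaller. -/
noncomputable def encodeEps (n : ℕ) (ε : ℝ) : ℕ := min ⌈1 / ε⌉₊ n

/-- The start configuration: `R[0]` holds the length of the stream, `R[1]` the error parameter,
all other registers hold `0`; nothing of the stream `S` or of the random words `r` is consumed. -/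
noncomputable def start (W : ℕ) (ε : ℝ) (S r : List ℕ) : State where
  mem := fun i => if i = 0 then S.length % W else if i = 1 then encodeEps S.length ε % W else 0
  inp := S
  rnd := r
  out := []

/-- `HaltsWith W s T P ε S r o`: on the stream `S` with error parameter `ε` and random words `r`,
the program `P` terminates within `T` steps, using at most `s` registers, and its output is `o`. -/
def HaltsWith (W s T : ℕ) (P : Program) (ε : ℝ) (S r o : List ℕ) : Prop :=
  ∃ (σ : State) (t : ℕ), Exec W s P (start W ε S r) σ t ∧ t ≤ T ∧ σ.out = o

/-- The output `o` consists of a midpoint `m` and a length `l` such that `S` has a palindrome of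
length `l` with midpoint `m` (equivalently, `l` is at most the length of the longest one there), and
`l` is at least `ℓ_max / (1 + ε)`. -/
def Reports (S : List ℕ) (ε : ℝ) (o : List ℕ) : Prop :=
  ∃ m l : ℕ, o = [m, l] ∧ 1 ≤ m ∧ m ≤ S.length ∧ l ≤ ell S m ∧
    (ellMax S : ℝ) / (1 + ε) ≤ (l : ℝ)

end PalStream

/-! Checkpoints. Let `K` be the integer error parameter. On each level `k ≤ log₂ n` there are `B = 4
* (K + 1)` slots, which between them remember the most recent multiples of `2 ^ k` as possible
starting points. Take a longest palindrome, of length `l` around `m`, and the largest level with `(K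
+ 1) * (2 ^ k - 1) ≤ l`. The first multiple of `2 ^ k` at or after `m - l` trims fewer than `2 ^ k`
symbols from either side, so at most the fraction `1 / (K + 1)` of `l`. Maximality of `k` gives `2 *
l ≤ B * 2 ^ k`, so the checkpoint is still in its slot when the trimmed palindrome ends
(`exists_slot`). Testing every slot after every symbol therefore finds a length of at least `K * l /
(K + 1)`. This is at least `l / (1 + ε)` if `K = ⌈1 / ε⌉`, and integrality makes the result exact if
`K = n` (`reports_of_covers`). There are `O(log n / ε)` slots, which is within the claimed bound
because `log (1 + ε) ≤ 1` (`slots_le`).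

Fingerprints. A segment is tested by comparing its polynomial with the reversed one at random points
of a finite field. Two different polynomials of degree at most `n` agree at no more than `n` points
(`card_hashPal_le`). The field must have well over `n` elements and be found deterministically
within `O(n log n)` steps. The quadratic extension of `ZMod p` with `p` of order `n ^ (2/3)`
achieves this: trial division finds `p` in `O(p ^ (3/2)) = O(n)` steps, and the non-residue comes
from taking square roots by brute force, starting at `-1`. Elements met in this way have order `2 ^
(k + 1)`, which divides `p - 1`, so logarithmically many roots suffice
(`two_pow_lt_of_pow_eq_neg_one`).

Errors. A random word modulo `p ^ 2` is bad for a given non-palindrome with probability at most `2 *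
n / p ^ 2`, of order `n ^ (-1/3)`. Nine independent points bring this below `n ^ (-3)`, and a union
bound over `n ^ 2` segments leaves `1 / n` (`card_fooled_le`). True palindromes are never rejected,
so errors are one-sided.

Machine. Loop-free code has a weakest precondition and a cost fixed by its syntax (`St.runs`); a
loop invariant carries an iteration budget (`Runs.whileCode`). Hence the time and space bounds hold
for every outcome of the random words. -/

namespace PalStream

/-! ## A structured language on top of the word RAM

Registers `0, …, 31` are variables, registers `32, …, 63` are temporaries, and the registers from
`64` on form an array. -/

/-- The memory as the structured language sees it. -/
structure Store where
  var : ℕ → ℕ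
  arr : ℕ → ℕ
  inp : List ℕ
  rnd : List ℕ
  out : List ℕ

/-- The machine state `σ` represents the store `h`; temporaries are ignored. -/
structure Rep (W : ℕ) (σ : State) (h : Store) : Prop where
  var : ∀ a < 32, σ.mem a = h.var a
  arr : ∀ a, 64 ≤ a → σ.mem a = h.arr a
  lt : ∀ a, σ.mem a < W
  inp : σ.inp = h.inp
  rnd : σ.rnd = h.rnd
  out : σ.out = h.out

/-- Expressions. -/
inductive Ex where
  | var (x : ℕ)
  | lit (k : ℕ)
  | bin (o : Op) (e f : Ex)
  | get (e : Ex)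

namespace Ex

def val (h : Store) : Ex → ℕ
  | var x => h.var x
  | lit k => k
  | bin o e f => o.eval (e.val h) (f.val h)
  | get e => h.arr (e.val h)

/-- All intermediate values are words and all addresses are valid. -/
def Ok (W s : ℕ) (h : Store) : Ex → Prop
  | var x => x < 32
  | lit k => k < W
  | bin o e f => e.Ok W s h ∧ f.Ok W s h ∧ o.eval (e.val h) (f.val h) < W
  | get e => e.Ok W s h ∧ 64 ≤ e.val h ∧ e.val h < s

def depth : Ex → ℕ
  | var _ => 1
  | lit _ => 1
  | bin _ e f => max e.depth (f.depth + 1)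
  | get e => e.depth

/-- Code that computes an expression into register `d`, using only registers from `d` on. -/
def code : Ex → ℕ → Program
  -- There is no move instruction, so a register is copied by clearing the target and adding.
  | var x, d => .seq (.const d 0) (.arith .add d d x)
  | lit k, d => .const d k
  | bin o e f, d => .seq (e.code d) (.seq (f.code (d + 1)) (.arith o d d (d + 1)))
  | get e, d => .seq (e.code d) (.load d d)

def cost : Ex → ℕ
  | var _ => 2
  | lit _ => 1
  | bin _ e f => e.cost + (f.cost + 1)
  | get e => e.cost + 1

theorem depth_pos (e : Ex) : 1 ≤ e.depth := by
  induction e with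
  | var x => simp [depth]
  | lit k => simp [depth]
  | bin o e f he hf => simp [depth, he]
  | get e he => simpa [depth] using he

end Ex

theorem Rep.set_temp {W : ℕ} {σ : State} {h : Store} (hr : Rep W σ h) {d v : ℕ}
    (hd : 32 ≤ d) (hd' : d < 64) (hv : v < W) : Rep W (σ.set W d v) h where
  var a ha := by
    have : a ≠ d := by omega
    simpa [State.set, Function.update_of_ne this] using hr.var a ha
  arr a ha := by
    have : a ≠ d := by omega
    simpa [State.set, Function.update_of_ne this] using hr.arr a ha
  lt a := by
    simp only [State.set, Function.update_apply]
    split_ifs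
    · exact Nat.mod_lt _ (by omega)
    · exact hr.lt a
  inp := hr.inp
  rnd := hr.rnd
  out := hr.out

theorem State.set_mem_self {W : ℕ} {σ : State} {d v : ℕ} (hv : v < W) :
    (σ.set W d v).mem d = v := by
  simp [State.set, Nat.mod_eq_of_lt hv]

theorem State.set_mem_ne {W : ℕ} {σ : State} {d v a : ℕ} (h : a ≠ d) :
    (σ.set W d v).mem a = σ.mem a := by
  simp [State.set, Function.update_of_ne h]

/-- Evaluation treats the temporaries as a stack growing upwards from `d`: the left operand waits in
`d` while the right one is computed from `d + 1` on. `Ex.depth` is the height of that stack, and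
nothing below `d` is disturbed. -/
theorem Ex.exec {W s : ℕ} {h : Store} (hs : 64 ≤ s) (e : Ex) :
    ∀ (d : ℕ) (σ : State), Rep W σ h → e.Ok W s h → 32 ≤ d → d + e.depth ≤ 64 →
      ∃ σ', Exec W s (e.code d) σ σ' e.cost ∧ Rep W σ' h ∧ σ'.mem d = e.val h ∧
        ∀ a, a < d → σ'.mem a = σ.mem a := by
  induction e with
  | var x =>
    intro d σ hr ho hd hd'
    simp only [Ok] at ho
    simp only [depth] at hd'
    have hW : 0 < W := by have := hr.lt 0; omega
    have hx : x ≠ d := by omega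
    have h1 := hr.set_temp hd (by omega : d < 64) hW
    have hv : h.var x < W := hr.var x ho ▸ hr.lt x
    have e1 : (Op.add).eval ((σ.set W d 0).mem d) ((σ.set W d 0).mem x) = h.var x := by
      rw [State.set_mem_self hW, State.set_mem_ne hx, hr.var x ho]; simp [Op.eval]
    refine ⟨_, Exec.seq _ _ _ _ _ 1 1 (Exec.const σ d 0 (by omega))
      (Exec.arith _ .add d d x (by omega) (by omega) (by omega)), ?_, ?_, ?_⟩
    · rw [e1]; exact h1.set_temp hd (by omega) hv
    · rw [e1, State.set_mem_self hv]; rfl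
    · intro a ha
      rw [State.set_mem_ne (by omega), State.set_mem_ne (by omega)]
  | lit k =>
    intro d σ hr ho hd hd'
    simp only [Ok] at ho
    simp only [depth] at hd'
    refine ⟨_, Exec.const σ d k (by omega), hr.set_temp hd (by omega) ho,
      State.set_mem_self ho, fun a ha => State.set_mem_ne (by omega)⟩
  | bin o e f he hf =>
    intro d σ hr ho hd hd'
    obtain ⟨h1, h2, h3⟩ := ho
    simp only [depth] at hd'
    have hp := e.depth_pos
    have hp' := f.depth_pos
    obtain ⟨σ1, x1, r1, v1, f1⟩ := he d σ hr h1 hd (by omega)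
    obtain ⟨σ2, x2, r2, v2, f2⟩ := hf (d + 1) σ1 r1 h2 (by omega) (by omega)
    have e1 : o.eval (σ2.mem d) (σ2.mem (d + 1)) = o.eval (e.val h) (f.val h) := by
      rw [v2, f2 d (by omega), v1]
    refine ⟨_, Exec.seq _ _ _ _ _ _ _ x1 (Exec.seq _ _ _ _ _ _ _ x2
      (Exec.arith _ o d d (d + 1) (by omega) (by omega) (by omega))), ?_, ?_, ?_⟩
    · rw [e1]; exact r2.set_temp hd (by omega) h3
    · rw [e1, State.set_mem_self h3]; rfl
    · intro a ha
      rw [State.set_mem_ne (by omega), f2 a (by omega), f1 a ha]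
  | get e he =>
    intro d σ hr ho hd hd'
    obtain ⟨h1, h2, h3⟩ := ho
    simp only [depth] at hd'
    have hp := e.depth_pos
    obtain ⟨σ1, x1, r1, v1, f1⟩ := he d σ hr h1 hd (by omega)
    have e1 : σ1.mem (σ1.mem d) = h.arr (e.val h) := by rw [v1, r1.arr _ h2]
    have hv : h.arr (e.val h) < W := e1 ▸ r1.lt _
    refine ⟨_, Exec.seq _ _ _ _ _ _ _ x1
      (Exec.load _ d d (by omega) (by omega) (by omega)), ?_, ?_, ?_⟩
    · rw [e1]; exact r1.set_temp hd (by omega) hv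
    · rw [e1, State.set_mem_self hv]; rfl
    · intro a ha
      rw [State.set_mem_ne (by omega), f1 a ha]

/-! ### Loop-free statements, weakest preconditions and timed loops -/

/-- Statements without loops. -/
inductive St where
  | skip
  /-- assign an expression to a variable -/
  | asg (x : ℕ) (e : Ex)
  /-- write the value of `f` to the array cell with address `e` -/
  | put (e f : Ex)
  | read (x : ℕ)
  | rand (x : ℕ)
  | out (x : ℕ)
  | seq (p q : St)
  /-- if `e < f` then `p` else `q` -/
  | ite (e f : Ex) (p q : St)

namespace St

def code : St → Program
  | skip => .skip
  | asg x e => .seq (e.code 32) (.seq (.const x 0) (.arith .add x x 32))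
  | put e f => .seq (e.code 32) (.seq (f.code 33) (.store 32 33))
  | read x => .read x
  | rand x => .rand x
  | out x => .output x
  | seq p q => .seq p.code q.code
  | ite e f p q => .seq (e.code 32) (.seq (f.code 33) (.ite 32 33 p.code q.code))

def cost : St → ℕ
  | skip => 0
  | asg _ e => e.cost + 2
  | put e f => e.cost + (f.cost + 1)
  | read _ => 1
  | rand _ => 1
  | out _ => 1
  | seq p q => p.cost + q.cost
  | ite e f p q => e.cost + (f.cost + (max p.cost q.cost + 1))

/-- The weakest precondition. -/
def wp (W s : ℕ) : St → (Store → Prop) → Store → Prop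
  | skip, Q, h => Q h
  | asg x e, Q, h => x < 32 ∧ e.depth ≤ 30 ∧ e.Ok W s h ∧
      Q { h with var := Function.update h.var x (e.val h) }
  | put e f, Q, h => e.depth ≤ 30 ∧ f.depth ≤ 30 ∧ e.Ok W s h ∧ f.Ok W s h ∧ 64 ≤ e.val h ∧
      e.val h < s ∧ Q { h with arr := Function.update h.arr (e.val h) (f.val h) }
  | read x, Q, h => x < 32 ∧ ∃ v l, h.inp = v :: l ∧ v < W ∧
      Q { h with var := Function.update h.var x v, inp := l }
  | rand x, Q, h => x < 32 ∧ ∃ v l, h.rnd = v :: l ∧ v < W ∧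
      Q { h with var := Function.update h.var x v, rnd := l }
  | out x, Q, h => x < 32 ∧ Q { h with out := h.out ++ [h.var x] }
  | seq p q, Q, h => p.wp W s (q.wp W s Q) h
  | ite e f p q, Q, h => e.depth ≤ 30 ∧ f.depth ≤ 30 ∧ e.Ok W s h ∧ f.Ok W s h ∧
      if e.val h < f.val h then p.wp W s Q h else q.wp W s Q h

end St

/-- From every state that represents `h`, the program `P` terminates within `t` steps in a state
that represents a store with the property `Q`. -/
def Runs (W s : ℕ) (P : Program) (h : Store) (t : ℕ) (Q : Store → Prop) : Prop :=
  ∀ σ, Rep W σ h → ∃ σ' t' h', Exec W s P σ σ' t' ∧ t' ≤ t ∧ Rep W σ' h' ∧ Q h'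

theorem Rep.set_var {W : ℕ} {σ : State} {h : Store} (hr : Rep W σ h) {x v : ℕ}
    (hx : x < 32) (hv : v < W) :
    Rep W (σ.set W x v) { h with var := Function.update h.var x v } where
  var a ha := by
    simp only [State.set, Function.update_apply, Nat.mod_eq_of_lt hv]
    split_ifs
    · rfl
    · exact hr.var a ha
  arr a ha := by
    have : a ≠ x := by omega
    simpa [State.set, Function.update_of_ne this] using hr.arr a ha
  lt a := by
    simp only [State.set, Function.update_apply]
    split_ifs
    · exact Nat.mod_lt _ (by omega)
    · exact hr.lt a
  inp := hr.inp
  rnd := hr.rnd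
  out := hr.out

theorem Rep.set_arr {W : ℕ} {σ : State} {h : Store} (hr : Rep W σ h) {x v : ℕ}
    (hx : 64 ≤ x) (hv : v < W) :
    Rep W (σ.set W x v) { h with arr := Function.update h.arr x v } where
  arr a ha := by
    simp only [State.set, Function.update_apply, Nat.mod_eq_of_lt hv]
    split_ifs
    · rfl
    · exact hr.arr a ha
  var a ha := by
    have : a ≠ x := by omega
    simpa [State.set, Function.update_of_ne this] using hr.var a ha
  lt a := by
    simp only [State.set, Function.update_apply]
    split_ifs
    · exact Nat.mod_lt _ (by omega)
    · exact hr.lt a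
  inp := hr.inp
  rnd := hr.rnd
  out := hr.out

/-- Both branches of a test are charged the maximum of their costs, so the time bound depends on the
syntax alone and only the functional behaviour remains to be verified. -/
theorem St.runs {W s : ℕ} (hs : 64 ≤ s) (p : St) :
    ∀ (h : Store) (Q : Store → Prop), p.wp W s Q h → Runs W s p.code h p.cost Q := by
  induction p with
  | skip => exact fun h Q hw σ hr => ⟨σ, 0, h, Exec.skip σ, le_rfl, hr, hw⟩
  | asg x e =>
    rintro h Q ⟨hx, hd, ho, hq⟩ σ hr
    obtain ⟨σ1, x1, r1, v1, f1⟩ := e.exec hs 32 σ hr ho le_rfl (by omega)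
    have hv : e.val h < W := v1 ▸ r1.lt _
    have hW : 0 < W := by omega
    have r2 := r1.set_var hx hW
    have e1 : (Op.add).eval ((σ1.set W x 0).mem x) ((σ1.set W x 0).mem 32) = e.val h := by
      rw [State.set_mem_self hW, State.set_mem_ne (by omega), v1]; simp [Op.eval]
    refine ⟨_, _, _, Exec.seq _ _ _ _ _ _ _ x1 (Exec.seq _ _ _ _ _ 1 1
      (Exec.const _ x 0 (by omega)) (Exec.arith _ .add x x 32 (by omega) (by omega) (by omega))),
      le_rfl, ?_, hq⟩
    rw [e1]
    have := r2.set_var hx hv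
    simpa using this
  | put e f =>
    rintro h Q ⟨hd, hd', ho, ho', h1, h2, hq⟩ σ hr
    obtain ⟨σ1, x1, r1, v1, f1⟩ := e.exec hs 32 σ hr ho le_rfl (by omega)
    obtain ⟨σ2, x2, r2, v2, f2⟩ := f.exec hs 33 σ1 r1 ho' (by omega) (by omega)
    have hv : f.val h < W := v2 ▸ r2.lt _
    have ha : σ2.mem 32 = e.val h := by rw [f2 32 (by omega), v1]
    refine ⟨_, _, _, Exec.seq _ _ _ _ _ _ _ x1 (Exec.seq _ _ _ _ _ _ _ x2
      (Exec.store _ 32 33 (by omega) (by omega) (by omega))), le_rfl, ?_, hq⟩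
    rw [ha, v2]
    exact r2.set_arr h1 hv
  | read x =>
    rintro h Q ⟨hx, v, l, hl, hv, hq⟩ σ hr
    refine ⟨_, 1, _, Exec.read σ x v l (by omega) (hr.inp.trans hl), le_rfl, ?_, hq⟩
    have : Rep W { σ with inp := l } { h with inp := l } :=
      ⟨hr.var, hr.arr, hr.lt, rfl, hr.rnd, hr.out⟩
    exact this.set_var hx hv
  | rand x =>
    rintro h Q ⟨hx, v, l, hl, hv, hq⟩ σ hr
    refine ⟨_, 1, _, Exec.rand σ x v l (by omega) (hr.rnd.trans hl), le_rfl, ?_, hq⟩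
    have : Rep W { σ with rnd := l } { h with rnd := l } :=
      ⟨hr.var, hr.arr, hr.lt, hr.inp, rfl, hr.out⟩
    exact this.set_var hx hv
  | out x =>
    rintro h Q ⟨hx, hq⟩ σ hr
    refine ⟨_, 1, _, Exec.output σ x (by omega), le_rfl, ?_, hq⟩
    exact ⟨hr.var, hr.arr, hr.lt, hr.inp, hr.rnd, by simp [hr.out, hr.var x hx]⟩
  | seq p q hp hq =>
    intro h Q hw σ hr
    obtain ⟨σ1, t1, h1, x1, l1, r1, w1⟩ := hp h _ hw σ hr
    obtain ⟨σ2, t2, h2, x2, l2, r2, w2⟩ := hq h1 _ w1 σ1 r1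
    exact ⟨σ2, _, h2, Exec.seq _ _ _ _ _ _ _ x1 x2, by simp only [cost]; omega, r2, w2⟩
  | ite e f p q hp hq =>
    rintro h Q ⟨hd, hd', ho, ho', hw⟩ σ hr
    obtain ⟨σ1, x1, r1, v1, f1⟩ := e.exec hs 32 σ hr ho le_rfl (by omega)
    obtain ⟨σ2, x2, r2, v2, f2⟩ := f.exec hs 33 σ1 r1 ho' (by omega) (by omega)
    have ha : σ2.mem 32 = e.val h := by rw [f2 32 (by omega), v1]
    split_ifs at hw with hc
    · obtain ⟨σ3, t3, h3, x3, l3, r3, w3⟩ := hp h _ hw σ2 r2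
      exact ⟨σ3, _, h3, Exec.seq _ _ _ _ _ _ _ x1 (Exec.seq _ _ _ _ _ _ _ x2
        (Exec.ite_true 32 33 _ _ _ _ _ (by omega) (by omega) (by omega) x3)),
        by simp only [cost]; omega, r3, w3⟩
    · obtain ⟨σ3, t3, h3, x3, l3, r3, w3⟩ := hq h _ hw σ2 r2
      exact ⟨σ3, _, h3, Exec.seq _ _ _ _ _ _ _ x1 (Exec.seq _ _ _ _ _ _ _ x2
        (Exec.ite_false 32 33 _ _ _ _ _ (by omega) (by omega) (by omega) x3)),
        by simp only [cost]; omega, r3, w3⟩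

theorem Runs.mono {W s : ℕ} {P : Program} {h : Store} {t t' : ℕ} {Q Q' : Store → Prop}
    (hr : Runs W s P h t Q) (ht : t ≤ t') (hQ : ∀ h', Q h' → Q' h') : Runs W s P h t' Q' := by
  intro σ hσ
  obtain ⟨σ1, t1, h1, x1, l1, r1, w1⟩ := hr σ hσ
  exact ⟨σ1, t1, h1, x1, by omega, r1, hQ _ w1⟩

theorem Runs.seq {W s : ℕ} {P P' : Program} {h : Store} {t t' : ℕ} {Q Q' : Store → Prop}
    (hr : Runs W s P h t Q) (hr' : ∀ h', Q h' → Runs W s P' h' t' Q') :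
    Runs W s (.seq P P') h (t + t') Q' := by
  intro σ hσ
  obtain ⟨σ1, t1, h1, x1, l1, r1, w1⟩ := hr σ hσ
  obtain ⟨σ2, t2, h2, x2, l2, r2, w2⟩ := hr' _ w1 σ1 r1
  exact ⟨σ2, _, h2, Exec.seq _ _ _ _ _ _ _ x1 x2, by omega, r2, w2⟩

/-- while `e < f` do `P` -/
def whileCode (e f : Ex) (P : Program) : Program :=
  -- The machine compares registers, not expressions, so both sides of the test are evaluated before
  -- the loop and again at the end of each round.
  .seq (.seq (e.code 32) (f.code 33))
    (.while 32 33 (.seq P (.seq (e.code 32) (f.code 33))))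

/-- A loop whose invariant `I k` carries a bound `k` on the number of remaining iterations. -/
theorem Runs.whileCode {W s : ℕ} (hs : 64 ≤ s) {e f : Ex} {P : Program} {tb : ℕ}
    {I : ℕ → Store → Prop} {Q : Store → Prop} (he : e.depth ≤ 30) (hf : f.depth ≤ 30)
    (hok : ∀ k h, I k h → e.Ok W s h ∧ f.Ok W s h)
    (hbody : ∀ k h, I k h → e.val h < f.val h → ∃ k', k = k' + 1 ∧ Runs W s P h tb (I k'))
    (hexit : ∀ k h, I k h → ¬ e.val h < f.val h → Q h) (k : ℕ) (h : Store) (hI : I k h) :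
    Runs W s (whileCode e f P) h
      (k * (tb + e.cost + f.cost + 1) + (e.cost + f.cost + 1)) Q := by
  have test : ∀ k h, I k h → ∀ σ, Rep W σ h → ∃ σ', Exec W s (.seq (e.code 32) (f.code 33)) σ σ'
      (e.cost + f.cost) ∧ Rep W σ' h ∧ σ'.mem 32 = e.val h ∧ σ'.mem 33 = f.val h := by
    intro k h hI σ hr
    obtain ⟨ho, ho'⟩ := hok k h hI
    obtain ⟨σ1, x1, r1, v1, f1⟩ := e.exec hs 32 σ hr ho le_rfl (by omega)
    obtain ⟨σ2, x2, r2, v2, f2⟩ := f.exec hs 33 σ1 r1 ho' (by omega) (by omega)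
    exact ⟨σ2, Exec.seq _ _ _ _ _ _ _ x1 x2, r2, by rw [f2 32 (by omega), v1], v2⟩
  have loop : ∀ k h, I k h → ∀ σ, Rep W σ h → σ.mem 32 = e.val h → σ.mem 33 = f.val h →
      ∃ σ' t' h', Exec W s (.while 32 33 (.seq P (.seq (e.code 32) (f.code 33)))) σ σ' t' ∧
        t' ≤ k * (tb + e.cost + f.cost + 1) + 1 ∧ Rep W σ' h' ∧ Q h' := by
    intro k
    induction k with
    | zero =>
      intro h hI σ hr h1 h2
      by_cases hc : e.val h < f.val h
      · obtain ⟨k', hk, -⟩ := hbody 0 h hI hc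
        omega
      · exact ⟨σ, 1, h, Exec.while_false 32 33 _ _ (by omega) (by omega) (by omega), by omega, hr,
          hexit _ _ hI hc⟩
    | succ k ih =>
      intro h hI σ hr h1 h2
      by_cases hc : e.val h < f.val h
      · obtain ⟨k', hk, hP⟩ := hbody (k + 1) h hI hc
        obtain rfl : k' = k := by omega
        obtain ⟨σ1, t1, s1, x1, l1, r1, w1⟩ := hP σ hr
        obtain ⟨σ2, x2, r2, v2, v2'⟩ := test _ _ w1 σ1 r1
        obtain ⟨σ3, t3, s3, x3, l3, r3, w3⟩ := ih s1 w1 σ2 r2 v2 v2'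
        refine ⟨σ3, _, s3, Exec.while_true 32 33 _ _ _ _ _ _ (by omega) (by omega) (by omega)
          (Exec.seq _ _ _ _ _ _ _ x1 x2) x3, ?_, r3, w3⟩
        rw [Nat.add_mul]
        omega
      · exact ⟨σ, 1, h, Exec.while_false 32 33 _ _ (by omega) (by omega) (by omega), by omega, hr,
          hexit _ _ hI hc⟩
  intro σ hr
  obtain ⟨σ1, x1, r1, v1, v1'⟩ := test k h hI σ hr
  obtain ⟨σ2, t2, h2, x2, l2, r2, w2⟩ := loop k h hI σ1 r1 v1 v1'
  exact ⟨σ2, _, h2, Exec.seq _ _ _ _ _ _ _ x1 x2, by omega, r2, w2⟩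

end PalStream

namespace PalStream

/-! ## The field with `p ^ 2` elements in single words

For a prime `p` and a non-residue `g` modulo `p`, the word `u + p * v` with `u, v < p` stands for
`u + v * √g`. -/

/-- Addition of packed field elements. -/
def addP (p a b : ℕ) : ℕ := (a % p + b % p) % p + p * ((a / p + b / p) % p)

/-- Multiplication of packed field elements. -/
def mulP (p g a b : ℕ) : ℕ :=
  (a % p * (b % p) + g * (a / p * (b / p) % p)) % p +
    p * ((a % p * (b / p) + a / p * (b % p)) % p)

/-- The field element that a word stands for. -/
def toF (p g a : ℕ) : QuadraticAlgebra (ZMod p) (g : ZMod p) 0 := ⟨(a : ZMod p), ((a / p : ℕ) : ZMod p)⟩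

theorem pack_lt {p u v : ℕ} (hu : u < p) (hv : v < p) : u + p * v < p * p := by
  have : p * (v + 1) ≤ p * p := Nat.mul_le_mul_left p hv
  rw [Nat.mul_add] at this
  omega

theorem addP_lt {p : ℕ} (hp : 0 < p) (a b : ℕ) : addP p a b < p * p :=
  pack_lt (Nat.mod_lt _ hp) (Nat.mod_lt _ hp)

theorem mulP_lt {p : ℕ} (hp : 0 < p) (g a b : ℕ) : mulP p g a b < p * p :=
  pack_lt (Nat.mod_lt _ hp) (Nat.mod_lt _ hp)

theorem toF_pack {p : ℕ} (hp : 0 < p) (g u v : ℕ) :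
    toF p g (u % p + p * v) = ⟨(u : ZMod p), (v : ZMod p)⟩ := by
  ext
  · simp [toF]
  · simp only [toF]
    rw [Nat.add_mul_div_left _ _ hp, Nat.div_eq_of_lt (Nat.mod_lt u hp), Nat.zero_add]

theorem toF_addP {p : ℕ} (hp : 0 < p) (g a b : ℕ) :
    toF p g (addP p a b) = toF p g a + toF p g b := by
  rw [addP, toF_pack hp]
  ext <;> simp [toF]

theorem toF_mulP {p : ℕ} (hp : 0 < p) (g a b : ℕ) :
    toF p g (mulP p g a b) = toF p g a * toF p g b := by
  rw [mulP, toF_pack hp]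
  ext <;> simp [toF]
  ring

theorem toF_zero (p g : ℕ) : toF p g 0 = 0 := by
  ext <;> simp [toF]

theorem toF_one {p : ℕ} (hp : 1 < p) (g : ℕ) : toF p g 1 = 1 := by
  ext <;> simp [toF, Nat.div_eq_of_lt hp, QuadraticAlgebra.re_one, QuadraticAlgebra.im_one]

/-- The two coordinates modulo `p` are the remainder and the quotient of the word by `p`; the
quotient is already below `p` because the word is below `p * p`. -/
theorem toF_inj {p g a b : ℕ} (ha : a < p * p) (hb : b < p * p) (h : toF p g a = toF p g b) :
    a = b := by
  have h1 : (a : ZMod p) = b := congrArg QuadraticAlgebra.re h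
  have h2 : ((a / p : ℕ) : ZMod p) = ((b / p : ℕ) : ZMod p) := congrArg QuadraticAlgebra.im h
  rw [ZMod.natCast_eq_natCast_iff'] at h1 h2
  rw [Nat.mod_eq_of_lt (Nat.div_lt_of_lt_mul ha), Nat.mod_eq_of_lt (Nat.div_lt_of_lt_mul hb)] at h2
  rw [← Nat.mod_add_div a p, ← Nat.mod_add_div b p, h1, h2]

/-! ### Non-residues and trial division -/

/-- `g` is a non-residue modulo `p`. -/
def NonRes (p g : ℕ) : Prop := ∀ y, y < p → y * y % p ≠ g

/-- This is the form in which `QuadraticAlgebra` asks for irreducibility; it turns the ring of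
packed words into a field, where polynomials have few roots. -/
theorem NonRes.fact {p g : ℕ} (hp : 0 < p) (hg : g < p) (h : NonRes p g) :
    Fact (∀ r : ZMod p, r ^ 2 ≠ (g : ZMod p) + 0 * r) := by
  have : NeZero p := ⟨by omega⟩
  refine ⟨fun r hr => h r.val (ZMod.val_lt r) ?_⟩
  have h1 : ((r.val * r.val : ℕ) : ZMod p) = (g : ZMod p) := by
    simp only [Nat.cast_mul, ZMod.natCast_val, ZMod.cast_id', id_eq]
    rw [← sq, hr]; ring
  rw [ZMod.natCast_eq_natCast_iff', Nat.mod_eq_of_lt hg] at h1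
  exact h1

/-- The element `g` has order exactly `2 ^ (k + 1)`, since its power `2 ^ k` is `-1 ≠ 1`, and this
order divides `p - 1`. It bounds how often a square root can be taken starting from `-1`. -/
theorem two_pow_lt_of_pow_eq_neg_one {p g k : ℕ} (hp : p.Prime) (hp2 : 2 < p)
    (h : (g : ZMod p) ^ 2 ^ k = -1) : 2 ^ (k + 1) < p := by
  have : Fact p.Prime := ⟨hp⟩
  have : Fact (2 < p) := ⟨hp2⟩
  have h1 : ¬ (g : ZMod p) ^ 2 ^ k = 1 := by
    rw [h]; exact ZMod.neg_one_ne_one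
  have h2 : (g : ZMod p) ^ 2 ^ (k + 1) = 1 := by
    rw [pow_succ, pow_mul, h]; ring
  have h3 := orderOf_eq_prime_pow h1 h2
  have h0 : (g : ZMod p) ≠ 0 := by
    intro h0
    rw [h0, zero_pow (by positivity)] at h2
    exact zero_ne_one h2
  have h4 := ZMod.orderOf_dvd_card_sub_one h0
  rw [h3] at h4
  have := Nat.le_of_dvd (by omega) h4
  omega

theorem prime_of_forall_not_dvd {p y : ℕ} (hp : 2 ≤ p) (h : ∀ d, 2 ≤ d → d < y → ¬ d ∣ p)
    (hy : p < y * y) : p.Prime := by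
  rw [Nat.prime_def_le_sqrt]
  refine ⟨hp, fun m hm hm' => h m hm ?_⟩
  have := Nat.le_sqrt.1 hm'
  by_contra hc
  push Not at hc
  have := Nat.mul_le_mul hc hc
  omega

end PalStream

namespace PalStream

/-! ## Polynomials from lists -/

section Poly

open Polynomial

variable {R : Type*} [CommRing R]

/-- The polynomial whose coefficients, from the constant one on, are listed. -/
noncomputable def polyOf (l : List R) : R[X] := l.foldr (fun d f => C d + X * f) 0

theorem polyOf_nil : polyOf ([] : List R) = 0 := rfl

theorem polyOf_cons (d : R) (l : List R) : polyOf (d :: l) = C d + X * polyOf l := rfl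

theorem polyOf_snoc (l : List R) (d : R) :
    polyOf (l ++ [d]) = polyOf l + C d * X ^ l.length := by
  induction l with
  | nil => simp [polyOf_nil, polyOf_cons]
  | cons a l ih =>
    rw [List.cons_append, polyOf_cons, ih, polyOf_cons, List.length_cons]
    ring

/-- Equal lengths are needed because trailing zeros leave the polynomial unchanged. A list is
compared only with its own reversal, so this costs nothing. -/
theorem polyOf_injective {l l' : List R} (hl : l.length = l'.length)
    (h : polyOf l = polyOf l') : l = l' := by
  induction l generalizing l' with
  | nil => exact (List.length_eq_zero_iff.1 hl.symm).symm
  | cons a l ih =>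
    cases l' with
    | nil => simp at hl
    | cons b l' =>
      rw [polyOf_cons, polyOf_cons] at h
      have h0 : a = b := by simpa using congrArg (fun f => coeff f 0) h
      subst h0
      have h1 : polyOf l = polyOf l' := by
        ext n
        simpa [coeff_C] using congrArg (fun f => coeff f (n + 1)) h
      rw [ih (by simpa using hl) h1]

theorem natDegree_polyOf_le (l : List R) : (polyOf l).natDegree ≤ l.length := by
  induction l with
  | nil => simp [polyOf_nil]
  | cons a l ih =>
    rw [polyOf_cons, List.length_cons]
    refine (natDegree_add_le _ _).trans (max_le (by simp) ?_)
    refine natDegree_mul_le.trans ?_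
    have := natDegree_X_le (R := R)
    omega

end Poly

/-! ## Fingerprints -/

/-- Feed the digit `d` into a fingerprint at the point `x`: a forward hash, a backward hash and a
power of `x`. -/
def hashStep (p g x : ℕ) (c : ℕ × ℕ × ℕ) (d : ℕ) : ℕ × ℕ × ℕ :=
  (addP p (mulP p g c.1 x) d, addP p c.2.1 (mulP p g d c.2.2), mulP p g c.2.2 x)

/-- The fingerprint of a list at the point `x`. -/
def hash (p g x : ℕ) (l : List ℕ) : ℕ × ℕ × ℕ := l.foldl (hashStep p g x) (0, 0, 1)

theorem hash_snoc (p g x : ℕ) (l : List ℕ) (d : ℕ) :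
    hash p g x (l ++ [d]) = hashStep p g x (hash p g x l) d := by
  simp [hash]

theorem hash_lt {p : ℕ} (hp : 1 < p) (g x : ℕ) (l : List ℕ) :
    (hash p g x l).1 < p * p ∧ (hash p g x l).2.1 < p * p ∧ (hash p g x l).2.2 < p * p := by
  have hp0 : 0 < p := by omega
  induction l using List.reverseRecOn with
  | nil => simp only [hash, List.foldl_nil]; refine ⟨by positivity, by positivity, by nlinarith⟩
  | append_singleton l d =>
    rw [hash_snoc]
    exact ⟨addP_lt hp0 _ _, addP_lt hp0 _ _, mulP_lt hp0 _ _ _⟩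

/-- The forward hash is updated by Horner's rule, so the newest symbol becomes the constant
coefficient. The backward hash adds the newest symbol times the current power, so it becomes the
leading one. Both are one-pass updates, and the two polynomials are reversals of each other. -/
theorem toF_hash {p : ℕ} (hp : 1 < p) (g x : ℕ) (l : List ℕ) :
    toF p g (hash p g x l).1 = (polyOf (l.map (toF p g)).reverse).eval (toF p g x) ∧
    toF p g (hash p g x l).2.1 = (polyOf (l.map (toF p g))).eval (toF p g x) ∧
    toF p g (hash p g x l).2.2 = toF p g x ^ l.length := by
  have hp0 : 0 < p := by omega
  induction l using List.reverseRecOn with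
  | nil => simp [hash, toF_zero, toF_one hp, polyOf_nil]
  | append_singleton l d ih =>
    obtain ⟨h1, h2, h3⟩ := ih
    rw [hash_snoc]
    simp only [hashStep, toF_addP hp0, toF_mulP hp0, h1, h2, h3, List.map_append, List.map_cons,
      List.map_nil, List.reverse_append, List.reverse_cons, List.reverse_nil, List.nil_append,
      List.singleton_append, List.length_append, List.length_cons, List.length_nil, polyOf_cons,
      polyOf_snoc]
    refine ⟨?_, ?_, ?_⟩
    · simp; ring
    · simp
    · ring

/-- The forward and the backward hash at `x` agree. -/
def HashPal (p g x : ℕ) (l : List ℕ) : Prop := (hash p g x l).1 = (hash p g x l).2.1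

theorem hashPal_of_reverse {p : ℕ} (hp : 1 < p) (g x : ℕ) {l : List ℕ} (h : l.reverse = l) :
    HashPal p g x l := by
  obtain ⟨h1, h2, -⟩ := toF_hash hp g x l
  obtain ⟨b1, b2, -⟩ := hash_lt hp g x l
  refine toF_inj b1 b2 (h1.trans (Eq.trans ?_ h2.symm))
  rw [← List.map_reverse, h]

/-- A point with equal hashes is a root of the difference of the two polynomials, which is nonzero
because reading digits below `p * p` as field elements is injective. Its degree bounds the number of
roots. -/
theorem card_hashPal_le {p g : ℕ} (hp : p.Prime) (hg : g < p) (hr : NonRes p g) {l : List ℕ}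
    (hl : ∀ d ∈ l, d < p * p) (h : l.reverse ≠ l) :
    {x ∈ Finset.range (p * p) | (hash p g x l).1 = (hash p g x l).2.1}.card ≤ l.length := by
  have : Fact p.Prime := ⟨hp⟩
  have := hr.fact hp.pos hg
  classical
  set f := polyOf (l.map (toF p g)).reverse - polyOf (l.map (toF p g)) with hf
  have hf0 : f ≠ 0 := by
    intro h0
    have h1 := polyOf_injective (by simp) (sub_eq_zero.1 h0)
    apply h
    rw [← List.map_reverse] at h1
    have hinj : ∀ a ∈ l, ∀ b ∈ l, toF p g a = toF p g b → a = b :=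
      fun a ha b hb hab => toF_inj (hl a ha) (hl b hb) hab
    apply List.ext_getElem (by simp)
    intro i h2 h3
    have h4 : (l.reverse.map (toF p g))[i]'(by simpa using h3) =
      (l.map (toF p g))[i]'(by simpa using h3) := by simp only [h1]
    rw [List.getElem_map, List.getElem_map] at h4
    exact hinj _ (List.mem_reverse.1 (List.getElem_mem _)) _ (List.getElem_mem _) h4
  have hdeg : f.natDegree ≤ l.length := by
    refine (Polynomial.natDegree_sub_le _ _).trans (max_le ?_ ?_)
    · simpa using natDegree_polyOf_le (l.map (toF p g)).reverse
    · simpa using natDegree_polyOf_le (l.map (toF p g))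
  refine le_trans ?_ ((Multiset.toFinset_card_le _).trans (f.card_roots'.trans hdeg))
  refine Finset.card_le_card_of_injOn (toF p g) ?_ ?_
  · intro x hx
    simp only [Finset.coe_filter, Set.mem_ofPred_eq] at hx
    obtain ⟨h1, h2, -⟩ := toF_hash hp.one_lt g x l
    simp only [Finset.mem_coe, Multiset.mem_toFinset]
    rw [Polynomial.mem_roots hf0, Polynomial.IsRoot.def, hf, Polynomial.eval_sub, ← h1, ← h2,
      hx.2, sub_self]
  · intro x hx y hy hxy
    simp only [Finset.coe_filter, Set.mem_ofPred_eq, Finset.mem_range] at hx hy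
    exact toF_inj hx.1 hy.1 hxy

/-! ## Symbols, segments and palindromes -/

/-- The `k`-th digit of `v` in base `q`. -/
def dig (q k v : ℕ) : ℕ := v / q ^ k % q

theorem eq_of_dig_eq {q : ℕ} : ∀ {a v w : ℕ}, v < q ^ a → w < q ^ a →
    (∀ k < a, dig q k v = dig q k w) → v = w := by
  intro a
  induction a with
  | zero => intro v w hv hw _; simp at hv hw; omega
  | succ a ih =>
    intro v w hv hw h
    have h0 := h 0 (by omega)
    simp only [dig, pow_zero, Nat.div_one] at h0
    have h1 : v / q = w / q := by
      refine ih ?_ ?_ fun k hk => ?_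
      · exact Nat.div_lt_of_lt_mul (by rwa [← pow_succ'])
      · exact Nat.div_lt_of_lt_mul (by rwa [← pow_succ'])
      · have := h (k + 1) (by omega)
        simpa only [dig, Nat.div_div_eq_div_mul, ← pow_succ'] using this
    rw [← Nat.mod_add_div v q, ← Nat.mod_add_div w q, h0, h1]

/-- The symbols number `c + 1, …, i` of `S`. -/
def seg (S : List ℕ) (c i : ℕ) : List ℕ := (S.take i).drop c

theorem seg_self (S : List ℕ) (i : ℕ) : seg S i i = [] := by
  simp [seg]

theorem seg_succ {S : List ℕ} {c i : ℕ} (hc : c ≤ i) (hi : i < S.length) :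
    seg S c (i + 1) = seg S c i ++ [S[i]] := by
  rw [seg, List.take_succ_eq_append_getElem hi, List.drop_append_of_le_length (by simp; omega), seg]

theorem length_seg {S : List ℕ} {c i : ℕ} (hi : i ≤ S.length) : (seg S c i).length = i - c := by
  simp [seg, hi]

theorem mem_of_mem_seg {S : List ℕ} {c i v : ℕ} (h : v ∈ seg S c i) : v ∈ S :=
  List.mem_of_mem_take (List.mem_of_mem_drop h)

theorem getElem?_seg {S : List ℕ} {c i t : ℕ} (ht : c + t < i) :
    (seg S c i)[t]? = S[c + t]? := by
  rw [seg, List.getElem?_drop, List.getElem?_take_of_lt ht]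

/-- Reversal pairs position `c + t` with `c + (2 * l - 1 - t)`. The definition of `IsPal` lists each
pair once, so the left and the right half of the indices are treated separately. -/
theorem isPal_iff_reverse {S : List ℕ} {c l : ℕ} (h : c + 2 * l ≤ S.length) :
    IsPal S (c + l) l ↔ (seg S c (c + 2 * l)).reverse = seg S c (c + 2 * l) := by
  have hlen : (seg S c (c + 2 * l)).length = 2 * l := by rw [length_seg h]; omega
  constructor
  · rintro ⟨-, -, hp⟩
    apply List.ext_getElem?
    intro t
    by_cases ht : t < 2 * l
    · rw [List.getElem?_reverse (by omega), hlen, getElem?_seg (by omega), getElem?_seg (by omega)]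
      by_cases htl : t < l
      · have := hp (l - t) (by omega) (by omega)
        rw [show c + l - (l - t) = c + t by omega,
          show c + l + (l - t) - 1 = c + (2 * l - 1 - t) by omega] at this
        exact this.symm
      · have := hp (t + 1 - l) (by omega) (by omega)
        rw [show c + l - (t + 1 - l) = c + (2 * l - 1 - t) by omega,
          show c + l + (t + 1 - l) - 1 = c + t by omega] at this
        exact this
    · rw [List.getElem?_eq_none (by simp; omega), List.getElem?_eq_none (by omega)]
  · intro hr
    refine ⟨by omega, by omega, fun i hi hi' => ?_⟩
    have h1 : (seg S c (c + 2 * l)).reverse[l - i]? = (seg S c (c + 2 * l))[l - i]? := by rw [hr]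
    rw [List.getElem?_reverse (by omega), hlen, getElem?_seg (by omega),
      getElem?_seg (by omega)] at h1
    rw [show c + l - i = c + (l - i) by omega,
      show c + l + i - 1 = c + (2 * l - 1 - (l - i)) by omega]
    exact h1.symm

/-- All fingerprints of the segment from `c` to `i` look like those of a palindrome. The
fingerprint number `e < 9 * a` is that of the digits number `e / 9` at the point `X e`. -/
def Accept (p g a : ℕ) (X : ℕ → ℕ) (S : List ℕ) (c i : ℕ) : Prop :=
  ∀ e < 9 * a, HashPal p g (X e) ((seg S c i).map (dig (p * p) (e / 9)))

theorem accept_of_reverse {p : ℕ} (hp : 1 < p) (g a : ℕ) (X : ℕ → ℕ) {S : List ℕ} {c i : ℕ}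
    (h : (seg S c i).reverse = seg S c i) : Accept p g a X S c i :=
  fun e _ => hashPal_of_reverse hp g _ (by rw [← List.map_reverse, h])

/-- The points `X` mistake a segment of `S` for a palindrome. -/
def Fooled (p g a : ℕ) (X : ℕ → ℕ) (S : List ℕ) : Prop :=
  ∃ c < S.length, ∃ i < S.length, (seg S c (i + 1)).reverse ≠ seg S c (i + 1) ∧
    Accept p g a X S c (i + 1)

theorem exists_digit_ne {q a : ℕ} {l : List ℕ} (hl : ∀ v ∈ l, v < q ^ a)
    (h : l.reverse ≠ l) : ∃ k < a, (l.map (dig q k)).reverse ≠ l.map (dig q k) := by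
  by_contra hc
  push Not at hc
  apply h
  apply List.ext_getElem (by simp)
  intro i h1 h2
  refine eq_of_dig_eq (hl _ (List.mem_reverse.1 (List.getElem_mem _)))
    (hl _ (List.getElem_mem _)) fun k hk => ?_
  have h3 := hc k hk
  rw [← List.map_reverse] at h3
  have h4 : (l.reverse.map (dig q k))[i]'(by simpa using h2) =
    (l.map (dig q k))[i]'(by simpa using h2) := by simp only [h3]
  rwa [List.getElem_map, List.getElem_map] at h4

/-! ## Counting -/

/-- A residue has at most `W / q + 1` representatives below `W`. Reducing a uniform word modulo `q ≤
W` therefore raises probabilities by a factor of at most two. -/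
theorem card_mod_mem_le {W q : ℕ} (hqW : q ≤ W) (R : Finset ℕ) :
    {v : Fin W | (v : ℕ) % q ∈ R}.toFinset.card * q ≤ 2 * R.card * W := by
  have h1 : {v : Fin W | (v : ℕ) % q ∈ R}.toFinset.card ≤ R.card * (W / q + 1) := by
    rw [← Finset.card_range (W / q + 1), ← Finset.card_product]
    refine Finset.card_le_card_of_injOn (fun v => ((v : ℕ) % q, (v : ℕ) / q)) ?_ ?_
    · intro v hv
      simp only [Set.coe_toFinset, Set.mem_ofPred_eq] at hv
      simp only [Finset.coe_product, Set.mem_prod, Finset.mem_coe, Finset.mem_range]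
      exact ⟨hv, Nat.lt_succ_of_le (Nat.div_le_div_right v.2.le)⟩
    · intro v _ w _ hvw
      simp only [Prod.mk.injEq] at hvw
      ext
      rw [← Nat.mod_add_div v q, ← Nat.mod_add_div w q, hvw.1, hvw.2]
  have h2 : (W / q + 1) * q ≤ 2 * W := by
    have := Nat.div_mul_le_self W q
    rw [Nat.add_mul]; omega
  calc _ ≤ R.card * (W / q + 1) * q := Nat.mul_le_mul_right _ h1
    _ = R.card * ((W / q + 1) * q) := by ring
    _ ≤ R.card * (2 * W) := Nat.mul_le_mul_left _ h2
    _ = _ := by ring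

/-- Independence in cross-multiplied form: the coordinates in `I` each contribute at most `N / q` to
the probability, the others are free. -/
theorem card_forall_mem_le {ι : Type*} [Fintype ι] [DecidableEq ι] {W q N : ℕ} (I : Finset ι)
    (B : Finset (Fin W)) (hB : B.card * q ≤ N * W) :
    {r : ι → Fin W | ∀ i ∈ I, r i ∈ B}.toFinset.card * q ^ I.card ≤
      N ^ I.card * W ^ Fintype.card ι := by
  have h1 : {r : ι → Fin W | ∀ i ∈ I, r i ∈ B}.toFinset =
      Fintype.piFinset (fun i => if i ∈ I then B else Finset.univ) := by
    ext r
    simp only [Set.mem_toFinset, Set.mem_ofPred_eq, Fintype.mem_piFinset]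
    refine forall_congr' fun i => ?_
    by_cases hi : i ∈ I <;> simp [hi]
  have h2 : ∀ x : ℕ, x ^ I.card = ∏ i : ι, if i ∈ I then x else 1 := by
    intro x; simp [Finset.prod_ite_mem]
  have h3 : W ^ Fintype.card ι = ∏ _i : ι, W := by simp
  rw [h1, Fintype.card_piFinset, h2 q, h2 N, h3, ← Finset.prod_mul_distrib,
    ← Finset.prod_mul_distrib]
  refine Finset.prod_le_prod' fun i _ => ?_
  by_cases hi : i ∈ I
  · simpa [hi] using hB
  · simp [hi]

/-- The points given by the random words `r`. -/
def points {W T : ℕ} (q : ℕ) (r : Fin T → Fin W) (e : ℕ) : ℕ :=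
  ((List.ofFn fun i => (r i : ℕ)).getD e 0) % q

theorem points_eq {W T : ℕ} (q : ℕ) (r : Fin T → Fin W) (e : ℕ) (he : e < T) :
    points q r e = (r ⟨e, he⟩ : ℕ) % q := by
  simp [points, he]

-- A non-palindrome of symbols is a non-palindrome in some digit `k`. Acceptance then forces the
-- nine points belonging to that digit all to be bad, and these use nine different random words.
open Classical in
theorem card_accept_le {p g a n W T : ℕ} (hp : p.Prime) (hg : g < p) (hr : NonRes p g)
    (hW : p * p ≤ W) (hT : 9 * a ≤ T) {S : List ℕ} (hS : ∀ v ∈ S, v < (p * p) ^ a)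
    (hn : S.length = n) {c i : ℕ} (hi : i < n) (hne : (seg S c (i + 1)).reverse ≠ seg S c (i + 1)) :
    {r : Fin T → Fin W | Accept p g a (points (p * p) r) S c (i + 1)}.toFinset.card * (p * p) ^ 9 ≤
      (2 * n) ^ 9 * W ^ T := by
  have hq : 0 < p * p := Nat.mul_pos hp.pos hp.pos
  obtain ⟨k, hk, hne'⟩ := exists_digit_ne (fun v hv => hS v (mem_of_mem_seg hv)) hne
  set l := (seg S c (i + 1)).map (dig (p * p) k) with hl
  set R := {x ∈ Finset.range (p * p) | (hash p g x l).1 = (hash p g x l).2.1} with hR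
  have hRc : R.card ≤ n := by
    refine (card_hashPal_le hp hg hr ?_ hne').trans ?_
    · intro d hd
      obtain ⟨v, -, rfl⟩ := List.mem_map.1 hd
      exact Nat.mod_lt _ hq
    · rw [hl, List.length_map, length_seg (by omega)]; omega
  set B := {v : Fin W | (v : ℕ) % (p * p) ∈ R}.toFinset with hB
  have hBc : B.card * (p * p) ≤ 2 * n * W := by
    refine (card_mod_mem_le hW R).trans ?_
    gcongr
  -- The fingerprints with number `9 * k + j`, `j < 9`, are exactly those of the digit `k`.
  let f : Fin 9 ↪ Fin T := ⟨fun j => ⟨9 * k + j, by omega⟩, fun x y h => by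
    simp only [Fin.mk.injEq] at h; ext; omega⟩
  have h := card_forall_mem_le (Finset.univ.map f) B hBc
  rw [Finset.card_map, Finset.card_univ, Fintype.card_fin, Fintype.card_fin] at h
  refine le_trans (Nat.mul_le_mul_right _ (Finset.card_le_card ?_)) h
  intro r hr
  simp only [Set.mem_toFinset, Set.mem_ofPred_eq] at hr ⊢
  intro x hx
  obtain ⟨j, -, rfl⟩ := Finset.mem_map.1 hx
  have h1 := hr (9 * k + j) (by omega)
  have h2 : (9 * k + (j : ℕ)) / 9 = k := by omega
  rw [h2, points_eq _ _ _ (by omega)] at h1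
  rw [hB, Set.mem_toFinset, Set.mem_ofPred_eq, hR, Finset.mem_filter]
  exact ⟨Finset.mem_range.2 (Nat.mod_lt _ hq), h1⟩

-- Union bound over the `n * n` pairs of a start and an end; the hypothesis on `p` makes each
-- acceptance have probability at most `1 / n ^ 3`.
open Classical in
theorem card_fooled_le {p g a n W T : ℕ} (hp : p.Prime) (hg : g < p) (hr : NonRes p g)
    (hW : p * p ≤ W) (hT : 9 * a ≤ T) {S : List ℕ} (hS : ∀ v ∈ S, v < (p * p) ^ a)
    (hn : S.length = n) (hn0 : 0 < n) (hq : n ^ 3 * (2 * n) ^ 9 ≤ (p * p) ^ 9) :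
    {r : Fin T → Fin W | Fooled p g a (points (p * p) r) S}.toFinset.card * n ≤ W ^ T := by
  set A : ℕ × ℕ → Finset (Fin T → Fin W) := fun ci =>
    if (seg S ci.1 (ci.2 + 1)).reverse ≠ seg S ci.1 (ci.2 + 1) then
      {r : Fin T → Fin W | Accept p g a (points (p * p) r) S ci.1 (ci.2 + 1)}.toFinset
    else ∅ with hA
  have hA' : ∀ ci ∈ Finset.range n ×ˢ Finset.range n,
      (A ci).card * (p * p) ^ 9 ≤ (2 * n) ^ 9 * W ^ T := by
    intro ci hci
    simp only [Finset.mem_product, Finset.mem_range] at hci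
    simp only [hA]
    split_ifs with h
    · exact card_accept_le hp hg hr hW hT hS hn hci.2 h
    · simp
  have h1 : {r : Fin T → Fin W | Fooled p g a (points (p * p) r) S}.toFinset.card * (p * p) ^ 9 ≤
      n * n * ((2 * n) ^ 9 * W ^ T) := by
    calc _ ≤ ((Finset.range n ×ˢ Finset.range n).biUnion A).card * (p * p) ^ 9 := by
          refine Nat.mul_le_mul_right _ (Finset.card_le_card ?_)
          intro r hr
          simp only [Set.mem_toFinset, Set.mem_ofPred_eq] at hr
          obtain ⟨c, hc, i, hi, hne, hacc⟩ := hr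
          refine Finset.mem_biUnion.2 ⟨(c, i), by simp [← hn, hc, hi], ?_⟩
          simp [hA, hne, hacc]
      _ ≤ (∑ ci ∈ Finset.range n ×ˢ Finset.range n, (A ci).card) * (p * p) ^ 9 :=
          Nat.mul_le_mul_right _ Finset.card_biUnion_le
      _ ≤ ∑ ci ∈ Finset.range n ×ˢ Finset.range n, (2 * n) ^ 9 * W ^ T := by
          rw [Finset.sum_mul]; exact Finset.sum_le_sum hA'
      _ = _ := by simp
  -- Multiplying by this factor completes the left side to `n ^ 3 * (2 * n) ^ 9`, the quantity
  -- bounded by `hq`.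
  have h2 : 0 < n * n * (2 * n) ^ 9 := by positivity
  refine Nat.le_of_mul_le_mul_left ?_ h2
  calc _ = {r : Fin T → Fin W | Fooled p g a (points (p * p) r) S}.toFinset.card *
        (n ^ 3 * (2 * n) ^ 9) := by ring
    _ ≤ _ := Nat.mul_le_mul_left _ hq
    _ ≤ _ := h1
    _ = _ := by ring

end PalStream

namespace PalStream

/-! ## Longest palindromes -/

theorem bddAbove_isPal (S : List ℕ) (m : ℕ) : BddAbove {l | IsPal S m l} :=
  ⟨S.length, fun l hl => by have := hl.2.1; omega⟩

theorem IsPal.le_ell {S : List ℕ} {m l : ℕ} (h : IsPal S m l) : l ≤ ell S m :=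
  le_csSup (bddAbove_isPal S m) h

theorem isPal_ell {S : List ℕ} {m : ℕ} (hm : m ≤ S.length) : IsPal S m (ell S m) :=
  Nat.sSup_mem (s := {l | IsPal S m l})
    ⟨0, show IsPal S m 0 from ⟨Nat.zero_le _, by omega, fun i hi hi' => by omega⟩⟩
    (bddAbove_isPal S m)

theorem exists_isPal_ellMax (S : List ℕ) : ∃ m, IsPal S m (ellMax S) := by
  obtain ⟨m, hm, h⟩ := Finset.exists_mem_eq_sup (Finset.range (S.length + 1)) (by simp) (ell S)
  refine ⟨m, ?_⟩
  rw [ellMax, h]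
  exact isPal_ell (by simpa [Nat.lt_succ_iff] using hm)

/-! ## Checkpoints -/

/-- The checkpoint before step `i` in a slot that is renewed whenever the position is `o` modulo
`P`. -/
def checkpoint (P o : ℕ) : ℕ → ℕ
  | 0 => 0
  | i + 1 => if i = 0 ∨ i % P = o then i else checkpoint P o i

theorem checkpoint_lt (P o i : ℕ) : checkpoint P o (i + 1) < i + 1 := by
  induction i with
  | zero => simp [checkpoint]
  | succ i ih =>
    rw [checkpoint]
    split_ifs <;> omega

/-- The next renewal after position `c` happens at `c + P` and takes effect only one step later, so
the distance `d = P` is still allowed. -/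
theorem checkpoint_eq {P o c : ℕ} (hc : c % P = o) :
    ∀ d, 0 < d → d ≤ P → checkpoint P o (c + d) = c := by
  intro d
  induction d with
  | zero => intro h; omega
  | succ d ih =>
    intro _ hd
    rw [← Nat.add_assoc, checkpoint]
    by_cases h0 : d = 0
    · subst h0; simp [hc]
    · rw [if_neg, ih (by omega) (by omega)]
      rintro (h | h)
      · omega
      · rw [← hc] at h
        have h1 : (c + d) ≡ c + 0 [MOD P] := h
        have h2 := Nat.ModEq.add_left_cancel' c h1
        have h3 := Nat.mod_eq_of_lt (show d < P by omega)
        rw [Nat.ModEq, h3, Nat.zero_mod] at h2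
        exact h0 h2

/-- The checkpoint in slot number `j`: there are `B` slots for each power of two. -/
def slot (B j i : ℕ) : ℕ := checkpoint (B * 2 ^ (j / B)) (j % B * 2 ^ (j / B)) i

/-- Every interval `(m - l, m + l]` has an almost as long subinterval with the same midpoint that
starts at a checkpoint present when its end is reached. -/
theorem exists_slot {n K B m l : ℕ} (hK : 1 ≤ K) (hB : B = 4 * (K + 1)) (hl : 0 < l)
    (hm : l ≤ m) (hn : m + l ≤ n) :
    ∃ j < B * (Nat.log 2 n + 1), ∃ c h, 0 < h ∧ h ≤ l ∧ m = c + h ∧ K * l ≤ (K + 1) * h ∧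
      slot B j (c + 2 * h) = c := by
  -- The largest level whose spacing trims at most `l / (K + 1)` symbols per side; level `0` always
  -- qualifies, since it trims none.
  set k := Nat.findGreatest (fun k => (K + 1) * (2 ^ k - 1) ≤ l) (Nat.log 2 n) with hk
  have hk1 : (K + 1) * (2 ^ k - 1) ≤ l :=
    Nat.findGreatest_spec (P := fun k => (K + 1) * (2 ^ k - 1) ≤ l) (Nat.zero_le _) (by simp)
  have hk2 : k ≤ Nat.log 2 n := Nat.findGreatest_le _
  have hw : 0 < 2 ^ k := by positivity
  -- The lifetime of a slot covers the palindrome. On the top level `2 * l ≤ n < 2 * 2 ^ k`; below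
  -- it, level `k + 1` fails, so `l < (K + 1) * 2 ^ (k + 1)`, which is where the `4` in `B` comes
  -- from.
  have hk3 : 2 * l ≤ B * 2 ^ k := by
    rcases hk2.eq_or_lt with h | h
    · have h1 := Nat.lt_pow_succ_log_self (b := 2) (by norm_num) n
      rw [← h, Nat.succ_eq_add_one, pow_succ] at h1
      rw [hB]
      nlinarith
    · have h1 := Nat.findGreatest_is_greatest (P := fun k => (K + 1) * (2 ^ k - 1) ≤ l)
        (show k < k + 1 by omega) (by omega : k + 1 ≤ Nat.log 2 n)
      have h2 : (K + 1) * (2 ^ (k + 1) - 1) ≤ (K + 1) * 2 ^ (k + 1) :=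
        Nat.mul_le_mul_left _ (Nat.sub_le _ _)
      rw [hB]
      rw [pow_succ] at h2
      simp only [not_le] at h1
      rw [pow_succ] at h1
      nlinarith
  set w := 2 ^ k with hwk
  have hB0 : 0 < B := by omega
  -- Division rounded up: `u * w` is the first multiple of `w` that is at least `m - l`.
  set u := (m - l + (w - 1)) / w with hu
  have hc1 : m - l ≤ u * w := by
    have h1 := Nat.mod_add_div (m - l + (w - 1)) w
    have h2 := Nat.mod_lt (m - l + (w - 1)) hw
    rw [← hu, Nat.mul_comm w u] at h1
    omega
  have hc2 : u * w ≤ m - l + (w - 1) := Nat.div_mul_le_self _ _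
  have hw1 : w - 1 ≤ l := by nlinarith
  obtain ⟨h, hh⟩ : ∃ h, m = u * w + h := ⟨m - u * w, by omega⟩
  have hh2 : l ≤ h + (w - 1) := by omega
  have hKl : K * l ≤ (K + 1) * h := by nlinarith
  have hh0 : 0 < h := by
    rcases Nat.eq_zero_or_pos h with h0 | h0
    · subst h0; nlinarith
    · exact h0
  have hub : u % B < B := Nat.mod_lt _ hB0
  refine ⟨k * B + u % B, ?_, u * w, h, hh0, by omega, hh, hKl, ?_⟩
  · calc k * B + u % B < k * B + B := by omega
      _ = B * (k + 1) := by ring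
      _ ≤ _ := Nat.mul_le_mul_left _ (by omega)
  · have e1 : (k * B + u % B) / B = k := by
      rw [Nat.mul_comm, Nat.mul_add_div hB0, Nat.div_eq_of_lt hub, Nat.add_zero]
    have e2 : (k * B + u % B) % B = u % B := by
      rw [Nat.mul_comm, Nat.mul_add_mod, Nat.mod_mod]
    rw [slot, e1, e2, ← hwk]
    apply checkpoint_eq
    · rw [Nat.mul_mod_mul_right]
    · omega
    · omega

/-- `best` and `mid` are sound: they describe an accepted segment. -/
def Sound (p g a : ℕ) (X : ℕ → ℕ) (S : List ℕ) (best mid : ℕ) : Prop :=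
  1 ≤ mid ∧ mid ≤ S.length ∧ (0 < best → ∃ c, mid = c + best ∧ c + 2 * best ≤ S.length ∧
    Accept p g a X S c (c + 2 * best))

/-- `best` is at least half the length of every accepted segment of even length that starts in slot
`j` when `i + 1` symbols have been read. -/
def Covers (p g a : ℕ) (X : ℕ → ℕ) (S : List ℕ) (B best i j : ℕ) : Prop :=
  ∀ h, i + 1 = slot B j (i + 1) + 2 * h → Accept p g a X S (slot B j (i + 1)) (i + 1) → h ≤ best

/-- When no segment fools the points, acceptance means palindrome, so soundness bounds `best` by the
true length at `mid`. Conversely the trimmed longest palindrome is certainly accepted, which gives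
`K * ellMax S ≤ (K + 1) * best`. -/
theorem reports_of_covers {p g a K B best mid : ℕ} {X : ℕ → ℕ} {S : List ℕ} {ε : ℝ}
    (hp : 1 < p) (hε : 0 < ε) (hK : K = encodeEps S.length ε) (hn : 2 ≤ S.length)
    (hB : B = 4 * (K + 1)) (hs : Sound p g a X S best mid)
    (hc : ∀ i < S.length, ∀ j < B * (Nat.log 2 S.length + 1), Covers p g a X S B best i j)
    (hf : ¬ Fooled p g a X S) : Reports S ε [mid, best] := by
  obtain ⟨h1, h2, h3⟩ := hs
  have hbest : best ≤ ell S mid ∧ 2 * best ≤ S.length := by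
    rcases Nat.eq_zero_or_pos best with h0 | h0
    · subst h0; simp
    · obtain ⟨c, rfl, hc2, hacc⟩ := h3 h0
      refine ⟨IsPal.le_ell ((isPal_iff_reverse hc2).2 ?_), by omega⟩
      by_contra hne
      refine hf ⟨c, by omega, c + 2 * best - 1, by omega, ?_⟩
      rw [show c + 2 * best - 1 + 1 = c + 2 * best by omega]
      exact ⟨hne, hacc⟩
  refine ⟨mid, best, rfl, h1, h2, hbest.1, ?_⟩
  have hK1 : 1 ≤ K := by
    rw [hK, encodeEps, le_min_iff]
    exact ⟨Nat.one_le_ceil_iff.2 (by positivity), by omega⟩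
  have key : K * ellMax S ≤ (K + 1) * best := by
    obtain ⟨m, hm⟩ := exists_isPal_ellMax S
    rcases Nat.eq_zero_or_pos (ellMax S) with h0 | h0
    · simp [h0]
    · obtain ⟨j, hj, c, h, hh0, hhl, rfl, hKl, hsl⟩ := exists_slot hK1 hB h0 hm.1 hm.2.1
      have hlen := hm.2.1
      refine hKl.trans (Nat.mul_le_mul_left _ ?_)
      have hpal : IsPal S (c + h) h :=
        ⟨by omega, by omega, fun i hi hi' => hm.2.2 i hi (by omega)⟩
      rw [isPal_iff_reverse (by omega)] at hpal
      have := hc (c + 2 * h - 1) (by omega) j hj h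
      rw [show c + 2 * h - 1 + 1 = c + 2 * h by omega, hsl] at this
      exact this rfl (accept_of_reverse hp g a X hpal)
  rw [div_le_iff₀ (by linarith)]
  -- If `K = ⌈1 / ε⌉`, then `(K + 1) / K ≤ 1 + ε`. If `K` is capped at the length of the stream, a
  -- loss of one would give `K ≤ best`, against `2 * best ≤ S.length`.
  rcases le_or_gt ⌈1 / ε⌉₊ S.length with hle | hlt
  · have hKε : K = ⌈1 / ε⌉₊ := by rw [hK, encodeEps, min_eq_left hle]
    have h4 : 1 / ε ≤ (K : ℝ) := hKε ▸ Nat.le_ceil _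
    have h5 : 1 ≤ K * ε := by rwa [div_le_iff₀ hε] at h4
    have h6 : (K : ℝ) * ellMax S ≤ (K + 1) * best := by exact_mod_cast key
    have hKpos : (0 : ℝ) < K := by exact_mod_cast hK1
    have h7 : (0 : ℝ) ≤ best := Nat.cast_nonneg _
    have : (K : ℝ) * ellMax S ≤ K * (best * (1 + ε)) := by nlinarith
    exact le_of_mul_le_mul_left this hKpos
  · have hKε : K = S.length := by rw [hK, encodeEps, min_eq_right hlt.le]
    have h4 : ellMax S ≤ best := by
      by_contra hlt
      push Not at hlt
      have h5 : K * (best + 1) ≤ K * ellMax S := Nat.mul_le_mul_left _ hlt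
      nlinarith [hbest.2]
    have h6 : (ellMax S : ℝ) ≤ best := by exact_mod_cast h4
    have h7 : (0 : ℝ) ≤ best := Nat.cast_nonneg _
    nlinarith

end PalStream

namespace PalStream

/-! ## Program fragments -/

theorem St.wp_mono {W s : ℕ} (p : St) {Q Q' : Store → Prop} (hQ : ∀ h, Q h → Q' h) :
    ∀ h, p.wp W s Q h → p.wp W s Q' h := by
  induction p generalizing Q Q' with
  | skip => exact hQ
  | asg x e => exact fun h ⟨h1, h2, h3, h4⟩ => ⟨h1, h2, h3, hQ _ h4⟩
  | put e f => exact fun h ⟨h1, h2, h3, h4, h5, h6, h7⟩ => ⟨h1, h2, h3, h4, h5, h6, hQ _ h7⟩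
  | read x => exact fun h ⟨h1, v, l, h2, h3, h4⟩ => ⟨h1, v, l, h2, h3, hQ _ h4⟩
  | rand x => exact fun h ⟨h1, v, l, h2, h3, h4⟩ => ⟨h1, v, l, h2, h3, hQ _ h4⟩
  | out x => exact fun h ⟨h1, h2⟩ => ⟨h1, hQ _ h2⟩
  | seq p q hp hq => exact fun h hw => hp (hq hQ) h hw
  | ite e f p q hp hq =>
    rintro h ⟨h1, h2, h3, h4, h5⟩
    refine ⟨h1, h2, h3, h4, ?_⟩
    split_ifs at h5 ⊢
    · exact hp hQ h h5
    · exact hq hQ h h5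

/-- `f 0; f 1; …; f (m - 1)` -/
def St.rep (f : ℕ → St) : ℕ → St
  | 0 => .skip
  | m + 1 => .seq (rep f m) (f m)

theorem St.wp_rep {W s : ℕ} {f : ℕ → St} {I : ℕ → Store → Prop} {m : ℕ}
    (hf : ∀ k < m, ∀ h, I k h → (f k).wp W s (I (k + 1)) h) (h : Store) (h0 : I 0 h) :
    (St.rep f m).wp W s (I m) h := by
  induction m with
  | zero => exact h0
  | succ m ih =>
    exact St.wp_mono _ (hf m (by omega)) h (ih fun k hk => hf k (by omega))

namespace Ex

abbrev add (e f : Ex) : Ex := .bin .add e f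
abbrev sub (e f : Ex) : Ex := .bin .sub e f
abbrev mul (e f : Ex) : Ex := .bin .mul e f
abbrev div (e f : Ex) : Ex := .bin .div e f
abbrev mod (e f : Ex) : Ex := .bin .mod e f

/-- Addition of packed field elements, with the prime in variable `3`. -/
def addE (a b : Ex) : Ex :=
  add (mod (add (mod a (var 3)) (mod b (var 3))) (var 3))
    (mul (var 3) (mod (add (div a (var 3)) (div b (var 3))) (var 3)))

/-- Multiplication of packed field elements, with the non-residue in variable `5`. -/
def mulE (a b : Ex) : Ex :=
  add (mod (add (mul (mod a (var 3)) (mod b (var 3)))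
      (mul (var 5) (mod (mul (div a (var 3)) (div b (var 3))) (var 3)))) (var 3))
    (mul (var 3) (mod (add (mul (mod a (var 3)) (div b (var 3)))
      (mul (div a (var 3)) (mod b (var 3)))) (var 3)))

/-- The quotient of variable `11` by the `k`-th power of variable `6`. -/
def quotE : ℕ → Ex
  | 0 => var 11
  | k + 1 => div (quotE k) (var 6)

theorem val_addE (h : Store) (a b : Ex) :
    (addE a b).val h = addP (h.var 3) (a.val h) (b.val h) := rfl

theorem val_mulE (h : Store) (a b : Ex) :
    (mulE a b).val h = mulP (h.var 3) (h.var 5) (a.val h) (b.val h) := rfl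

theorem val_quotE (h : Store) (k : ℕ) : (quotE k).val h = h.var 11 / h.var 6 ^ k := by
  induction k with
  | zero => simp [quotE, val]
  | succ k ih => simp [quotE, val, Op.eval, ih, Nat.div_div_eq_div_mul, pow_succ]

theorem depth_quotE (k : ℕ) : (quotE k).depth ≤ 2 := by
  induction k with
  | zero => simp [quotE, depth]
  | succ k ih => simp [quotE, depth, ih]

theorem depth_mulE_le (a b : Ex) : (mulE a b).depth ≤ max a.depth b.depth + 6 := by
  simp only [mulE, depth]; omega

theorem depth_addE_le (a b : Ex) : (addE a b).depth ≤ max a.depth b.depth + 6 := by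
  simp only [addE, depth]; omega

theorem ok_quotE {W s : ℕ} {h : Store} (hv : h.var 11 < W) (k : ℕ) : (quotE k).Ok W s h := by
  induction k with
  | zero => simp [quotE, Ok]
  | succ k ih =>
    refine ⟨ih, by simp [Ok], ?_⟩
    rw [val_quotE]
    exact (Nat.div_le_self _ _).trans_lt ((Nat.div_le_self _ _).trans_lt hv)

theorem ok_addE {W s p : ℕ} {h : Store} {a b : Ex} (h3 : h.var 3 = p) (hp : 0 < p)
    (hW : 2 * (p * p) ≤ W) (ha : a.Ok W s h) (hb : b.Ok W s h) (ha' : a.val h < p * p)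
    (hb' : b.val h < p * p) : (addE a b).Ok W s h := by
  have a1 := Nat.mod_lt (a.val h) hp
  have b1 := Nat.mod_lt (b.val h) hp
  have a2 := Nat.div_lt_of_lt_mul ha'
  have b2 := Nat.div_lt_of_lt_mul hb'
  have e1 := Nat.mod_lt (a.val h % p + b.val h % p) hp
  have e2 := Nat.mod_lt (a.val h / p + b.val h / p) hp
  have e3 := pack_lt e1 e2
  have pp : p ≤ p * p := Nat.le_mul_self p
  simp only [addE, Ok, val, Op.eval, h3]
  refine ⟨⟨⟨⟨ha, by simp, ?_⟩, ⟨hb, by simp, ?_⟩, ?_⟩, by simp, ?_⟩, ⟨by simp, ⟨⟨⟨ha, by simp, ?_⟩,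
    ⟨hb, by simp, ?_⟩, ?_⟩, by simp, ?_⟩, ?_⟩, ?_⟩ <;> omega

/-- The product of the two `√g` parts is reduced before it is multiplied by `g`. Each coordinate is
thus a sum of two products below `p * p`, which fits into a word as `2 * (p * p) ≤ W`. -/
theorem ok_mulE {W s p g : ℕ} {h : Store} {a b : Ex} (h3 : h.var 3 = p) (h5 : h.var 5 = g)
    (hp : 0 < p) (hg : g < p) (hW : 2 * (p * p) ≤ W) (ha : a.Ok W s h) (hb : b.Ok W s h)
    (ha' : a.val h < p * p) (hb' : b.val h < p * p) : (mulE a b).Ok W s h := by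
  have a1 := Nat.mod_lt (a.val h) hp
  have b1 := Nat.mod_lt (b.val h) hp
  have a2 := Nat.div_lt_of_lt_mul ha'
  have b2 := Nat.div_lt_of_lt_mul hb'
  have c1 := Nat.mul_lt_mul'' a1 b1
  have c2 := Nat.mul_lt_mul'' a1 b2
  have c3 := Nat.mul_lt_mul'' a2 b1
  have c4 := Nat.mul_lt_mul'' a2 b2
  have d1 := Nat.mod_lt (a.val h / p * (b.val h / p)) hp
  have c5 := Nat.mul_lt_mul'' hg d1
  have e1 := Nat.mod_lt (a.val h % p * (b.val h % p) + g * (a.val h / p * (b.val h / p) % p)) hp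
  have e2 := Nat.mod_lt (a.val h % p * (b.val h / p) + a.val h / p * (b.val h % p)) hp
  have e3 := pack_lt e1 e2
  have pp : p ≤ p * p := Nat.le_mul_self p
  simp only [mulE, Ok, val, Op.eval, h3, h5]
  refine ⟨⟨⟨⟨⟨ha, by simp, ?_⟩, ⟨hb, by simp, ?_⟩, ?_⟩, ⟨by simp, ⟨⟨⟨ha, by simp, ?_⟩,
    ⟨hb, by simp, ?_⟩, ?_⟩, by simp, ?_⟩, ?_⟩, ?_⟩, by simp, ?_⟩,
    ⟨by simp, ⟨⟨⟨⟨ha, by simp, ?_⟩, ⟨hb, by simp, ?_⟩, ?_⟩, ⟨⟨ha, by simp, ?_⟩, ⟨hb, by simp, ?_⟩, ?_⟩,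
    ?_⟩, by simp, ?_⟩, ?_⟩, ?_⟩ <;> omega

end Ex

/-- Naming the assigned value `v` keeps the store of a long straight-line program readable: later
steps see mathematical values instead of nested expressions. -/
theorem St.wp_asg_seq {W s : ℕ} {Q : Store → Prop} {h : Store} {p : St} {x : ℕ} {e : Ex} (v : ℕ)
    (hx : x < 32) (hd : e.depth ≤ 30) (hok : e.Ok W s h) (hv : e.val h = v)
    (hq : p.wp W s Q { h with var := Function.update h.var x v }) :
    (St.seq (.asg x e) p).wp W s Q h :=
  ⟨hx, hd, hok, hv ▸ hq⟩

theorem St.wp_put_seq {W s : ℕ} {Q : Store → Prop} {h : Store} {p : St} {e f : Ex} (x v : ℕ)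
    (hd : e.depth ≤ 30) (hd' : f.depth ≤ 30) (hok : e.Ok W s h) (hok' : f.Ok W s h)
    (hx : e.val h = x) (hv : f.val h = v) (h64 : 64 ≤ x) (hs : x < s)
    (hq : p.wp W s Q { h with arr := Function.update h.arr x v }) :
    (St.seq (.put e f) p).wp W s Q h :=
  ⟨hd, hd', hok, hok', hx ▸ h64, hx ▸ hs, hx ▸ hv ▸ hq⟩

theorem St.wp_ite {W s : ℕ} {Q : Store → Prop} {h : Store} {p q : St} {e f : Ex} (x y : ℕ)
    (hd : e.depth ≤ 30) (hd' : f.depth ≤ 30) (hok : e.Ok W s h) (hok' : f.Ok W s h)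
    (hx : e.val h = x) (hy : f.val h = y) (h1 : x < y → p.wp W s Q h)
    (h2 : ¬ x < y → q.wp W s Q h) : (St.ite e f p q).wp W s Q h := by
  refine ⟨hd, hd', hok, hok', ?_⟩
  rw [hx, hy]
  split_ifs with hc
  · exact h1 hc
  · exact h2 hc

/-! ## Parameters of a run -/

/-- The parameters of a run after the setup phase. -/
structure Params where
  a : ℕ
  n : ℕ
  K : ℕ
  p : ℕ
  g : ℕ
  W : ℕ
  s : ℕ
  S : List ℕ
  X : ℕ → ℕ

namespace Params

variable (c : Params)

/-- The field size. -/
abbrev q : ℕ := c.p * c.p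
/-- The number of slots per level. -/
abbrev B : ℕ := 4 * (c.K + 1)
/-- The number of slots. -/
abbrev M : ℕ := c.B * (Nat.log 2 c.n + 1)
/-- The address of the first slot. -/
abbrev base : ℕ := 64 + 9 * c.a
/-- The number of registers of a slot. -/
abbrev R : ℕ := 27 * c.a + 1

structure Valid : Prop where
  two_le_n : 2 ≤ c.n
  K_le : c.K ≤ c.n
  one_lt_p : 1 < c.p
  p_le : c.p ≤ 4 * c.n
  g_lt : c.g < c.p
  X_lt : ∀ e, c.X e < c.p * c.p
  length_S : c.S.length = c.n
  S_lt : ∀ v ∈ c.S, v < c.W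
  W_large : 100 * (c.n + 1) ^ 3 ≤ c.W
  le_s : c.base + c.M * c.R ≤ c.s
  s_lt : c.s < c.W

theorem Valid.two_q_le {c : Params} (hc : c.Valid) : 2 * (c.p * c.p) ≤ c.W :=
  calc 2 * (c.p * c.p) ≤ 2 * (4 * c.n * (4 * c.n)) := by gcongr <;> exact hc.p_le
    _ = 32 * c.n ^ 2 := by ring
    _ ≤ 100 * (c.n + 1) ^ 3 := by
      refine Nat.mul_le_mul (by norm_num) ?_
      exact (Nat.pow_le_pow_left (Nat.le_succ _) 2).trans
        (Nat.pow_le_pow_right (Nat.succ_pos _) (by norm_num))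
    _ ≤ c.W := hc.W_large

/-- The digits number `k` of the symbols from the checkpoint `st` to position `i`. -/
def digits (e st i : ℕ) : List ℕ := (seg c.S st i).map (dig c.q (e / 9))

/-- The fingerprint number `e` of the symbols from the checkpoint `st` to position `i`. -/
def fp (e st i : ℕ) : ℕ × ℕ × ℕ := hash c.p c.g (c.X e) (c.digits e st i)

end Params

/-! ### Updating one fingerprint -/

/-- The contents of the variables that do not change while a slot is processed. -/
structure Regs (c : Params) (best mid i v t w o : ℕ) (inp : List ℕ) (h : Store) : Prop where
  n : h.var 0 = c.n
  K : h.var 1 = c.K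
  p : h.var 3 = c.p
  g : h.var 5 = c.g
  q : h.var 6 = c.q
  B : h.var 7 = c.B
  best : h.var 8 = best
  mid : h.var 9 = mid
  i : h.var 10 = i
  v : h.var 11 = v
  t : h.var 12 = t
  w : h.var 13 = w
  o : h.var 14 = o
  X : ∀ e < 9 * c.a, h.arr (64 + e) = c.X e
  inp : h.inp = inp
  out : h.out = []

/-- The array cells from `t + 1 + 3 * e` on hold the fingerprint number `e`. -/
def CellRep (c : Params) (arr : ℕ → ℕ) (t e st i : ℕ) : Prop :=
  arr (t + (1 + 3 * e)) = (c.fp e st i).1 ∧ arr (t + (2 + 3 * e)) = (c.fp e st i).2.1 ∧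
    arr (t + (3 + 3 * e)) = (c.fp e st i).2.2

open Ex in
/-- Compute the next value of the fingerprint number `e` of the slot at the address in variable
`12`. -/
def cellCompute (e : ℕ) : St :=
  .seq (.asg 17 (mod (quotE (e / 9)) (var 6))) <|
  .seq (.asg 21 (get (lit (64 + e)))) <|
  .seq (.asg 18 (get (add (var 12) (lit (1 + 3 * e))))) <|
  .seq (.asg 19 (get (add (var 12) (lit (2 + 3 * e))))) <|
  .seq (.asg 20 (get (add (var 12) (lit (3 + 3 * e))))) <|
  .seq (.asg 18 (mulE (var 18) (var 21))) <|
  .seq (.asg 18 (addE (var 18) (var 17))) <|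
  .seq (.asg 17 (mulE (var 17) (var 20))) <|
  .seq (.asg 19 (addE (var 19) (var 17))) <|
  .seq (.asg 20 (mulE (var 20) (var 21))) .skip

open Ex in
/-- Store the computed fingerprint number `e` and compare its two hashes. -/
def cellStore (e : ℕ) : St :=
  .seq (.put (add (var 12) (lit (1 + 3 * e))) (var 18)) <|
  .seq (.put (add (var 12) (lit (2 + 3 * e))) (var 19)) <|
  .seq (.put (add (var 12) (lit (3 + 3 * e))) (var 20)) <|
  .ite (var 18) (var 19) (.asg 16 (lit 0))
    (.ite (var 19) (var 18) (.asg 16 (lit 0)) .skip)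

/-- Update the fingerprint number `e` of the slot at the address in variable `12`. -/
def cellCode (e : ℕ) : St := .seq (cellCompute e) (cellStore e)

/-- The state after `k` fingerprints of the slot at `t` have been updated. -/
structure CellInv (c : Params) (arr : ℕ → ℕ) (best mid i v t w o st : ℕ) (inp : List ℕ) (k : ℕ)
    (h : Store) : Prop where
  regs : Regs c best mid i v t w o inp h
  start : h.var 15 = st
  ok : (h.var 16 = 1 ∧ ∀ e < k, HashPal c.p c.g (c.X e) (c.digits e st (i + 1))) ∨
    (h.var 16 = 0 ∧ ¬ ∀ e < k, HashPal c.p c.g (c.X e) (c.digits e st (i + 1)))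
  cells : ∀ e < 9 * c.a, CellRep c h.arr t e st (if e < k then i + 1 else i)
  -- The cell at `t` itself is included among the unchanged ones: it holds the checkpoint, which
  -- must survive the fingerprint updates.
  frame : ∀ x, x ≤ t ∨ t + c.R ≤ x → h.arr x = arr x

theorem Params.fp_succ (c : Params) (hc : c.Valid) {e st i : ℕ} (hst : st ≤ i) (hi : i < c.n)
    {v : ℕ} (hv : c.S[i]? = some v) :
    c.fp e st (i + 1) = hashStep c.p c.g (c.X e) (c.fp e st i) (v / c.q ^ (e / 9) % c.q) := by
  have hi' : i < c.S.length := hc.length_S ▸ hi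
  have hv' : c.S[i] = v := by
    rw [List.getElem?_eq_getElem hi'] at hv; exact Option.some.inj hv
  rw [Params.fp, Params.digits, seg_succ hst hi', List.map_append, List.map_singleton, hash_snoc,
    hv']
  rfl

theorem cellCompute_wp (c : Params) (hc : c.Valid) {arr : ℕ → ℕ} {best mid i v t w o st : ℕ}
    {inp : List ℕ} {k : ℕ} (hk : k < 9 * c.a) (ht : c.base ≤ t) (ht' : t + c.R ≤ c.s)
    (hst : st ≤ i) (hi : i < c.n) (hv : c.S[i]? = some v) (h : Store)
    (hI : CellInv c arr best mid i v t w o st inp k h) :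
    (cellCompute k).wp c.W c.s (fun h' => CellInv c arr best mid i v t w o st inp k h' ∧
      h'.var 18 = (c.fp k st (i + 1)).1 ∧ h'.var 19 = (c.fp k st (i + 1)).2.1 ∧
      h'.var 20 = (c.fp k st (i + 1)).2.2) h := by
  obtain ⟨⟨rn, rK, rp, rg, rq, rB, rbest, rmid, ri, rv, rt, rw', ro, rX, rinp, rout⟩, hst15, hok,
    hcells, hframe⟩ := hI
  have hp0 : 0 < c.p := by have := hc.one_lt_p; omega
  have hvW : v < c.W := hc.S_lt v (List.mem_of_getElem? hv)
  have hsW := hc.s_lt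
  have hqW := hc.two_q_le
  have hfp := hash_lt hc.one_lt_p c.g (c.X k) (c.digits k st i)
  change (c.fp k st i).1 < _ ∧ (c.fp k st i).2.1 < _ ∧ (c.fp k st i).2.2 < _ at hfp
  obtain ⟨f1, f2, f3⟩ := hfp
  obtain ⟨c1, c2, c3⟩ := hcells k hk
  simp only [lt_irrefl, if_false] at c1 c2 c3
  have hfs := c.fp_succ hc (e := k) hst hi hv
  have hXk := hc.X_lt k
  have hd : v / c.q ^ (k / 9) % c.q < c.p * c.p := Nat.mod_lt _ (Nat.mul_pos hp0 hp0)
  have b1 : t + (3 + 3 * k) < t + c.R := by simp only [Params.R]; omega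
  have b0 := ht
  simp only [Params.base] at b0
  set d := v / c.q ^ (k / 9) % c.q with hdd
  have l1 : ∀ x y, addP c.p x y < c.p * c.p := addP_lt hp0
  have l2 : ∀ x y, mulP c.p c.g x y < c.p * c.p := mulP_lt hp0 c.g
  have dq := Ex.depth_quotE (k / 9)
  have xk := rX k hk
  have e1 : addP c.p (mulP c.p c.g (c.fp k st i).1 (c.X k)) d = (c.fp k st (i + 1)).1 := by
    rw [hfs]; rfl
  have e2 : addP c.p (c.fp k st i).2.1 (mulP c.p c.g d (c.fp k st i).2.2) =
    (c.fp k st (i + 1)).2.1 := by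
    rw [hfs]; rfl
  have e3 : mulP c.p c.g (c.fp k st i).2.2 (c.X k) = (c.fp k st (i + 1)).2.2 := by
    rw [hfs]; rfl
  apply St.wp_asg_seq d (by norm_num) (by simp only [Ex.depth]; omega)
  · refine ⟨Ex.ok_quotE (by omega) _, by norm_num [Ex.Ok], ?_⟩
    simp only [Ex.val, Ex.val_quotE, Op.eval, rv, rq]
    exact hd.trans_le (by omega)
  · simp only [Ex.val, Ex.val_quotE, Op.eval, rv, rq, hdd]
  apply St.wp_asg_seq (c.X k) (by norm_num) (by simp [Ex.depth])
  · simp [Ex.Ok, Ex.val]; omega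
  · simpa [Ex.val] using xk
  apply St.wp_asg_seq (c.fp k st i).1 (by norm_num) (by simp [Ex.depth])
  · simp [Ex.Ok, Ex.val, Op.eval, rt]; omega
  · simpa [Ex.val, Op.eval, rt] using c1
  apply St.wp_asg_seq (c.fp k st i).2.1 (by norm_num) (by simp [Ex.depth])
  · simp [Ex.Ok, Ex.val, Op.eval, rt]; omega
  · simpa [Ex.val, Op.eval, rt] using c2
  apply St.wp_asg_seq (c.fp k st i).2.2 (by norm_num) (by simp [Ex.depth])
  · simp [Ex.Ok, Ex.val, Op.eval, rt]; omega
  · simpa [Ex.val, Op.eval, rt] using c3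
  apply St.wp_asg_seq (mulP c.p c.g (c.fp k st i).1 (c.X k)) (by norm_num)
    ((Ex.depth_mulE_le _ _).trans (by simp [Ex.depth]))
  · apply Ex.ok_mulE _ _ hp0 hc.g_lt hqW <;>
      simp [Ex.Ok, Ex.val, rp, rg, hXk, f1]
  · simp [Ex.val_mulE, Ex.val, rp, rg]
  apply St.wp_asg_seq (c.fp k st (i + 1)).1 (by norm_num)
    ((Ex.depth_addE_le _ _).trans (by simp [Ex.depth]))
  · apply Ex.ok_addE _ hp0 hqW <;>
      simp [Ex.Ok, Ex.val, rp, hd, l2]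
  · simp [Ex.val_addE, Ex.val, rp, e1]
  apply St.wp_asg_seq (mulP c.p c.g d (c.fp k st i).2.2) (by norm_num)
    ((Ex.depth_mulE_le _ _).trans (by simp [Ex.depth]))
  · apply Ex.ok_mulE _ _ hp0 hc.g_lt hqW <;>
      simp [Ex.Ok, Ex.val, rp, rg, hd, f3]
  · simp [Ex.val_mulE, Ex.val, rp, rg]
  apply St.wp_asg_seq (c.fp k st (i + 1)).2.1 (by norm_num)
    ((Ex.depth_addE_le _ _).trans (by simp [Ex.depth]))
  · apply Ex.ok_addE _ hp0 hqW <;>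
      simp [Ex.Ok, Ex.val, rp, l2, f2]
  · simp [Ex.val_addE, Ex.val, rp, e2]
  apply St.wp_asg_seq (c.fp k st (i + 1)).2.2 (by norm_num)
    ((Ex.depth_mulE_le _ _).trans (by simp [Ex.depth]))
  · apply Ex.ok_mulE _ _ hp0 hc.g_lt hqW <;>
      simp [Ex.Ok, Ex.val, rp, rg, hXk, f3]
  · simp [Ex.val_mulE, Ex.val, rp, rg, e3]
  refine ⟨⟨?_, by simpa using hst15, by simpa using hok, hcells, hframe⟩, by simp, by simp, by simp⟩
  constructor <;> assumption

theorem cellStore_wp (c : Params) (hc : c.Valid) {arr : ℕ → ℕ} {best mid i v t w o st : ℕ}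
    {inp : List ℕ} {k : ℕ} (hk : k < 9 * c.a) (ht : c.base ≤ t) (ht' : t + c.R ≤ c.s) (h : Store)
    (hI : CellInv c arr best mid i v t w o st inp k h) (v18 : h.var 18 = (c.fp k st (i + 1)).1)
    (v19 : h.var 19 = (c.fp k st (i + 1)).2.1) (v20 : h.var 20 = (c.fp k st (i + 1)).2.2) :
    (cellStore k).wp c.W c.s (CellInv c arr best mid i v t w o st inp (k + 1)) h := by
  obtain ⟨⟨rn, rK, rp, rg, rq, rB, rbest, rmid, ri, rv, rt, rw', ro, rX, rinp, rout⟩, hst15, hok,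
    hcells, hframe⟩ := hI
  have hsW := hc.s_lt
  have b1 : t + (3 + 3 * k) < t + c.R := by simp only [Params.R]; omega
  have b0 := ht
  simp only [Params.base] at b0
  have depth_le : ∀ x, (Ex.add (.var 12) (.lit x)).depth ≤ 30 := by simp [Ex.depth]
  refine St.wp_put_seq (t + (1 + 3 * k)) (c.fp k st (i + 1)).1 (depth_le _)
    (by simp [Ex.depth]) ⟨by simp [Ex.Ok], ?_, ?_⟩ (by simp [Ex.Ok]) ?_ (v18) (by omega) (by omega) ?_
  · simp only [Ex.Ok]; omega
  · simp only [Ex.val, Op.eval, rt]; omega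
  · simp only [Ex.val, Op.eval, rt]
  refine St.wp_put_seq (t + (2 + 3 * k)) (c.fp k st (i + 1)).2.1 (depth_le _)
    (by simp [Ex.depth]) ⟨by simp [Ex.Ok], ?_, ?_⟩ (by simp [Ex.Ok]) ?_ (v19) (by omega) (by omega) ?_
  · simp only [Ex.Ok]; omega
  · simp only [Ex.val, Op.eval, rt]; omega
  · simp only [Ex.val, Op.eval, rt]
  refine St.wp_put_seq (t + (3 + 3 * k)) (c.fp k st (i + 1)).2.2 (depth_le _)
    (by simp [Ex.depth]) ⟨by simp [Ex.Ok], ?_, ?_⟩ (by simp [Ex.Ok]) ?_ (v20) (by omega) (by omega) ?_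
  · simp only [Ex.Ok]; omega
  · simp only [Ex.val, Op.eval, rt]; omega
  · simp only [Ex.val, Op.eval, rt]
  have hcells' : ∀ e < 9 * c.a, CellRep c (Function.update (Function.update (Function.update h.arr
      (t + (1 + 3 * k)) (c.fp k st (i + 1)).1) (t + (2 + 3 * k)) (c.fp k st (i + 1)).2.1)
      (t + (3 + 3 * k)) (c.fp k st (i + 1)).2.2) t e st (if e < k + 1 then i + 1 else i) := by
    intro e he
    by_cases hek : e = k
    · subst hek
      simp [CellRep]
    · have := hcells e he
      have h1 : (e < k + 1) ↔ (e < k) := by omega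
      simp only [h1]
      have n1 : e ≠ k := hek
      unfold CellRep at this ⊢
      rw [Function.update_of_ne (by omega), Function.update_of_ne (by omega),
        Function.update_of_ne (by omega), Function.update_of_ne (by omega),
        Function.update_of_ne (by omega), Function.update_of_ne (by omega),
        Function.update_of_ne (by omega), Function.update_of_ne (by omega),
        Function.update_of_ne (by omega)]
      exact this
  have hframe' : ∀ x, x ≤ t ∨ t + c.R ≤ x → Function.update (Function.update (Function.update h.arr
      (t + (1 + 3 * k)) (c.fp k st (i + 1)).1) (t + (2 + 3 * k)) (c.fp k st (i + 1)).2.1)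
      (t + (3 + 3 * k)) (c.fp k st (i + 1)).2.2 x = arr x := by
    intro x hx
    rw [Function.update_of_ne (by omega), Function.update_of_ne (by omega),
        Function.update_of_ne (by omega), hframe x hx]
  have hX' : ∀ e < 9 * c.a, Function.update (Function.update (Function.update h.arr
      (t + (1 + 3 * k)) (c.fp k st (i + 1)).1) (t + (2 + 3 * k)) (c.fp k st (i + 1)).2.1)
      (t + (3 + 3 * k)) (c.fp k st (i + 1)).2.2 (64 + e) = c.X e := by
    intro e he
    rw [Function.update_of_ne (by omega), Function.update_of_ne (by omega),
        Function.update_of_ne (by omega), rX e he]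
  have hsplit : ∀ P : ℕ → Prop, (∀ e < k + 1, P e) ↔ (∀ e < k, P e) ∧ P k :=
    fun P => Nat.forall_lt_succ_right
  have hW0 : 0 < c.W := by omega
  have hpal : HashPal c.p c.g (c.X k) (c.digits k st (i + 1)) ↔
    (c.fp k st (i + 1)).1 = (c.fp k st (i + 1)).2.1 := Iff.rfl
  refine St.wp_ite (c.fp k st (i + 1)).1 (c.fp k st (i + 1)).2.1 (by simp [Ex.depth])
    (by simp [Ex.depth]) (by simp [Ex.Ok]) (by simp [Ex.Ok]) v18 v19 (fun hlt => ?_) fun hlt => ?_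
  · refine ⟨by norm_num, by simp [Ex.depth], hW0, ?_⟩
    refine ⟨?_, by simpa using hst15, Or.inr ⟨by simp [Ex.val], ?_⟩, hcells', hframe'⟩
    · constructor <;> assumption
    · rw [hsplit, hpal]; rintro ⟨-, h2⟩; omega
  · refine St.wp_ite (c.fp k st (i + 1)).2.1 (c.fp k st (i + 1)).1 (by simp [Ex.depth])
      (by simp [Ex.depth]) (by simp [Ex.Ok]) (by simp [Ex.Ok]) v19 v18 (fun hlt' => ?_)
      fun hlt' => ?_
    · refine ⟨by norm_num, by simp [Ex.depth], hW0, ?_⟩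
      refine ⟨?_, by simpa using hst15, Or.inr ⟨by simp [Ex.val], ?_⟩, hcells', hframe'⟩
      · constructor <;> assumption
      · rw [hsplit, hpal]; rintro ⟨-, h2⟩; omega
    · refine ⟨?_, hst15, ?_, hcells', hframe'⟩
      · constructor <;> assumption
      · have : (c.fp k st (i + 1)).1 = (c.fp k st (i + 1)).2.1 := by omega
        simp only [hsplit, hpal, this, and_true]
        exact hok

theorem cellCode_wp (c : Params) (hc : c.Valid) {arr : ℕ → ℕ} {best mid i v t w o st : ℕ}
    {inp : List ℕ} {k : ℕ} (hk : k < 9 * c.a) (ht : c.base ≤ t) (ht' : t + c.R ≤ c.s)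
    (hst : st ≤ i) (hi : i < c.n) (hv : c.S[i]? = some v) (h : Store)
    (hI : CellInv c arr best mid i v t w o st inp k h) :
    (cellCode k).wp c.W c.s (CellInv c arr best mid i v t w o st inp (k + 1)) h :=
  St.wp_mono (cellCompute k) (fun h' (⟨h1, h2, h3, h4⟩ : _ ∧ _ ∧ _ ∧ _) => cellStore_wp c hc hk ht ht' h' h1 h2 h3 h4) h
    (cellCompute_wp c hc hk ht ht' hst hi hv h hI)

end PalStream

/-! ### Processing one slot in one step -/

namespace PalStream

open Ex in
/-- Make the fingerprint number `e` of the slot at the address in variable `12` that of the empty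
list. -/
def resetCell (e : ℕ) : St :=
  .seq (.put (add (var 12) (lit (1 + 3 * e))) (lit 0)) <|
  .seq (.put (add (var 12) (lit (2 + 3 * e))) (lit 0)) <|
  .seq (.put (add (var 12) (lit (3 + 3 * e))) (lit 1)) .skip

open Ex in
/-- Renew the slot at the address in variable `12` if it is due, and load its checkpoint. -/
def slotHead (a : ℕ) : St :=
  .seq (.asg 15 (mod (var 10) (mul (var 7) (var 13)))) <|
  .seq (.ite (var 10) (lit 1) (.asg 15 (var 14)) .skip) <|
  .seq (.ite (var 15) (var 14) .skip (.ite (var 14) (var 15) .skip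
    (.seq (.put (var 12) (var 10)) (.rep resetCell (9 * a))))) <|
  .seq (.asg 16 (lit 1)) (.asg 15 (get (var 12)))

open Ex in
/-- Compare the segment that starts at the checkpoint with the best palindrome so far. -/
def slotCompare : St :=
  .seq (.asg 21 (div (sub (add (var 10) (lit 1)) (var 15)) (lit 2))) <|
  .ite (mul (lit 2) (var 21)) (sub (add (var 10) (lit 1)) (var 15)) .skip
    (.ite (var 16) (lit 1) .skip
      (.ite (var 8) (var 21) (.seq (.asg 8 (var 21)) (.asg 9 (add (var 15) (var 21)))) .skip))

open Ex in
/-- Go to the next slot. -/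
def slotNext (a : ℕ) : St :=
  .seq (.asg 12 (add (var 12) (lit (27 * a + 1)))) <|
  .seq (.asg 14 (add (var 14) (var 13))) <|
  .ite (var 14) (mul (var 7) (var 13)) .skip
    (.seq (.asg 14 (lit 0)) (.asg 13 (add (var 13) (var 13))))

/-- Process one slot. -/
def slotCode (a : ℕ) : St :=
  .seq (slotHead a) (.seq (.rep cellCode (9 * a)) (.seq slotCompare (slotNext a)))

/-- The first `k` fingerprints of the slot at `t` have been reset. -/
structure ResetInv (c : Params) (arr : ℕ → ℕ) (best mid i v t w o : ℕ) (inp : List ℕ) (k : ℕ)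
    (h : Store) : Prop where
  regs : Regs c best mid i v t w o inp h
  start : h.arr t = i
  cells : ∀ e < k, CellRep c h.arr t e i i
  frame : ∀ x, x < t ∨ t + c.R ≤ x → h.arr x = arr x

theorem resetCell_wp (c : Params) (hc : c.Valid) {arr : ℕ → ℕ} {best mid i v t w o : ℕ}
    {inp : List ℕ} {k : ℕ} (hk : k < 9 * c.a) (ht : c.base ≤ t) (ht' : t + c.R ≤ c.s)
    (h : Store) (hI : ResetInv c arr best mid i v t w o inp k h) :
    (resetCell k).wp c.W c.s (ResetInv c arr best mid i v t w o inp (k + 1)) h := by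
  obtain ⟨⟨rn, rK, rp, rg, rq, rB, rbest, rmid, ri, rv, rt, rw', ro, rX, rinp, rout⟩, hst,
    hcells, hframe⟩ := hI
  have hsW := hc.s_lt
  have b1 : t + (3 + 3 * k) < t + c.R := by simp only [Params.R]; omega
  have b0 := ht
  simp only [Params.base] at b0
  have depth_le : ∀ x, (Ex.add (.var 12) (.lit x)).depth ≤ 30 := by simp [Ex.depth]
  refine St.wp_put_seq (t + (1 + 3 * k)) 0 (depth_le _)
    (by simp [Ex.depth]) ⟨by simp [Ex.Ok], ?_, ?_⟩ (by simp only [Ex.Ok]; omega) ?_ rfl (by omega)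
    (by omega) ?_
  · simp only [Ex.Ok]; omega
  · simp only [Ex.val, Op.eval, rt]; omega
  · simp only [Ex.val, Op.eval, rt]
  refine St.wp_put_seq (t + (2 + 3 * k)) 0 (depth_le _)
    (by simp [Ex.depth]) ⟨by simp [Ex.Ok], ?_, ?_⟩ (by simp only [Ex.Ok]; omega) ?_ rfl (by omega)
    (by omega) ?_
  · simp only [Ex.Ok]; omega
  · simp only [Ex.val, Op.eval, rt]; omega
  · simp only [Ex.val, Op.eval, rt]
  refine St.wp_put_seq (t + (3 + 3 * k)) 1 (depth_le _)
    (by simp [Ex.depth]) ⟨by simp [Ex.Ok], ?_, ?_⟩ (by simp only [Ex.Ok]; omega) ?_ rfl (by omega)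
    (by omega) ?_
  · simp only [Ex.Ok]; omega
  · simp only [Ex.val, Op.eval, rt]; omega
  · simp only [Ex.val, Op.eval, rt]
  have hX' : ∀ e < 9 * c.a, Function.update (Function.update (Function.update h.arr
      (t + (1 + 3 * k)) 0) (t + (2 + 3 * k)) 0) (t + (3 + 3 * k)) 1 (64 + e) = c.X e := by
    intro e he
    rw [Function.update_of_ne (by omega), Function.update_of_ne (by omega),
      Function.update_of_ne (by omega), rX e he]
  refine ⟨?_, ?_, ?_, ?_⟩
  · constructor <;> assumption
  · simp only
    rw [Function.update_of_ne (by omega), Function.update_of_ne (by omega),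
      Function.update_of_ne (by omega), hst]
  · intro e he
    by_cases hek : e = k
    · subst hek
      simp [CellRep, Params.fp, Params.digits, seg_self, hash]
    · have := hcells e (by omega)
      have n1 : e ≠ k := hek
      unfold CellRep at this ⊢
      simp only
      rw [Function.update_of_ne (by omega), Function.update_of_ne (by omega),
        Function.update_of_ne (by omega), Function.update_of_ne (by omega),
        Function.update_of_ne (by omega), Function.update_of_ne (by omega),
        Function.update_of_ne (by omega), Function.update_of_ne (by omega),
        Function.update_of_ne (by omega)]
      exact this
  · intro x hx
    simp only
    rw [Function.update_of_ne (by omega), Function.update_of_ne (by omega),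
      Function.update_of_ne (by omega), hframe x hx]

theorem Params.Valid.mul_w_lt {c : Params} (hc : c.Valid) {w : ℕ} (hw : w ≤ c.n) :
    c.B * w < c.W := by
  have h1 : c.B * w ≤ 4 * (c.n + 1) * c.n :=
    Nat.mul_le_mul (Nat.mul_le_mul_left 4 (Nat.succ_le_succ hc.K_le)) hw
  have h2 : 4 * (c.n + 1) * c.n < 100 * (c.n + 1) ^ 3 := by
    have : 0 < (c.n + 1) ^ 2 := by positivity
    nlinarith
  exact (h1.trans_lt h2).trans_le hc.W_large

theorem Params.Valid.n_lt {c : Params} (hc : c.Valid) : 2 * c.n + 2 < c.W := by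
  have h2 : 2 * c.n + 2 < 100 * (c.n + 1) ^ 3 := by
    have : 0 < (c.n + 1) ^ 2 := by positivity
    nlinarith
  exact h2.trans_le hc.W_large

/-- The contents of the slot are assumed only for `0 < i`: every slot is renewed at position `0`, so
the array needs no separate initialisation. -/
theorem slotHead_wp (c : Params) (hc : c.Valid) {best mid i v t w o st : ℕ}
    {inp : List ℕ} (ht : c.base ≤ t) (ht' : t + c.R ≤ c.s) (hi : i < c.n) (hw : w ≤ c.n)
    (h : Store) (hI : Regs c best mid i v t w o inp h)
    (hold : 0 < i → h.arr t = st ∧ ∀ e < 9 * c.a, CellRep c h.arr t e st i) :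
    (slotHead c.a).wp c.W c.s (fun h' => ∃ arr, CellInv c arr best mid i v t w o
      (if i = 0 ∨ i % (c.B * w) = o then i else st) inp 0 h' ∧
      arr t = (if i = 0 ∨ i % (c.B * w) = o then i else st) ∧
      ∀ x, x < t ∨ t + c.R ≤ x → arr x = h.arr x) h := by
  have hI' := hI
  obtain ⟨rn, rK, rp, rg, rq, rB, rbest, rmid, ri, rv, rt, rw', ro, rX, rinp, rout⟩ := hI
  have hsW := hc.s_lt
  have hnW := hc.n_lt
  have hBw := hc.mul_w_lt hw
  have b0 := ht
  simp only [Params.base] at b0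
  have bR : t + 1 ≤ t + c.R := by simp only [Params.R]; omega
  set st' := if i = 0 ∨ i % (c.B * w) = o then i else st with hst'
  have fin : ∀ h1 : Store, Regs c best mid i v t w o inp h1 → h1.arr t = st' →
      (∀ e < 9 * c.a, CellRep c h1.arr t e st' i) →
      (∀ x, x < t ∨ t + c.R ≤ x → h1.arr x = h.arr x) →
      (St.seq (.asg 16 (.lit 1)) (.asg 15 (.get (.var 12)))).wp c.W c.s
        (fun h' => ∃ arr, CellInv c arr best mid i v t w o st' inp 0 h' ∧
          arr t = st' ∧ ∀ x, x < t ∨ t + c.R ≤ x → arr x = h.arr x) h1 := by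
    rintro h1 ⟨rn, rK, rp, rg, rq, rB, rbest, rmid, ri, rv, rt, rw', ro, rX, rinp, rout⟩ h2 h3 h4
    apply St.wp_asg_seq 1 (by norm_num) (by simp [Ex.depth]) (by simp only [Ex.Ok]; omega) rfl
    refine ⟨by norm_num, by simp [Ex.depth], ⟨by simp [Ex.Ok], ?_, ?_⟩, h1.arr, ?_, h2, h4⟩
    · simp [Ex.val, rt]; omega
    · simp [Ex.val, rt]; omega
    refine ⟨?_, ?_, Or.inl ⟨rfl, by simp⟩, by simpa using h3, fun _ _ => rfl⟩
    · constructor <;> assumption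
    · simp [Ex.val, rt, h2]
  have regs15 : ∀ x, Regs c best mid i v t w o inp { h with var := Function.update h.var 15 x } := by
    intro x; constructor <;> assumption
  -- At `i = 0` the value `o` replaces the residue, which makes the equality test succeed and forces
  -- the renewal. Equality is expressed by the failure of both strict comparisons.
  have main : ∀ r, (r = if i = 0 then o else i % (c.B * w)) →
      ((St.ite (.var 15) (.var 14) .skip (.ite (.var 14) (.var 15) .skip
      (.seq (.put (.var 12) (.var 10)) (.rep resetCell (9 * c.a))))).seq
      (St.seq (.asg 16 (.lit 1)) (.asg 15 (.get (.var 12))))).wp c.W c.s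
        (fun h' => ∃ arr, CellInv c arr best mid i v t w o st' inp 0 h' ∧
          arr t = st' ∧ ∀ x, x < t ∨ t + c.R ≤ x → arr x = h.arr x)
          { h with var := Function.update h.var 15 r } := by
    intro r hr
    have keep : r ≠ o → (St.seq (.asg 16 (.lit 1)) (.asg 15 (.get (.var 12)))).wp c.W c.s
        (fun h' => ∃ arr, CellInv c arr best mid i v t w o st' inp 0 h' ∧
          arr t = st' ∧ ∀ x, x < t ∨ t + c.R ≤ x → arr x = h.arr x)
          { h with var := Function.update h.var 15 r } := by
      intro hro
      have hi0 : i ≠ 0 := by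
        intro hi0
        rw [if_pos hi0] at hr
        exact hro hr
      rw [if_neg hi0] at hr
      have e1 : st' = st := by
        rw [hst', if_neg]
        rintro (h1 | h1)
        · exact hi0 h1
        · exact hro (hr.trans h1)
      obtain ⟨o1, o2⟩ := hold (by omega)
      refine fin _ (regs15 r) ?_ ?_ (fun _ _ => rfl)
      · rw [e1]; exact o1
      · rw [e1]; exact o2
    refine St.wp_ite r o (by simp [Ex.depth]) (by simp [Ex.depth]) (by simp [Ex.Ok])
      (by simp [Ex.Ok]) (by simp [Ex.val]) (by simp [Ex.val, ro]) (fun hlt => keep (by omega))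
      fun hlt => ?_
    refine St.wp_ite o r (by simp [Ex.depth]) (by simp [Ex.depth]) (by simp [Ex.Ok])
      (by simp [Ex.Ok]) (by simp [Ex.val, ro]) (by simp [Ex.val]) (fun hlt => keep (by omega))
      fun hlt' => ?_
    have hro : r = o := by omega
    have e1 : st' = i := by
      rw [hst', if_pos]
      by_cases hi0 : i = 0
      · exact Or.inl hi0
      · rw [if_neg hi0] at hr
        exact Or.inr (hr.symm.trans hro)
    refine St.wp_put_seq t i (by simp [Ex.depth]) (by simp [Ex.depth]) (by simp [Ex.Ok])
      (by simp [Ex.Ok]) (by simp [Ex.val, rt]) (by simp [Ex.val, ri]) (by omega) (by omega) ?_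
    have hreset := St.wp_rep (W := c.W) (s := c.s) (f := resetCell) (m := 9 * c.a)
      (I := ResetInv c h.arr best mid i v t w o inp)
      (fun k hk h hI => resetCell_wp c hc hk ht ht' h hI)
      { h with var := Function.update h.var 15 r, arr := Function.update h.arr t i } (by
        refine ⟨?_, by simp, fun e he => absurd he (by omega), fun x hx => ?_⟩
        · have hX' : ∀ e < 9 * c.a, Function.update h.arr t i (64 + e) = c.X e := by
            intro e he
            rw [Function.update_of_ne (by omega), rX e he]
          constructor <;> assumption
        · simp only
          rw [Function.update_of_ne (by omega)])
    refine St.wp_mono _ ?_ _ hreset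
    rintro h1 ⟨q1, q2, q3, q4⟩
    refine fin h1 q1 (q2.trans e1.symm) ?_ q4
    rw [e1]; exact q3
  apply St.wp_asg_seq (i % (c.B * w)) (by norm_num) (by simp [Ex.depth])
  · refine ⟨by simp [Ex.Ok], ⟨by simp [Ex.Ok], by simp [Ex.Ok], ?_⟩, ?_⟩
    · simpa only [Ex.val, Op.eval, rB, rw'] using hBw
    · simp only [Ex.val, Op.eval, ri]
      exact (Nat.mod_le _ _).trans_lt (by omega)
  · simp only [Ex.val, Op.eval, rB, rw', ri]
  refine St.wp_ite i 1 (by simp [Ex.depth]) (by simp [Ex.depth]) (by simp [Ex.Ok])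
      (by simp only [Ex.Ok]; omega) (by simp [Ex.val, ri]) rfl (fun hlt => ?_) fun hlt => ?_
  · refine ⟨by norm_num, by simp [Ex.depth], by simp [Ex.Ok], ?_⟩
    have := main o (by rw [if_pos (by omega)])
    simpa [Ex.val, ro] using this
  · exact main _ (by rw [if_neg (by omega)])

/-- Odd lengths are recognised by `2 * (len / 2) < len`. For an even length, either the flag is down
and the segment is not accepted, or `best` ends up at least as large; in both cases the record stays
sound. -/
theorem slotCompare_wp (c : Params) (hc : c.Valid) {arr : ℕ → ℕ} {best mid i v t w o st : ℕ}
    {inp : List ℕ} (hst : st ≤ i) (hi : i < c.n) (h : Store)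
    (hI : CellInv c arr best mid i v t w o st inp (9 * c.a) h)
    (hs : Sound c.p c.g c.a c.X c.S best mid) :
    slotCompare.wp c.W c.s (fun h' => ∃ best' mid', Regs c best' mid' i v t w o inp h' ∧
      h'.arr = h.arr ∧ best ≤ best' ∧ Sound c.p c.g c.a c.X c.S best' mid' ∧
      ∀ l, i + 1 = st + 2 * l → Accept c.p c.g c.a c.X c.S st (i + 1) → l ≤ best') h := by
  obtain ⟨hI', hst15, hok, -, -⟩ := hI
  have hI := hI'
  obtain ⟨rn, rK, rp, rg, rq, rB, rbest, rmid, ri, rv, rt, rw', ro, rX, rinp, rout⟩ := hI'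
  have hnW := hc.n_lt
  have hlen := hc.length_S
  have hacc : Accept c.p c.g c.a c.X c.S st (i + 1) ↔
    ∀ e < 9 * c.a, HashPal c.p c.g (c.X e) (c.digits e st (i + 1)) := Iff.rfl
  rw [← hacc] at hok
  set len := (i + 1 - st) / 2 with hlen'
  have regs21 : Regs c best mid i v t w o inp { h with var := Function.update h.var 21 len } := by
    constructor <;> assumption
  have okd : ∀ h' : Store, h'.var 10 = i → h'.var 15 = st →
      (Ex.sub (.add (.var 10) (.lit 1)) (.var 15)).Ok c.W c.s h' := by
    intro h' h1 h2
    refine ⟨⟨by simp [Ex.Ok], by simp only [Ex.Ok]; omega, ?_⟩, by simp [Ex.Ok], ?_⟩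
    · simp only [Ex.val, Op.eval, h1]; omega
    · simp only [Ex.val, Op.eval, h1, h2]; omega
  apply St.wp_asg_seq len (by norm_num) (by simp [Ex.depth])
  · refine ⟨okd h ri hst15, by simp only [Ex.Ok]; omega, ?_⟩
    simp only [Ex.val, Op.eval, ri, hst15]; omega
  · simp only [Ex.val, Op.eval, ri, hst15, hlen']
  refine St.wp_ite (2 * len) (i + 1 - st) (by simp [Ex.depth]) (by simp [Ex.depth])
    ⟨by simp only [Ex.Ok]; omega, by simp [Ex.Ok], ?_⟩ (okd _ ri hst15) (by simp [Ex.val, Op.eval])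
    (by simp [Ex.val, Op.eval, ri, hst15]) (fun hlt => ?_) fun hlt => ?_
  · simp only [Ex.val, Op.eval, Function.update_self]; omega
  · exact ⟨best, mid, regs21, rfl, le_rfl, hs, fun l hl _ => by omega⟩
  refine St.wp_ite (h.var 16) 1 (by simp [Ex.depth]) (by simp [Ex.depth])
    (by simp [Ex.Ok]) (by simp only [Ex.Ok]; omega) (by simp [Ex.val]) rfl (fun hlt' => ?_)
    fun hlt' => ?_
  · refine ⟨best, mid, regs21, rfl, le_rfl, hs, fun l hl hA => ?_⟩
    rcases hok with hok | hok
    · omega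
    · exact absurd hA hok.2
  have hA : Accept c.p c.g c.a c.X c.S st (i + 1) := by
    rcases hok with hok | hok
    · exact hok.2
    · omega
  refine St.wp_ite best len (by simp [Ex.depth]) (by simp [Ex.depth])
    (by simp [Ex.Ok]) (by simp [Ex.Ok]) (by simp [Ex.val, rbest]) (by simp [Ex.val]) (fun hb => ?_)
    fun hb => ?_
  · apply St.wp_asg_seq len (by norm_num) (by simp [Ex.depth]) (by simp [Ex.Ok])
      (by simp [Ex.val])
    refine ⟨by norm_num, by simp [Ex.depth], ⟨by simp [Ex.Ok], by simp [Ex.Ok], ?_⟩, len, st + len,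
      ?_, rfl, by omega, ⟨by omega, by omega, fun _ => ⟨st, rfl, by omega, ?_⟩⟩,
      fun l hl _ => by omega⟩
    · simp [Ex.val, Op.eval, hst15]; omega
    · have : (st + len) = h.var 15 + len := by rw [hst15]
      constructor <;> first | assumption | simp [Ex.val, Op.eval, this]
    · rwa [show st + 2 * len = i + 1 by omega]
  · exact ⟨best, mid, regs21, rfl, le_rfl, hs, fun l hl _ => by omega⟩

theorem slotNext_wp (c : Params) (hc : c.Valid) {best mid i v t w o : ℕ} {inp : List ℕ}
    (ht' : t + c.R ≤ c.s) (hw : w ≤ c.n) (ho : o + w ≤ c.B * w) (h : Store)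
    (hI : Regs c best mid i v t w o inp h) :
    (slotNext c.a).wp c.W c.s (fun h' => Regs c best mid i v (t + c.R)
      (if o + w < c.B * w then w else 2 * w) (if o + w < c.B * w then o + w else 0) inp h' ∧
      h'.arr = h.arr) h := by
  obtain ⟨rn, rK, rp, rg, rq, rB, rbest, rmid, ri, rv, rt, rw', ro, rX, rinp, rout⟩ := hI
  have hsW := hc.s_lt
  have hnW := hc.n_lt
  have hBw := hc.mul_w_lt hw
  simp only [Params.R] at ht' ⊢
  apply St.wp_asg_seq (t + (27 * c.a + 1)) (by norm_num) (by simp [Ex.depth])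
  · refine ⟨by simp [Ex.Ok], by simp only [Ex.Ok]; omega, ?_⟩
    simp only [Ex.val, Op.eval, rt]; omega
  · simp only [Ex.val, Op.eval, rt]
  apply St.wp_asg_seq (o + w) (by norm_num) (by simp [Ex.depth])
  · refine ⟨by simp [Ex.Ok], by simp [Ex.Ok], ?_⟩
    simp [Ex.val, Op.eval, ro, rw']; omega
  · simp [Ex.val, Op.eval, ro, rw']
  refine St.wp_ite (o + w) (c.B * w) (by simp [Ex.depth]) (by simp [Ex.depth]) (by simp [Ex.Ok])
    ⟨by simp [Ex.Ok], by simp [Ex.Ok], ?_⟩ (by simp [Ex.val])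
    (by simp [Ex.val, Op.eval, rB, rw']) (fun hlt => ?_) fun hlt => ?_
  · simp only [Ex.val, Op.eval]
    simpa [rB, rw'] using hBw
  · rw [if_pos hlt, if_pos hlt]
    refine ⟨?_, rfl⟩
    constructor <;> first | assumption | simp
  · rw [if_neg hlt, if_neg hlt]
    apply St.wp_asg_seq 0 (by norm_num) (by simp [Ex.depth])
    · simp only [Ex.Ok]; omega
    · simp [Ex.val]
    refine ⟨by norm_num, by simp [Ex.depth], ⟨by simp [Ex.Ok], by simp [Ex.Ok], ?_⟩, ?_, rfl⟩
    · simp [Ex.val, Op.eval, rw']; omega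
    · constructor <;> first | assumption | simp [Ex.val, Op.eval, rw', two_mul]

end PalStream

/-! ### The loops over the slots and over the stream -/

namespace PalStream

/-- Slot number `j` holds its checkpoint and its fingerprints for the position `i`. -/
def SlotRep (c : Params) (arr : ℕ → ℕ) (j i : ℕ) : Prop :=
  arr (c.base + j * c.R) = slot c.B j i ∧
    ∀ e < 9 * c.a, CellRep c arr (c.base + j * c.R) e (slot c.B j i) i

theorem CellRep.congr {c : Params} {arr arr' : ℕ → ℕ} {t e st i : ℕ} (h : CellRep c arr t e st i)
    (he : e < 9 * c.a) (ha : ∀ x, t ≤ x → x < t + c.R → arr' x = arr x) :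
    CellRep c arr' t e st i := by
  simp only [Params.R] at ha
  obtain ⟨h1, h2, h3⟩ := h
  exact ⟨(ha _ (by omega) (by omega)).trans h1, (ha _ (by omega) (by omega)).trans h2,
    (ha _ (by omega) (by omega)).trans h3⟩

theorem SlotRep.congr {c : Params} {arr arr' : ℕ → ℕ} {j i : ℕ} (h : SlotRep c arr j i)
    (ha : ∀ x, c.base + j * c.R ≤ x → x < c.base + j * c.R + c.R → arr' x = arr x) :
    SlotRep c arr' j i :=
  ⟨(ha _ le_rfl (by simp only [Params.R]; omega)).trans h.1, fun e he => (h.2 e he).congr he ha⟩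

/-- Step number `i` has processed the slots below `j`. -/
structure SlotInv (c : Params) (i v : ℕ) (inp : List ℕ) (j best mid : ℕ) (h : Store) : Prop where
  regs : Regs c best mid i v (c.base + j * c.R) (2 ^ (j / c.B)) (j % c.B * 2 ^ (j / c.B)) inp h
  slots : ∀ j' < c.M, (j' < j ∨ 0 < i) → SlotRep c h.arr j' (if j' < j then i + 1 else i)
  sound : Sound c.p c.g c.a c.X c.S best mid
  covers : ∀ i' j', j' < c.M → (i' < i ∨ i' = i ∧ j' < j) →
    Covers c.p c.g c.a c.X c.S c.B best i' j'

/-- The spacing `2 ^ (j / B)` exceeds `n` exactly when all slots are done, so the program can stop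
on the spacing and never computes a logarithm. -/
theorem Params.Valid.two_pow_le_iff {c : Params} (hc : c.Valid) (j : ℕ) :
    2 ^ (j / c.B) < c.n + 1 ↔ j < c.M := by
  have hn := hc.two_le_n
  have hB : 0 < c.B := by simp only [Params.B]; omega
  rw [Nat.lt_succ_iff, ← Nat.le_log_iff_pow_le (by norm_num) (by omega), ← Nat.lt_succ_iff,
    Nat.div_lt_iff_lt_mul hB, Nat.mul_comm]

theorem Covers.mono {p g a B best best' i j : ℕ} {X : ℕ → ℕ} {S : List ℕ}
    (h : Covers p g a X S B best i j) (hb : best ≤ best') : Covers p g a X S B best' i j :=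
  fun l h1 h2 => (h l h1 h2).trans hb

theorem slotCode_wp (c : Params) (hc : c.Valid) {i v j best mid : ℕ} {inp : List ℕ}
    (hi : i < c.n) (hv : c.S[i]? = some v) (hj : j < c.M) (h : Store)
    (hI : SlotInv c i v inp j best mid h) :
    (slotCode c.a).wp c.W c.s (fun h' => ∃ best' mid', SlotInv c i v inp (j + 1) best' mid' h')
      h := by
  obtain ⟨hregs, hslots, hsound, hcov⟩ := hI
  set w := 2 ^ (j / c.B) with hw
  set t := c.base + j * c.R with ht
  have hB : 0 < c.B := by simp only [Params.B]; omega
  have hwn : w ≤ c.n := Nat.lt_succ_iff.1 ((hc.two_pow_le_iff j).2 hj)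
  have htb : c.base ≤ t := by omega
  have hts : t + c.R ≤ c.s := by
    have h1 : (j + 1) * c.R ≤ c.M * c.R := Nat.mul_le_mul_right _ hj
    have h2 := hc.le_s
    rw [Nat.add_mul] at h1
    omega
  -- The program's renewal test is literally the recursion that defines `checkpoint`.
  have hst1 : (if i = 0 ∨ i % (c.B * w) = j % c.B * w then i else slot c.B j i) =
    slot c.B j (i + 1) := rfl
  have hstle : slot c.B j (i + 1) ≤ i := Nat.lt_succ_iff.1 (checkpoint_lt _ _ _)
  have hmod := Nat.mod_lt j hB
  have how : j % c.B * w + w ≤ c.B * w := by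
    calc j % c.B * w + w = (j % c.B + 1) * w := by ring
      _ ≤ _ := Nat.mul_le_mul_right _ hmod
  refine St.wp_mono (slotHead c.a) ?_ h (slotHead_wp c hc htb hts hi hwn h hregs (st := slot c.B j i) ?_)
  swap
  · intro hi0
    have := hslots j hj (Or.inr hi0)
    rwa [if_neg (lt_irrefl _)] at this
  rw [hst1]
  rintro h1 ⟨arr, hcell, harr, hframe⟩
  refine St.wp_mono (.rep cellCode (9 * c.a)) ?_ h1 (St.wp_rep (I := CellInv c arr best mid i v t w (j % c.B * w)
    (slot c.B j (i + 1)) inp) (fun k hk h hI => cellCode_wp c hc hk htb hts hstle hi hv h hI)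
    h1 hcell)
  intro h2 hcell2
  refine St.wp_mono slotCompare ?_ h2 (slotCompare_wp c hc hstle hi h2 hcell2 hsound)
  rintro h3 ⟨best', mid', hregs3, harr3, hbb, hsound', hbest'⟩
  refine St.wp_mono _ ?_ h3 (slotNext_wp c hc hts hwn how h3 hregs3)
  rintro h4 ⟨hregs4, harr4⟩
  have ha : h4.arr = h2.arr := harr4.trans harr3
  refine ⟨best', mid', ?_, ?_, hsound', ?_⟩
  · have et : t + c.R = c.base + (j + 1) * c.R := by rw [ht]; ring
    rw [et] at hregs4
    have how' : j % c.B * w + w = (j % c.B + 1) * w := by ring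
    have hwpos : 0 < w := by positivity
    -- The offset wraps around exactly when a level is complete; then the spacing doubles and the
    -- offset restarts at `0`.
    have hiff : j % c.B * w + w < c.B * w ↔ j % c.B + 1 < c.B := by
      rw [how', Nat.mul_lt_mul_right hwpos]
    simp only [hiff] at hregs4
    have hdm := Nat.div_add_mod j c.B
    by_cases hlt : j % c.B + 1 < c.B
    · have e1 : (j + 1) / c.B = j / c.B := by
        rw [Nat.div_eq_iff hB]
        rw [Nat.mul_comm] at hdm
        constructor <;> omega
      have e2 : (j + 1) % c.B = j % c.B + 1 := by
        rw [Nat.add_mod_eq_ite, Nat.mod_eq_of_lt (show 1 < c.B by omega), if_neg (by omega)]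
      rw [if_pos hlt, if_pos hlt, how'] at hregs4
      rw [e1, e2]
      exact hregs4
    · have e0 : j + 1 = c.B * (j / c.B + 1) := by
        rw [Nat.mul_add]; omega
      have e1 : (j + 1) / c.B = j / c.B + 1 := by
        rw [e0, Nat.mul_div_cancel_left _ hB]
      have e2 : (j + 1) % c.B = 0 := by
        rw [e0, Nat.mul_mod_right]
      rw [if_neg hlt, if_neg hlt] at hregs4
      rw [e1, e2, Nat.zero_mul, pow_succ, Nat.mul_comm _ 2]
      exact hregs4
  · intro j' hj' hor
    rw [ha]
    by_cases hjj : j' = j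
    · subst hjj
      rw [if_pos (Nat.lt_succ_self _)]
      refine ⟨(hcell2.frame t (Or.inl le_rfl)).trans harr, fun e he => ?_⟩
      have := hcell2.cells e he
      rwa [if_pos he] at this
    · have hlt : j' < j + 1 ↔ j' < j := by omega
      simp only [hlt] at hor ⊢
      refine (hslots j' hj' hor).congr fun x hx hx' => ?_
      have hdis : x < t ∨ t + c.R ≤ x := by
        rcases Nat.lt_or_gt_of_ne hjj with h' | h'
        · left
          have := Nat.mul_le_mul_right c.R h'
          rw [Nat.succ_mul] at this
          omega
        · right
          have := Nat.mul_le_mul_right c.R h'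
          rw [Nat.succ_mul] at this
          omega
      rw [hcell2.frame x (by omega), hframe x hdis]
  · intro i' j' hj' hor
    by_cases hij : i' = i ∧ j' = j
    · obtain ⟨rfl, rfl⟩ := hij
      exact hbest'
    · exact (hcov i' j' hj' (by omega)).mono hbb

open Ex in
/-- Process all slots. -/
def innerCode (a : ℕ) : Program := whileCode (var 13) (add (var 0) (lit 1)) (slotCode a).code

theorem innerCode_runs (c : Params) (hc : c.Valid) {i v best mid : ℕ} {inp : List ℕ}
    (hi : i < c.n) (hv : c.S[i]? = some v) (h : Store) (hI : SlotInv c i v inp 0 best mid h) :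
    Runs c.W c.s (innerCode c.a) h (c.M * ((slotCode c.a).cost + 7) + 7)
      (fun h' => ∃ best' mid', SlotInv c i v inp c.M best' mid' h') := by
  have hs : 64 ≤ c.s := by have := hc.le_s; simp only [Params.base] at this; omega
  have hnW := hc.n_lt
  refine (Runs.whileCode hs (tb := (slotCode c.a).cost)
    (I := fun k h => ∃ j best mid, j ≤ c.M ∧ k = c.M - j ∧ SlotInv c i v inp j best mid h)
    (Q := fun h' => ∃ best' mid', SlotInv c i v inp c.M best' mid' h')
    (by simp [Ex.depth]) (by simp [Ex.depth]) ?_ ?_ ?_ (c.M - 0) h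
    ⟨0, best, mid, Nat.zero_le _, rfl, hI⟩).mono 
    (by simp only [Ex.cost, Nat.sub_zero]; exact le_of_eq (by ring)) fun _ h => h
  · rintro k h ⟨j, best, mid, -, -, hI⟩
    refine ⟨by simp [Ex.Ok], by simp [Ex.Ok], by simp only [Ex.Ok]; omega, ?_⟩
    simp only [Ex.val, Op.eval, hI.regs.n]; omega
  · rintro k h ⟨j, best, mid, hj, rfl, hI⟩ hlt
    simp only [Ex.val, Op.eval, hI.regs.n, hI.regs.w] at hlt
    rw [hc.two_pow_le_iff] at hlt
    refine ⟨c.M - (j + 1), by omega, (St.runs hs _ _ _ (slotCode_wp c hc hi hv hlt h hI)).mono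
      le_rfl ?_⟩
    rintro h' ⟨best', mid', hI'⟩
    exact ⟨j + 1, best', mid', hlt, rfl, hI'⟩
  · rintro k h ⟨j, best, mid, hj, rfl, hI⟩ hlt
    simp only [Ex.val, Op.eval, hI.regs.n, hI.regs.w] at hlt
    rw [hc.two_pow_le_iff] at hlt
    obtain rfl : j = c.M := by omega
    exact ⟨best, mid, hI⟩

open Ex in
/-- Read a symbol and go to the first slot. -/
def stepHead (a : ℕ) : St :=
  .seq (.read 11) <| .seq (.asg 12 (lit (64 + 9 * a))) <| .seq (.asg 13 (lit 1)) (.asg 14 (lit 0))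

open Ex in
/-- The main loop and the output. -/
def mainCode (a : ℕ) : Program :=
  .seq (whileCode (var 10) (var 0)
    (.seq (stepHead a).code (.seq (innerCode a) (St.asg 10 (add (var 10) (lit 1))).code)))
    (St.seq (.out 9) (.out 8)).code

/-- `i` symbols have been processed. -/
structure StepInv (c : Params) (i best mid : ℕ) (h : Store) : Prop where
  regs : ∃ v t w o, Regs c best mid i v t w o (c.S.drop i) h
  slots : ∀ j < c.M, 0 < i → SlotRep c h.arr j i
  sound : Sound c.p c.g c.a c.X c.S best mid
  covers : ∀ i' j, j < c.M → i' < i → Covers c.p c.g c.a c.X c.S c.B best i' j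

theorem stepHead_wp (c : Params) (hc : c.Valid) {i v best mid : ℕ} (hi : i < c.n)
    (hv : c.S[i]? = some v) (h : Store) (hI : StepInv c i best mid h) :
    (stepHead c.a).wp c.W c.s (SlotInv c i v (c.S.drop (i + 1)) 0 best mid) h := by
  obtain ⟨⟨v', t, w, o, hregs⟩, hslots, hsound, hcov⟩ := hI
  obtain ⟨rn, rK, rp, rg, rq, rB, rbest, rmid, ri, rv, rt, rw', ro, rX, rinp, rout⟩ := hregs
  have hi' : i < c.S.length := hc.length_S ▸ hi
  have hv' : c.S[i] = v := by
    rw [List.getElem?_eq_getElem hi'] at hv; exact Option.some.inj hv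
  have hnW := hc.n_lt
  have hbW : c.base < c.W := by
    have := hc.le_s
    have := hc.s_lt
    omega
  refine ⟨by norm_num, v, c.S.drop (i + 1), ?_, hc.S_lt v (List.mem_of_getElem? hv), ?_⟩
  · rw [rinp, List.drop_eq_getElem_cons hi', hv']
  apply St.wp_asg_seq (64 + 9 * c.a) (by norm_num) (by simp [Ex.depth]) (by simpa [Ex.Ok] using hbW) rfl
  apply St.wp_asg_seq 1 (by norm_num) (by simp [Ex.depth]) (by simp only [Ex.Ok]; omega) rfl
  refine ⟨by norm_num, by simp [Ex.depth], by simp only [Ex.Ok]; omega, ?_, ?_, hsound, ?_⟩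
  · constructor <;> first | assumption | simp [Ex.val]
  · intro j' hj' hor
    rw [if_neg (Nat.not_lt_zero _)]
    exact hslots j' hj' (by omega)
  · exact fun i' j' hj' hor => hcov i' j' hj' (by omega)

/-- A bound for the cost of one slot in one step, including an equal share of the other costs. -/
def mainCost (a : ℕ) : ℕ := (slotCode a).cost + (stepHead a).cost + 40

theorem mainCode_runs (c : Params) (hc : c.Valid) {best mid : ℕ} (h : Store)
    (hI : StepInv c 0 best mid h) :
    Runs c.W c.s (mainCode c.a) h (c.n * c.M * mainCost c.a)
      (fun h' => ∃ best mid, h'.out = [mid, best] ∧ Sound c.p c.g c.a c.X c.S best mid ∧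
        ∀ i < c.n, ∀ j < c.M, Covers c.p c.g c.a c.X c.S c.B best i j) := by
  have hs : 64 ≤ c.s := by have := hc.le_s; simp only [Params.base] at this; omega
  have hnW := hc.n_lt
  have hn := hc.two_le_n
  have hinc : (St.asg 10 (Ex.add (.var 10) (.lit 1))).cost = 6 := rfl
  have hout : (St.seq (.out 9) (.out 8)).cost = 2 := rfl
  refine ((Runs.whileCode hs (e := .var 10) (f := .var 0)
    (tb := (stepHead c.a).cost + ((c.M * ((slotCode c.a).cost + 7) + 7) + 6))
    (I := fun k h => ∃ i best mid, i ≤ c.n ∧ k = c.n - i ∧ StepInv c i best mid h)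
    (Q := fun h' => ∃ best' mid', StepInv c c.n best' mid' h')
    (by simp [Ex.depth]) (by simp [Ex.depth]) ?_ ?_ ?_ (c.n - 0) h
    ⟨0, best, mid, Nat.zero_le _, rfl, hI⟩).seq (t' := 2) ?_).mono ?_ fun _ h => h
  · rintro k h ⟨j, best, mid, -, -, hI⟩
    exact ⟨by simp [Ex.Ok], by simp [Ex.Ok]⟩
  · rintro k h ⟨i, best, mid, hi, rfl, hI⟩ hlt
    obtain ⟨v', t, w, o, hregs⟩ := hI.regs
    simp only [Ex.val, hregs.n, hregs.i] at hlt
    have hi' : i < c.S.length := hc.length_S ▸ hlt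
    have hv : c.S[i]? = some c.S[i] := List.getElem?_eq_getElem hi'
    refine ⟨c.n - (i + 1), by omega, ?_⟩
    refine (St.runs hs _ _ _ (stepHead_wp c hc hlt hv h hI)).seq fun h1 hI1 => ?_
    refine (innerCode_runs c hc hlt hv h1 hI1).seq fun h2 hI2 => ?_
    obtain ⟨best', mid', ⟨rn, rK, rp, rg, rq, rB, rbest, rmid, ri, rv, rt, rw', ro, rX, rinp, rout⟩,
      h4, h5, h6⟩ := hI2
    refine hinc ▸ St.runs hs _ _ _ ⟨by norm_num, by simp [Ex.depth],
      ⟨by simp [Ex.Ok], by simp only [Ex.Ok]; omega, ?_⟩,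
      i + 1, best', mid', by omega, rfl,
      ⟨_, _, _, _, ⟨rn, rK, rp, rg, rq, rB, rbest, rmid, ?_, rv, rt, rw', ro, rX, rinp, rout⟩⟩, ?_, h5, ?_⟩
    · simp only [Ex.val, Op.eval, ri]; omega
    · simp [Ex.val, Op.eval, ri]
    · intro j hj _
      have := h4 j hj (Or.inl hj)
      rwa [if_pos hj] at this
    · exact fun i' j hj hi' => h6 i' j hj (by omega)
  · rintro k h ⟨i, best, mid, hi, rfl, hI⟩ hlt
    obtain ⟨v', t, w, o, hregs⟩ := hI.regs
    simp only [Ex.val, hregs.n, hregs.i] at hlt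
    obtain rfl : i = c.n := by omega
    exact ⟨best, mid, hI⟩
  · rintro h' ⟨best', mid', ⟨v', t, w, o, hregs⟩, -, h5, h6⟩
    refine hout ▸ St.runs hs _ _ _ ⟨by norm_num, by norm_num, best', mid', ?_, h5,
      fun i hi j hj => h6 i j hj hi⟩
    simp [hregs.out, hregs.best, hregs.mid]
  · have hM : 1 ≤ c.M := Nat.mul_pos (Nat.mul_pos (by norm_num) (Nat.succ_pos _)) (Nat.succ_pos _)
    have hnM : c.n ≤ c.n * c.M := Nat.le_mul_of_pos_right _ hM
    simp only [Ex.cost, mainCost, Nat.sub_zero]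
    nlinarith [Nat.zero_le (c.n * c.M - c.n), Nat.mul_le_mul_right (stepHead c.a).cost hnM]

end PalStream

namespace PalStream

/-! ## The setup phase -/

theorem exists_cube_ge (n : ℕ) : ∃ N, 4 * n * n ≤ N * N * N :=
  ⟨4 * n * n, (Nat.le_mul_self _).trans (Nat.mul_le_mul (Nat.le_mul_self _) le_rfl)⟩

open Classical in
/-- The least number whose cube is at least `4 * n ^ 2`. -/
noncomputable def fieldN (n : ℕ) : ℕ := Nat.find (exists_cube_ge n)

theorem exists_prime_gt (n : ℕ) : ∃ p, n < p ∧ p.Prime := Nat.exists_infinite_primes (n + 1)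

open Classical in
/-- The characteristic: the least prime above `fieldN n`. -/
noncomputable def fieldP (n : ℕ) : ℕ := Nat.find (exists_prime_gt (fieldN n))

open Classical in
/-- Starting from `-1`, take the least square root modulo `p` as long as there is one. -/
noncomputable def rootSeq (p : ℕ) : ℕ → ℕ
  | 0 => p - 1
  | k + 1 => if h : ∃ y, y < p ∧ y * y % p = rootSeq p k then Nat.find h else rootSeq p k

/-- A non-residue. -/
noncomputable def fieldG (n : ℕ) : ℕ := rootSeq (fieldP n) (Nat.log 2 (fieldP n))

theorem fieldN_spec (n : ℕ) : 4 * n * n ≤ fieldN n * fieldN n * fieldN n := by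
  classical
  exact Nat.find_spec (exists_cube_ge n)

theorem lt_fieldN_iff {n N : ℕ} : N < fieldN n ↔ N * N * N < 4 * n * n := by
  classical
  constructor
  · intro h
    exact not_le.1 (Nat.find_min (exists_cube_ge n) h)
  · intro h
    by_contra hc
    push Not at hc
    have h1 := fieldN_spec n
    have h2 : fieldN n * fieldN n * fieldN n ≤ N * N * N :=
      Nat.mul_le_mul (Nat.mul_le_mul hc hc) hc
    omega

theorem fieldN_le {n : ℕ} (hn : 2 ≤ n) : fieldN n ≤ 2 * n := by
  by_contra hc
  push Not at hc
  rw [lt_fieldN_iff] at hc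
  nlinarith [Nat.mul_le_mul hn (le_refl (n * n))]

theorem two_lt_fieldN {n : ℕ} (hn : 2 ≤ n) : 2 < fieldN n := by
  rw [lt_fieldN_iff]
  nlinarith

theorem fieldP_prime (n : ℕ) : (fieldP n).Prime := by
  classical
  exact (Nat.find_spec (exists_prime_gt (fieldN n))).2

theorem fieldN_lt_fieldP (n : ℕ) : fieldN n < fieldP n := by
  classical
  exact (Nat.find_spec (exists_prime_gt (fieldN n))).1

theorem fieldP_le_of_prime {n p : ℕ} (h : fieldN n < p) (hp : p.Prime) : fieldP n ≤ p := by
  classical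
  exact Nat.find_min' (exists_prime_gt (fieldN n)) ⟨h, hp⟩

theorem fieldP_le {n : ℕ} (hn : 2 ≤ n) : fieldP n ≤ 2 * fieldN n := by
  have h2 := two_lt_fieldN hn
  obtain ⟨p, hp, h1, h3⟩ := Nat.exists_prime_lt_and_le_two_mul (fieldN n) (by omega)
  exact (fieldP_le_of_prime h1 hp).trans h3

theorem fieldP_le' {n : ℕ} (hn : 2 ≤ n) : fieldP n ≤ 4 * n := by
  have := fieldP_le hn
  have := fieldN_le hn
  omega

/-- At most `N` candidates with at most `√(2N) + 1` divisors each. By minimality `(N - 1) ^ 3 < 4 *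
n ^ 2`, and `N ≤ 2 * (N - 1)`, so the square of the product is `O(n ^ 2)` and the prime search takes
linear time. -/
theorem fieldN_mul_sqrt_le {n : ℕ} (hn : 2 ≤ n) :
    fieldN n * (Nat.sqrt (2 * fieldN n) + 1) ≤ 16 * n := by
  set N := fieldN n with hN
  have h2 : 2 < N := two_lt_fieldN hn
  set r := Nat.sqrt (2 * N) with hr
  have h3 : r * r ≤ 2 * N := Nat.sqrt_le _
  have h4 : 1 ≤ r := Nat.le_sqrt.2 (by omega)
  have h5 : (N - 1) * (N - 1) * (N - 1) < 4 * n * n := lt_fieldN_iff.1 (by omega)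
  have h6 : N * N * N ≤ 8 * ((N - 1) * (N - 1) * (N - 1)) := by
    have : N ≤ 2 * (N - 1) := by omega
    calc N * N * N ≤ 2 * (N - 1) * (2 * (N - 1)) * (2 * (N - 1)) := by gcongr
      _ = _ := by ring
  have h7 : (N * (r + 1)) * (N * (r + 1)) ≤ (16 * n) * (16 * n) := by
    calc (N * (r + 1)) * (N * (r + 1)) ≤ (N * (2 * r)) * (N * (2 * r)) := by gcongr <;> omega
      _ = 4 * (N * N) * (r * r) := by ring
      _ ≤ 4 * (N * N) * (2 * N) := Nat.mul_le_mul_left _ h3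
      _ = 8 * (N * N * N) := by ring
      _ ≤ 8 * (8 * (4 * n * n)) := by omega
      _ = (16 * n) * (16 * n) := by ring
  exact Nat.mul_self_le_mul_self_iff.1 h7

theorem rootSeq_succ_of_least {p k y : ℕ} (hy : y < p) (h : y * y % p = rootSeq p k)
    (hmin : ∀ y' < y, y' * y' % p ≠ rootSeq p k) : rootSeq p (k + 1) = y := by
  classical
  have hex : ∃ y, y < p ∧ y * y % p = rootSeq p k := ⟨y, hy, h⟩
  rw [rootSeq, dif_pos hex, Nat.find_eq_iff]
  exact ⟨⟨hy, h⟩, fun y' hy' h' => hmin y' hy' h'.2⟩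

/-- The sequence is constant once a non-residue is reached, so its value at the index `log₂ p` is
the end of the chain wherever the chain stops. -/
theorem rootSeq_eq_of_nonRes {p k : ℕ} (h : NonRes p (rootSeq p k)) :
    ∀ m, k ≤ m → rootSeq p m = rootSeq p k := by
  intro m hm
  induction m, hm using Nat.le_induction with
  | base => rfl
  | succ m hm ih =>
    rw [rootSeq, dif_neg, ih]
    rintro ⟨y, hy, hy'⟩
    rw [ih] at hy'
    exact h y hy hy'

open Ex in
/-- Increment variable `x`. -/
def incCode (x : ℕ) : St := .asg x (add (var x) (lit 1))

open Ex in
/-- Find the least number whose cube is at least `4 * n ^ 2`. -/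
def cubeCode : Program :=
  .seq (St.asg 2 (lit 1)).code
    (whileCode (mul (mul (var 2) (var 2)) (var 2)) (mul (mul (lit 4) (var 0)) (var 0))
      (incCode 2).code)

open Ex in
/-- Find the next prime by trial division. -/
def primeBody : St :=
  .ite (mod (var 3) (var 4)) (lit 1) (.seq (.asg 3 (add (var 3) (lit 1))) (.asg 4 (lit 2)))
    (incCode 4)

open Ex in
def primeCode : Program :=
  .seq (St.seq (.asg 3 (add (var 2) (lit 1))) (.asg 4 (lit 2))).code
    (whileCode (mul (var 4) (var 4)) (add (var 3) (lit 1)) primeBody.code)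

open Ex in
/-- Compare the square of variable `4` with variable `5`. -/
def rootBody : St :=
  .seq (.asg 11 (mod (mul (var 4) (var 4)) (var 3))) <|
  .ite (var 11) (var 5) (incCode 4) <|
  .ite (var 5) (var 11) (incCode 4) <|
  .seq (.asg 5 (var 4)) (.asg 4 (lit 1))

open Ex in
/-- Find a non-residue by repeatedly taking square roots. -/
def rootCode : Program :=
  .seq (St.seq (.asg 5 (sub (var 3) (lit 1))) (.asg 4 (lit 1))).code
    (whileCode (var 4) (var 3) rootBody.code)

open Ex in
/-- Draw the point number `e`. -/
def pointCode (e : ℕ) : St :=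
  .seq (.rand 4) (.put (lit (64 + e)) (mod (var 4) (var 6)))

open Ex in
/-- Initialise the remaining variables and draw the points. -/
def initCode (a : ℕ) : St :=
  .seq (.asg 6 (mul (var 3) (var 3))) <|
  .seq (.asg 7 (mul (lit 4) (add (var 1) (lit 1)))) <|
  .seq (.asg 8 (lit 0)) <| .seq (.asg 9 (lit 1)) <| .seq (.asg 10 (lit 0)) <|
  .rep pointCode (9 * a)

/-- The whole program. -/
def program (a : ℕ) : Program :=
  .seq cubeCode (.seq primeCode (.seq rootCode (.seq (initCode a).code (mainCode a))))

/-- The part of the store that the search for the field does not change. -/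
structure Given (n K : ℕ) (S r : List ℕ) (h : Store) : Prop where
  n : h.var 0 = n
  K : h.var 1 = K
  inp : h.inp = S
  rnd : h.rnd = r
  out : h.out = []

theorem Given.update {n K : ℕ} {S r : List ℕ} {h : Store} (hG : Given n K S r h) {x v : ℕ}
    (hx : 2 ≤ x) : Given n K S r { h with var := Function.update h.var x v } := by
  obtain ⟨h1, h2, h3, h4, h5⟩ := hG
  refine ⟨?_, ?_, h3, h4, h5⟩
  · simp only; rw [Function.update_of_ne (by omega), h1]
  · simp only; rw [Function.update_of_ne (by omega), h2]

section

variable {W s n K : ℕ} {S r : List ℕ}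

theorem incCode_wp {x v : ℕ} {h : Store} {Q : Store → Prop} (hx : x < 32) (hv : h.var x = v)
    (hvW : v + 1 < W) (hQ : Q { h with var := Function.update h.var x (v + 1) }) :
    (incCode x).wp W s Q h := by
  refine ⟨hx, by simp [Ex.depth], ⟨hx, by simp only [Ex.Ok]; omega, ?_⟩, ?_⟩
  · simpa [Ex.val, Op.eval, hv] using hvW
  · simpa [Ex.val, Op.eval, hv] using hQ

theorem cubeCode_runs (hs : 64 ≤ s) (hn : 2 ≤ n) (hW : 100 * (n + 1) ^ 3 ≤ W) (h : Store)
    (hG : Given n K S r h) :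
    Runs W s cubeCode h (50 * n + 40)
      (fun h' => Given n K S r h' ∧ h'.var 2 = fieldN n) := by
  have hNn := fieldN_le hn
  have hc1 : 8 * (n * n * n) + 8 < W := by nlinarith
  have hc2 : 4 * n * n < W := by nlinarith
  have hc3 : 4 * n + 4 < W := by nlinarith
  have hN0 := two_lt_fieldN hn
  refine ((St.runs hs (.asg 2 (.lit 1)) h (fun h' => Given n K S r h' ∧ h'.var 2 = 1) ?_).seq
    (fun h' hI => Runs.whileCode hs (tb := (incCode 2).cost)
    (I := fun k h => ∃ N, N ≤ fieldN n ∧ k = fieldN n - N ∧ Given n K S r h ∧ h.var 2 = N)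
    (Q := fun h' => Given n K S r h' ∧ h'.var 2 = fieldN n)
    (by simp [Ex.depth]) (by simp [Ex.depth]) ?_ ?_ ?_ (fieldN n - 1) h'
    ⟨1, by omega, rfl, hI⟩)).mono ?_ fun _ h => h
  · exact ⟨by norm_num, by simp [Ex.depth], by simp only [Ex.Ok]; omega, hG.update (by norm_num), rfl⟩
  · rintro k h ⟨N, hN, -, hG, h2⟩
    have hN2 : N ≤ 2 * n := hN.trans hNn
    have e1 : N * N ≤ 2 * n * (2 * n) := Nat.mul_le_mul hN2 hN2
    have e2 : N * N * N ≤ 2 * n * (2 * n) * (2 * n) := Nat.mul_le_mul e1 hN2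
    refine ⟨⟨⟨by simp [Ex.Ok], by simp [Ex.Ok], ?_⟩, by simp [Ex.Ok], ?_⟩,
      ⟨⟨by simp only [Ex.Ok]; omega, by simp [Ex.Ok], ?_⟩, by simp [Ex.Ok], ?_⟩⟩
    · simp only [Ex.val, Op.eval, h2]; nlinarith
    · simp only [Ex.val, Op.eval, h2]; nlinarith
    · simp only [Ex.val, Op.eval, hG.n]; omega
    · simp only [Ex.val, Op.eval, hG.n]; omega
  · rintro k h ⟨N, hN, rfl, hG, h2⟩ hlt
    simp only [Ex.val, Op.eval, h2, hG.n] at hlt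
    have hlt' := lt_fieldN_iff.2 hlt
    refine ⟨fieldN n - (N + 1), by omega, St.runs hs _ _ _ (incCode_wp (by norm_num) h2 (by omega)
      ⟨N + 1, hlt', rfl, hG.update (by norm_num), by simp⟩)⟩
  · rintro k h ⟨N, hN, rfl, hG, h2⟩ hlt
    simp only [Ex.val, Op.eval, h2, hG.n, ← lt_fieldN_iff] at hlt
    exact ⟨hG, by omega⟩
  · norm_num [Ex.cost, St.cost, incCode]
    omega

/-- The budget `(fieldP n - p) * R + (R - y)` drops with every test: a failed divisor raises `y`, a
successful one moves to the next candidate. `R` bounds the divisors tried, because candidates stay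
below `2 * fieldN n` by Bertrand's postulate. -/
theorem primeCode_runs (hs : 64 ≤ s) (hn : 2 ≤ n) (hW : 100 * (n + 1) ^ 3 ≤ W) (h : Store)
    (hG : Given n K S r h) (h2 : h.var 2 = fieldN n) :
    Runs W s primeCode h (1000 * n + 100) (fun h' => Given n K S r h' ∧ h'.var 3 = fieldP n) := by
  have hNn := fieldN_le hn
  have hP4 := fieldP_le' hn
  have hPN := fieldP_le hn
  have hNP := fieldN_lt_fieldP n
  have hN0 := two_lt_fieldN hn
  have hiter := fieldN_mul_sqrt_le hn
  set R := Nat.sqrt (2 * fieldN n) + 1 with hR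
  have hR2 : 2 ≤ R := by
    have : 1 ≤ Nat.sqrt (2 * fieldN n) := Nat.le_sqrt.2 (by omega)
    omega
  have hRR : R ≤ 4 * n + 1 := by
    have := Nat.sqrt_le_self (2 * fieldN n)
    omega
  have hc1 : (4 * n + 1) * (4 * n + 1) < W := by nlinarith
  have hc3 : 4 * n + 4 < W := by nlinarith
  refine ((St.runs hs (.seq (.asg 3 (.add (.var 2) (.lit 1))) (.asg 4 (.lit 2))) h
    (fun h' => Given n K S r h' ∧ h'.var 3 = fieldN n + 1 ∧ h'.var 4 = 2) ?_).seq
    (fun h' hI => Runs.whileCode hs (tb := primeBody.cost)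
    (I := fun k h => ∃ p y, fieldN n < p ∧ p ≤ fieldP n ∧ 2 ≤ y ∧ y ≤ R ∧
      (fieldP n - p) * R + (R - y) ≤ k ∧ (∀ d, 2 ≤ d → d < y → ¬ d ∣ p) ∧
      Given n K S r h ∧ h.var 3 = p ∧ h.var 4 = y)
    (Q := fun h' => Given n K S r h' ∧ h'.var 3 = fieldP n)
    (by simp [Ex.depth]) (by simp [Ex.depth]) ?_ ?_ ?_ (fieldN n * R) h'
    ⟨fieldN n + 1, 2, by omega, hNP, le_rfl, hR2, ?_, fun d h1 h2 => by omega, hI⟩)).mono ?_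
    fun _ h => h
  · apply St.wp_asg_seq (fieldN n + 1) (by norm_num) (by simp [Ex.depth])
    · refine ⟨by simp [Ex.Ok], by simp only [Ex.Ok]; omega, ?_⟩
      simp only [Ex.val, Op.eval, h2]; omega
    · simp only [Ex.val, Op.eval, h2]
    exact ⟨by norm_num, by simp [Ex.depth], by simp only [Ex.Ok]; omega,
      (hG.update (by norm_num)).update (by norm_num), by simp, rfl⟩
  · rintro k h ⟨p, y, h1, h2, h3, h4, -, -, hG, hp, hy⟩
    refine ⟨⟨by simp [Ex.Ok], by simp [Ex.Ok], ?_⟩, by simp [Ex.Ok], by simp only [Ex.Ok]; omega, ?_⟩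
    · simp only [Ex.val, Op.eval, hy]
      exact (Nat.mul_le_mul (h4.trans hRR) (h4.trans hRR)).trans_lt hc1
    · simp only [Ex.val, Op.eval, hp]; omega
  · rintro k h ⟨p, y, h1, h2, h3, h4, h5, h6, hG, hp, hy⟩ hlt
    simp only [Ex.val, Op.eval, hp, hy] at hlt
    have hyR : y < R := by
      have : y ≤ Nat.sqrt (2 * fieldN n) := Nat.le_sqrt.2 (by omega)
      omega
    refine ⟨k - 1, by omega, St.runs hs _ _ _ ?_⟩
    refine St.wp_ite (p % y) 1 (by simp [Ex.depth]) (by simp [Ex.depth])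
      ⟨by simp [Ex.Ok], by simp [Ex.Ok], ?_⟩ (by simp only [Ex.Ok]; omega)
      (by simp [Ex.val, Op.eval, hp, hy]) rfl (fun hd => ?_) fun hd => ?_
    · simp only [Ex.val, Op.eval, hp, hy]
      exact (Nat.mod_le _ _).trans_lt (by omega)
    · have hdvd : y ∣ p := Nat.dvd_of_mod_eq_zero (by omega)
      -- A divisor `y` with `2 ≤ y` and `y * y ≤ p` shows that `p` is composite, so the target has
      -- not been reached yet.
      have hpP : p < fieldP n := by
        refine lt_of_le_of_ne h2 fun he => ?_
        have hpr := fieldP_prime n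
        rw [← he] at hpr
        rcases (Nat.dvd_prime hpr).1 hdvd with h | h
        · omega
        · rw [h] at hlt
          nlinarith
      apply St.wp_asg_seq (p + 1) (by norm_num) (by simp [Ex.depth])
      · refine ⟨by simp [Ex.Ok], by simp only [Ex.Ok]; omega, ?_⟩
        simp only [Ex.val, Op.eval, hp]; omega
      · simp only [Ex.val, Op.eval, hp]
      refine ⟨by norm_num, by simp [Ex.depth], by simp only [Ex.Ok]; omega, p + 1, 2, by omega, hpP,
        le_rfl, hR2, ?_, fun d h1 h2 => by omega, (hG.update (by norm_num)).update (by norm_num),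
        by simp, rfl⟩
      obtain ⟨m, hm⟩ : ∃ m, fieldP n - p = m + 1 := ⟨fieldP n - p - 1, by omega⟩
      rw [hm, Nat.add_mul] at h5
      rw [show fieldP n - (p + 1) = m by omega]
      omega
    · refine incCode_wp (by norm_num) hy (by omega) ⟨p, y + 1, h1, h2, by omega, hyR, by omega, ?_,
        hG.update (by norm_num), by simpa using hp, by simp⟩
      intro d hd1 hd2 hdp
      rcases Nat.lt_succ_iff_lt_or_eq.1 hd2 with h | h
      · exact h6 d hd1 h hdp
      · subst h
        have := Nat.mod_eq_zero_of_dvd hdp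
        omega
  · rintro k h ⟨p, y, h1, h2, h3, h4, h5, h6, hG, hp, hy⟩ hlt
    simp only [Ex.val, Op.eval, hp, hy] at hlt
    refine ⟨hG, hp.trans (le_antisymm h2 (fieldP_le_of_prime h1 ?_))⟩
    exact prime_of_forall_not_dvd (y := y) (by omega) h6 (by omega)
  · have e1 : fieldP n - (fieldN n + 1) + 1 ≤ fieldN n := by omega
    have e2 := Nat.mul_le_mul_right R e1
    rw [Nat.add_mul] at e2
    omega
  · norm_num [Ex.cost, St.cost, incCode, primeBody]
    omega

/-- The invariant keeps the current value to the power `2 ^ k` equal to `-1`, which limits `k`; each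
value is searched for roots among fewer than `p` residues. When the search runs through all of them,
the value is a non-residue. -/
theorem rootCode_runs (hs : 64 ≤ s) (hn : 2 ≤ n) (hW : 100 * (n + 1) ^ 3 ≤ W) (h : Store)
    (hG : Given n K S r h) (h3 : h.var 3 = fieldP n) :
    Runs W s rootCode h (200 * (n * (Nat.log 2 n + 3)) + 100)
      (fun h' => Given n K S r h' ∧ h'.var 3 = fieldP n ∧ h'.var 5 = fieldG n ∧
        fieldG n < fieldP n ∧ NonRes (fieldP n) (fieldG n)) := by
  have hP4 := fieldP_le' hn
  have hNP := fieldN_lt_fieldP n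
  have hN0 := two_lt_fieldN hn
  have hprime := fieldP_prime n
  rw [fieldG]
  set p := fieldP n with hp
  set L := Nat.log 2 p with hL
  have hc1 : (4 * n + 1) * (4 * n + 1) < W := by nlinarith
  have hc3 : 4 * n + 4 < W := by nlinarith
  have hpp : p * p < W := (Nat.mul_le_mul (by omega) (by omega)).trans_lt hc1
  have hLn : L ≤ Nat.log 2 n + 2 := by
    rw [hL]
    refine (Nat.log_mono_right hP4).trans ?_
    rw [show 4 * n = n * 2 * 2 by ring, Nat.log_mul_base (by norm_num) (by omega),
      Nat.log_mul_base (by norm_num) (by omega)]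
  have hkL : ∀ k g : ℕ, (g : ZMod p) ^ 2 ^ k = -1 → k + 1 ≤ L := by
    intro k g hg
    have := two_pow_lt_of_pow_eq_neg_one hprime (by omega) hg
    exact Nat.le_log_of_pow_le (by norm_num) this.le
  have hneg : ((p - 1 : ℕ) : ZMod p) = -1 := by
    rw [Nat.cast_sub (by omega)]; simp
  refine ((St.runs hs (.seq (.asg 5 (.sub (.var 3) (.lit 1))) (.asg 4 (.lit 1))) h
    (fun h' => Given n K S r h' ∧ h'.var 3 = p ∧ h'.var 5 = p - 1 ∧ h'.var 4 = 1) ?_).seq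
    (fun h' hI => Runs.whileCode hs (tb := rootBody.cost)
    (I := fun f h => ∃ k y, ((rootSeq p k : ℕ) : ZMod p) ^ 2 ^ k = -1 ∧ 0 < rootSeq p k ∧
      rootSeq p k < p ∧ 1 ≤ y ∧ y ≤ p ∧ (∀ y' < y, y' * y' % p ≠ rootSeq p k) ∧
      (L - k) * p + (p - y) ≤ f ∧ Given n K S r h ∧ h.var 3 = p ∧ h.var 5 = rootSeq p k ∧
      h.var 4 = y)
    (Q := fun h' => Given n K S r h' ∧ h'.var 3 = p ∧ h'.var 5 = rootSeq p L ∧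
        rootSeq p L < p ∧ NonRes p (rootSeq p L))
    (by simp [Ex.depth]) (by simp [Ex.depth]) ?_ ?_ ?_ ((L + 1) * p) h'
    ⟨0, 1, ?_, ?_, ?_, le_rfl, by omega, ?_, ?_, hI⟩)).mono ?_
    fun _ h => h
  · apply St.wp_asg_seq (p - 1) (by norm_num) (by simp [Ex.depth])
    · refine ⟨by simp [Ex.Ok], by simp only [Ex.Ok]; omega, ?_⟩
      simp only [Ex.val, Op.eval, h3]; omega
    · simp only [Ex.val, Op.eval, h3]
    exact ⟨by norm_num, by simp [Ex.depth], by simp only [Ex.Ok]; omega,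
      (hG.update (by norm_num)).update (by norm_num), by simpa using h3, by simp, rfl⟩
  · exact fun k h _ => ⟨by simp [Ex.Ok], by simp [Ex.Ok]⟩
  · rintro f h ⟨k, y, h1, h2, h3, h4, h5, h6, h7, hG, v3, v5, v4⟩ hlt
    simp only [Ex.val, v3, v4] at hlt
    have hk := hkL k _ h1
    have hyy : y * y < W := (Nat.mul_le_mul h5 h5).trans_lt hpp
    refine ⟨f - 1, by omega, St.runs hs _ _ _ ?_⟩
    have hG' : Given n K S r { h with var := Function.update h.var 11 (y * y % p) } :=
      hG.update (by norm_num)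
    have next : y * y % p ≠ rootSeq p k → (incCode 4).wp W s
        (fun h => ∃ k y, ((rootSeq p k : ℕ) : ZMod p) ^ 2 ^ k = -1 ∧ 0 < rootSeq p k ∧
          rootSeq p k < p ∧ 1 ≤ y ∧ y ≤ p ∧ (∀ y' < y, y' * y' % p ≠ rootSeq p k) ∧
          (L - k) * p + (p - y) ≤ f - 1 ∧ Given n K S r h ∧ h.var 3 = p ∧
          h.var 5 = rootSeq p k ∧ h.var 4 = y)
        { h with var := Function.update h.var 11 (y * y % p) } := by
      intro hne
      refine incCode_wp (by norm_num) (by simpa using v4) (by omega) ⟨k, y + 1, h1, h2, h3,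
        by omega, hlt, ?_, by omega, hG'.update (by norm_num), by simpa using v3,
        by simpa using v5, by simp⟩
      intro y' hy'
      rcases Nat.lt_succ_iff_lt_or_eq.1 hy' with h | h
      · exact h6 y' h
      · subst h; exact hne
    apply St.wp_asg_seq (y * y % p) (by norm_num) (by simp [Ex.depth])
    · refine ⟨⟨by simp [Ex.Ok], by simp [Ex.Ok], ?_⟩, by simp [Ex.Ok], ?_⟩
      · simpa only [Ex.val, Op.eval, v4] using hyy
      · simp only [Ex.val, Op.eval, v4, v3]
        exact (Nat.mod_le _ _).trans_lt hyy
    · simp only [Ex.val, Op.eval, v4, v3]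
    refine St.wp_ite (y * y % p) (rootSeq p k) (by simp [Ex.depth]) (by simp [Ex.depth])
      (by simp [Ex.Ok]) (by simp [Ex.Ok]) (by simp [Ex.val]) (by simpa [Ex.val] using v5)
      (fun hc => next (by omega)) fun hc => ?_
    refine St.wp_ite (rootSeq p k) (y * y % p) (by simp [Ex.depth]) (by simp [Ex.depth])
      (by simp [Ex.Ok]) (by simp [Ex.Ok]) (by simpa [Ex.val] using v5) (by simp [Ex.val])
      (fun hc' => next (by omega)) fun hc' => ?_
    have heq : y * y % p = rootSeq p k := by omega
    have hsucc := rootSeq_succ_of_least hlt heq h6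
    apply St.wp_asg_seq y (by norm_num) (by simp [Ex.depth]) (by simp [Ex.Ok])
      (by simpa [Ex.val] using v4)
    refine ⟨by norm_num, by simp [Ex.depth], by simp only [Ex.Ok]; omega, k + 1, 1, ?_, by omega,
      by omega, le_rfl, by omega, ?_, ?_, (hG'.update (by norm_num)).update (by norm_num),
      by simpa using v3, by simp [hsucc], rfl⟩
    -- The new value `y` satisfies `y ^ 2 = rootSeq p k`, so its power `2 ^ (k + 1)` is the old
    -- power `2 ^ k`, that is, `-1`.
    · rw [hsucc, pow_succ', pow_mul, sq, ← Nat.cast_mul, ← h1, ← heq, ZMod.natCast_mod]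
    · intro y' hy'
      obtain rfl : y' = 0 := by omega
      rw [hsucc]
      simp
      omega
    · obtain ⟨m, hm⟩ : ∃ m, L - k = m + 1 := ⟨L - k - 1, by omega⟩
      rw [hm, Nat.add_mul] at h7
      rw [show L - (k + 1) = m by omega]
      omega
  · rintro f h ⟨k, y, h1, h2, h3, h4, h5, h6, h7, hG, v3, v5, v4⟩ hlt
    simp only [Ex.val, v3, v4] at hlt
    have hk := hkL k _ h1
    have hnr : NonRes p (rootSeq p k) := fun y' hy' => h6 y' (by omega)
    have := rootSeq_eq_of_nonRes hnr L (by omega)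
    rw [this]
    exact ⟨hG, v3, v5, h3, hnr⟩
  · simp only [rootSeq, pow_zero, pow_one, hneg]
  · simp only [rootSeq]; omega
  · simp only [rootSeq]; omega
  · intro y' hy'
    obtain rfl : y' = 0 := by omega
    simp only [rootSeq]
    simp
    omega
  · rw [Nat.add_mul]; simp only [Nat.sub_zero]; omega
  · have e1 : (L + 1) * p ≤ (Nat.log 2 n + 3) * (4 * n) := Nat.mul_le_mul (by omega) hP4
    have e2 : (Nat.log 2 n + 3) * (4 * n) = 4 * (n * (Nat.log 2 n + 3)) := by ring
    norm_num [Ex.cost, St.cost, incCode, rootBody]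
    omega

end

end PalStream

/-! ### Drawing the points and running the whole program -/

namespace PalStream

/-- The parameters of a run of the program on the stream `S` with the random words `r`. -/
noncomputable def runParams (a n K W s : ℕ) (S r : List ℕ) : Params where
  a := a
  n := n
  K := K
  p := fieldP n
  g := fieldG n
  W := W
  s := s
  S := S
  X e := r.getD e 0 % (fieldP n * fieldP n)

/-- The first `k` points have been drawn. -/
structure PointInv (c : Params) (r : List ℕ) (k : ℕ) (h : Store) : Prop where
  n : h.var 0 = c.n
  K : h.var 1 = c.K
  p : h.var 3 = c.p
  g : h.var 5 = c.g
  q : h.var 6 = c.q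
  B : h.var 7 = c.B
  best : h.var 8 = 0
  mid : h.var 9 = 1
  i : h.var 10 = 0
  X : ∀ e < k, h.arr (64 + e) = c.X e
  rnd : h.rnd = r.drop k
  inp : h.inp = c.S
  out : h.out = []

theorem pointCode_wp {c : Params} (hc : c.Valid) {r : List ℕ} (hr : ∀ v ∈ r, v < c.W)
    (hX : ∀ e, c.X e = r.getD e 0 % c.q) {k : ℕ} (hk : k < 9 * c.a) (hlen : 9 * c.a ≤ r.length)
    (h : Store) (hI : PointInv c r k h) :
    (pointCode k).wp c.W c.s (PointInv c r (k + 1)) h := by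
  obtain ⟨rn, rK, rp, rg, rq, rB, rbest, rmid, ri, rX, rrnd, rinp, rout⟩ := hI
  have hk' : k < r.length := by omega
  have hs := hc.le_s
  have hsW := hc.s_lt
  simp only [Params.base] at hs
  have hv := hr _ (List.getElem_mem hk')
  refine ⟨by norm_num, r[k], r.drop (k + 1), ?_, hv, by simp [Ex.depth], by simp [Ex.depth], ?_,
    ⟨by simp [Ex.Ok], by simp [Ex.Ok], ?_⟩, ?_, ?_, ?_⟩
  · rw [rrnd, List.drop_eq_getElem_cons hk']
  · simp only [Ex.Ok]; omega
  · simp only [Ex.val, Op.eval, Function.update_self]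
    exact (Nat.mod_le _ _).trans_lt hv
  · simp only [Ex.val]; omega
  · simp only [Ex.val]; omega
  · have hX' : ∀ e < k + 1, Function.update h.arr (64 + k) (r[k] % c.q) (64 + e) = c.X e := by
      intro e he
      by_cases hek : e = k
      · subst hek
        simp [hX, hk']
      · rw [Function.update_of_ne (by omega), rX e (by omega)]
    constructor <;> first | assumption | (simp [Ex.val, Op.eval, rq]; done) |
      simpa [Ex.val, Op.eval, rq] using hX'

theorem initCode_wp {c : Params} (hc : c.Valid) {r : List ℕ} (hr : ∀ v ∈ r, v < c.W)
    (hX : ∀ e, c.X e = r.getD e 0 % c.q) (hlen : 9 * c.a ≤ r.length) (h : Store)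
    (hG : Given c.n c.K c.S r h) (h3 : h.var 3 = c.p) (h5 : h.var 5 = c.g) :
    (initCode c.a).wp c.W c.s (StepInv c 0 0 1) h := by
  have hnW := hc.n_lt
  have hqW := hc.two_q_le
  have hn := hc.two_le_n
  have hB := hc.mul_w_lt (w := 1) (by omega)
  simp only [Nat.mul_one, Params.B] at hB
  have hp := hc.one_lt_p
  have hpp : 0 < c.p * c.p := by positivity
  apply St.wp_asg_seq (c.p * c.p) (by norm_num) (by simp [Ex.depth])
  · refine ⟨by simp [Ex.Ok], by simp [Ex.Ok], ?_⟩
    simp only [Ex.val, Op.eval, h3]; omega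
  · simp only [Ex.val, Op.eval, h3]
  apply St.wp_asg_seq (4 * (c.K + 1)) (by norm_num) (by simp [Ex.depth])
  · refine ⟨by simp only [Ex.Ok]; omega, ⟨by simp [Ex.Ok], by simp only [Ex.Ok]; omega, ?_⟩, ?_⟩
    · simp [Ex.val, Op.eval, hG.K]; omega
    · simp [Ex.val, Op.eval, hG.K]; omega
  · simp [Ex.val, Op.eval, hG.K]
  apply St.wp_asg_seq 0 (by norm_num) (by simp [Ex.depth]) (by simp only [Ex.Ok]; omega) rfl
  apply St.wp_asg_seq 1 (by norm_num) (by simp [Ex.depth]) (by simp only [Ex.Ok]; omega) rfl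
  apply St.wp_asg_seq 0 (by norm_num) (by simp [Ex.depth]) (by simp only [Ex.Ok]; omega) rfl
  have rn := hG.n
  have rK := hG.K
  have rinp := hG.inp
  have rrnd := hG.rnd
  have rout := hG.out
  refine St.wp_mono (.rep pointCode (9 * c.a)) ?_ _ (St.wp_rep (I := PointInv c r)
    (fun k hk h hI => pointCode_wp hc hr hX hk hlen h hI) _ ?_)
  · rintro h' ⟨rn, rK, rp, rg, rq, rB, rbest, rmid, ri, rX, rrnd, rinp, rout⟩
    refine ⟨⟨h'.var 11, h'.var 12, h'.var 13, h'.var 14, ?_⟩, fun j _ h0 => absurd h0 (by omega),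
      ⟨le_rfl, ?_, fun h0 => absurd h0 (by omega)⟩, fun i' j _ h0 => absurd h0 (by omega)⟩
    · constructor <;> first | assumption | rfl
    · rw [hc.length_S]; omega
  · constructor <;> first | assumption | rfl | exact fun e he => absurd he (Nat.not_lt_zero e)

/-- The factor by which the number of steps exceeds the length of the stream times the number of
slots. -/
def stepFactor (a : ℕ) : ℕ := mainCost a + (initCode a).cost + 2000 + 9 * a

/-- Since `log₂ n + 3` is at most the number of slots, the setup costs no more than a constant times
one pass over all slots for every symbol. -/
theorem program_runs {c : Params} (hc : c.Valid) (hcp : c.p = fieldP c.n) (hcg : c.g = fieldG c.n)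
    {r : List ℕ} (hr : ∀ v ∈ r, v < c.W) (hX : ∀ e, c.X e = r.getD e 0 % c.q)
    (hlen : 9 * c.a ≤ r.length) (h : Store) (hG : Given c.n c.K c.S r h) :
    Runs c.W c.s (program c.a) h (c.n * c.M * stepFactor c.a)
      (fun h' => ∃ best mid, h'.out = [mid, best] ∧ Sound c.p c.g c.a c.X c.S best mid ∧
        ∀ i < c.n, ∀ j < c.M, Covers c.p c.g c.a c.X c.S c.B best i j) := by
  have hs : 64 ≤ c.s := by have := hc.le_s; simp only [Params.base] at this; omega
  have hn := hc.two_le_n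
  refine ((cubeCode_runs hs hn hc.W_large h hG).seq fun h1 ⟨hG1, h12⟩ =>
    (primeCode_runs hs hn hc.W_large h1 hG1 h12).seq fun h2 ⟨hG2, h23⟩ =>
    (rootCode_runs hs hn hc.W_large h2 hG2 h23).seq fun h3 ⟨hG3, h33, h35, _⟩ =>
    (St.runs hs _ h3 _ (initCode_wp hc hr hX hlen h3 hG3 (hcp ▸ h33) (hcg ▸ h35))).seq fun h4 hI =>
    mainCode_runs c hc h4 hI).mono ?_ fun _ h => h
  have hM : Nat.log 2 c.n + 3 ≤ c.M := by
    simp only [Params.M, Params.B]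
    nlinarith [Nat.zero_le (c.K * Nat.log 2 c.n)]
  have h1 : c.n ≤ c.n * c.M := Nat.le_mul_of_pos_right _ (by omega)
  have h2 : c.n * (Nat.log 2 c.n + 3) ≤ c.n * c.M := Nat.mul_le_mul_left _ hM
  have h3 : 1 ≤ c.n * c.M := by omega
  have h4 : (initCode c.a).cost ≤ c.n * c.M * (initCode c.a).cost := Nat.le_mul_of_pos_left _ h3
  rw [stepFactor]
  generalize c.n * c.M = x at *
  generalize c.n * (Nat.log 2 c.n + 3) = y at *
  simp only [Nat.mul_add]
  omega

/-- The correctness proof of the search already contains this arithmetic fact. It is extracted by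
running `rootCode` on an auxiliary store with empty streams, of which only the postcondition
matters. -/
theorem fieldG_spec {n : ℕ} (hn : 2 ≤ n) :
    fieldG n < fieldP n ∧ NonRes (fieldP n) (fieldG n) := by
  set W := 100 * (n + 1) ^ 3 with hW
  have hW4 : 4 * n < W := by nlinarith [Nat.zero_le (n ^ 3), Nat.zero_le (n ^ 2)]
  have hP := fieldP_le' hn
  obtain ⟨σ', t', h', -, -, -, -, -, -, h1, h2⟩ := rootCode_runs (W := W) (s := 64) (n := n)
    (K := 0) (S := []) (r := []) le_rfl hn le_rfl
    ⟨fun x => if x = 0 then n else if x = 3 then fieldP n else 0, fun _ => 0, [], [], []⟩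
    ⟨rfl, rfl, rfl, rfl, rfl⟩ rfl
    ⟨fun x => if x = 0 then n else if x = 3 then fieldP n else 0, [], [], []⟩
    ⟨fun _ _ => rfl, fun a ha => by simp only; rw [if_neg (by omega), if_neg (by omega)], fun a => by
      simp only
      split_ifs <;> omega, rfl, rfl, rfl⟩
  exact ⟨h1, h2⟩

theorem four_mul_sq_le_fieldP_cube (n : ℕ) : 4 * n * n ≤ fieldP n * fieldP n * fieldP n := by
  have h := (fieldN_lt_fieldP n).le
  exact (fieldN_spec n).trans (Nat.mul_le_mul (Nat.mul_le_mul h h) h)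

/-- The choice `4 * n ^ 2 ≤ p ^ 3`, raised to the sixth power, gives `4096 * n ^ 12 ≤ p ^ 18`. Nine
points are what the exponent `12 = 3 + 9` requires. -/
theorem fieldP_pow_bound (n : ℕ) : n ^ 3 * (2 * n) ^ 9 ≤ (fieldP n * fieldP n) ^ 9 := by
  have h := four_mul_sq_le_fieldP_cube n
  calc n ^ 3 * (2 * n) ^ 9 = 512 * n ^ 12 := by ring
    _ ≤ 4096 * n ^ 12 := Nat.mul_le_mul_right _ (by norm_num)
    _ = (4 * n * n) ^ 6 := by ring
    _ ≤ (fieldP n * fieldP n * fieldP n) ^ 6 := Nat.pow_le_pow_left h 6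
    _ = _ := by ring

/-- Otherwise `p ^ 6 < 8 * n ^ 3 ≤ 16 * n ^ 4`, against `4 * n ^ 2 ≤ p ^ 3`. It makes a block of
`⌊log₂ n⌋ + 1` bits fit into one field element, so that `a` digits describe a symbol. -/
theorem two_mul_le_fieldP_mul (n : ℕ) : 2 * n ≤ fieldP n * fieldP n := by
  by_contra hc
  push Not at hc
  have h := four_mul_sq_le_fieldP_cube n
  have h1 : (4 * n * n) ^ 2 ≤ (fieldP n * fieldP n * fieldP n) ^ 2 := Nat.pow_le_pow_left h 2
  have h2 : (fieldP n * fieldP n * fieldP n) ^ 2 = (fieldP n * fieldP n) ^ 3 := by ring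
  have h3 : (fieldP n * fieldP n) ^ 3 < (2 * n) ^ 3 := Nat.pow_lt_pow_left hc (by norm_num)
  rw [h2] at h1
  have h4 : (2 * n) ^ 3 ≤ (4 * n * n) ^ 2 := by
    rcases Nat.eq_zero_or_pos n with h0 | h0
    · simp [h0]
    · calc (2 * n) ^ 3 = 8 * n ^ 3 := by ring
        _ ≤ 16 * n ^ 4 := Nat.mul_le_mul (by norm_num) (Nat.pow_le_pow_right h0 (by norm_num))
        _ = _ := by ring
  omega

theorem wordBound_le_fieldP_pow (a : ℕ) {n : ℕ} (hn : 2 ≤ n) :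
    wordBound a n ≤ (fieldP n * fieldP n) ^ a := by
  rw [wordBound, Nat.mul_comm, pow_mul]
  refine Nat.pow_le_pow_left (le_trans ?_ (two_mul_le_fieldP_mul n)) a
  rw [pow_succ, Nat.mul_comm]
  exact Nat.mul_le_mul_left _ (Nat.pow_log_le_self 2 (by omega))

/-! ### Word length, space, time and success probability -/

/-- The number of registers. -/
def space (a n K : ℕ) : ℕ := 64 + 9 * a + 4 * (K + 1) * (Nat.log 2 n + 1) * (27 * a + 1)

theorem space_lt {a n K : ℕ} (hn : 2 ≤ n) (hK : K ≤ n) : space a n K < wordBound (a + 10) n := by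
  rw [wordBound, Nat.mul_comm, pow_mul]
  set Z := 2 ^ (Nat.log 2 n + 1) with hZ
  have h1 : n < Z := Nat.lt_pow_succ_log_self (by norm_num) n
  have h2 : Nat.log 2 n + 1 < Z := Nat.lt_two_pow_self
  have h4 : 4 ≤ Z := by
    have : 1 ≤ Nat.log 2 n := Nat.le_log_of_pow_le (by norm_num) (by omega)
    calc 4 = 2 ^ 2 := by norm_num
      _ ≤ _ := Nat.pow_le_pow_right (by norm_num) (by omega)
  have ha : a + 1 ≤ Z ^ a := (Nat.lt_two_pow_self (n := a)).trans_le (Nat.pow_le_pow_left (by omega) a)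
  have hZ2 : 0 < Z ^ 2 := by positivity
  have hR : 27 * a + 1 ≤ 27 * Z ^ a := by omega
  have hM : 4 * (K + 1) * (Nat.log 2 n + 1) ≤ 4 * Z * Z :=
    Nat.mul_le_mul (Nat.mul_le_mul_left _ (by omega)) h2.le
  have h5 : 64 + 9 * a ≤ 64 * Z ^ a * (Z * Z) := by
    have : Z ^ a ≤ Z ^ a * (Z * Z) := Nat.le_mul_of_pos_right _ (by positivity)
    nlinarith
  have h6 : 4 ^ 8 ≤ Z ^ 8 := Nat.pow_le_pow_left h4 8
  have h7 : 0 < Z ^ a * (Z * Z) := by positivity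
  calc space a n K ≤ 64 * Z ^ a * (Z * Z) + 4 * Z * Z * (27 * Z ^ a) :=
        Nat.add_le_add h5 (Nat.mul_le_mul hM hR)
    _ = 172 * (Z ^ a * (Z * Z)) := by ring
    _ < 4 ^ 8 * (Z ^ a * (Z * Z)) := by omega
    _ ≤ Z ^ 8 * (Z ^ a * (Z * Z)) := Nat.mul_le_mul_right _ h6
    _ = Z ^ (a + 10) := by ring

theorem hundred_mul_le_wordBound (a : ℕ) {n : ℕ} (hn : 2 ≤ n) :
    100 * (n + 1) ^ 3 ≤ wordBound (a + 10) n := by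
  rw [wordBound, Nat.mul_comm (a + 10), pow_mul]
  set Z := 2 ^ (Nat.log 2 n + 1) with hZ
  have h1 : n < Z := Nat.lt_pow_succ_log_self (by norm_num) n
  have h4 : 4 ≤ Z := by
    have : 1 ≤ Nat.log 2 n := Nat.le_log_of_pow_le (by norm_num) (by omega)
    calc 4 = 2 ^ 2 := by norm_num
      _ ≤ _ := Nat.pow_le_pow_right (by norm_num) (by omega)
  calc 100 * (n + 1) ^ 3 ≤ 4 ^ 7 * Z ^ 3 :=
        Nat.mul_le_mul (by norm_num) (Nat.pow_le_pow_left h1 3)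
    _ ≤ Z ^ 7 * Z ^ 3 := Nat.mul_le_mul_right _ (Nat.pow_le_pow_left h4 7)
    _ = Z ^ 10 := by ring
    _ ≤ Z ^ (a + 10) := Nat.pow_le_pow_right (by omega) (by omega)

theorem runParams_valid {a n K : ℕ} {S r : List ℕ} (hn : 2 ≤ n) (hK : K ≤ n) (hS : S.length = n)
    (hSa : ∀ x ∈ S, x < wordBound a n) :
    (runParams a n K (wordBound (a + 10) n) (space a n K) S r).Valid where
  two_le_n := hn
  K_le := hK
  one_lt_p := (fieldP_prime n).one_lt
  p_le := fieldP_le' hn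
  g_lt := (fieldG_spec hn).1
  X_lt _ := Nat.mod_lt _ (Nat.mul_pos (fieldP_prime n).pos (fieldP_prime n).pos)
  length_S := hS
  S_lt v hv := (hSa v hv).trans_le
    (Nat.pow_le_pow_right (by norm_num) (Nat.mul_le_mul_right _ (by omega)))
  W_large := hundred_mul_le_wordBound a hn
  le_s := le_rfl
  s_lt := space_lt hn hK

/-- The number of steps. -/
def time (a n K : ℕ) : ℕ := n * (4 * (K + 1) * (Nat.log 2 n + 1)) * stepFactor a

/-- As many random words are supplied as there are time steps; the summand `9 * a` in `stepFactor`
guarantees that the draws never run out. -/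
theorem le_time {a n : ℕ} (K : ℕ) (hn : 2 ≤ n) : 9 * a ≤ time a n K := by
  have h1 : 9 * a ≤ stepFactor a := by rw [stepFactor]; omega
  exact h1.trans (Nat.le_mul_of_pos_left _ (by positivity))

theorem program_haltsWith {a n : ℕ} {ε : ℝ} {S r : List ℕ} (hn : 2 ≤ n)
    (hS : S.length = n) (hSa : ∀ x ∈ S, x < wordBound a n)
    (hr : ∀ v ∈ r, v < wordBound (a + 10) n) (hlen : r.length = time a n (encodeEps n ε)) :
    ∃ best mid, HaltsWith (wordBound (a + 10) n) (space a n (encodeEps n ε))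
      (time a n (encodeEps n ε)) (program a) ε S r [mid, best] ∧
      Sound (fieldP n) (fieldG n) a (fun e => r.getD e 0 % (fieldP n * fieldP n)) S best mid ∧
      ∀ i < n, ∀ j < 4 * (encodeEps n ε + 1) * (Nat.log 2 n + 1),
        Covers (fieldP n) (fieldG n) a (fun e => r.getD e 0 % (fieldP n * fieldP n)) S
          (4 * (encodeEps n ε + 1)) best i j := by
  have hK : encodeEps n ε ≤ n := min_le_right _ _
  have hc := runParams_valid (r := r) hn hK hS hSa
  have hnW := hc.n_lt
  have e1 : n % wordBound (a + 10) n = n :=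
    Nat.mod_eq_of_lt (by change 2 * n + 2 < wordBound (a + 10) n at hnW; omega)
  have e2 : encodeEps n ε % wordBound (a + 10) n = encodeEps n ε :=
    Nat.mod_eq_of_lt (by change 2 * n + 2 < wordBound (a + 10) n at hnW; omega)
  have hrun := program_runs hc rfl rfl hr (fun e => rfl) (hlen ▸ le_time _ hn)
    ⟨(start (wordBound (a + 10) n) ε S r).mem, (start (wordBound (a + 10) n) ε S r).mem, S, r, []⟩
    ⟨by simp only [start, if_true, hS]; exact e1,
      by simp only [start, hS]; exact e2, rfl, rfl, rfl⟩
  have hW : 0 < wordBound (a + 10) n := Nat.two_pow_pos _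
  obtain ⟨σ', t', h', hexec, ht, hrep, best, mid, hout, hsound, hcov⟩ := hrun
    (start (wordBound (a + 10) n) ε S r) ⟨fun _ _ => rfl, fun _ _ => rfl, fun x => by
      simp only [start]
      split_ifs
      · exact Nat.mod_lt _ hW
      · exact Nat.mod_lt _ hW
      · exact hW, rfl, rfl, rfl⟩
  exact ⟨best, mid, ⟨σ', t', hexec, ht, hrep.out.trans hout⟩, hsound, hcov⟩

/-- The constant is `4 * 3 * 4`: `K + 1 ≤ 1 / ε + 2 ≤ 3 / ε`, and `log₂ n + 1 ≤ 2 * log₂ n ≤ 4 * log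
n`. The factor `log (1 + ε) ≤ 1` in the denominator is only given away. -/
theorem slots_le {n : ℕ} {ε : ℝ} (hn : 2 ≤ n) (hε : 0 < ε) (hε1 : ε ≤ 1) :
    ((4 * (encodeEps n ε + 1) * (Nat.log 2 n + 1) : ℕ) : ℝ) ≤
      48 * (Real.log n / (ε * Real.log (1 + ε))) := by
  have hK : ((encodeEps n ε : ℕ) : ℝ) + 1 ≤ 3 / ε := by
    have h1 : ((encodeEps n ε : ℕ) : ℝ) ≤ ⌈1 / ε⌉₊ := by exact_mod_cast min_le_left _ _
    have h2 := Nat.ceil_lt_add_one (show 0 ≤ 1 / ε by positivity)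
    have h3 : 1 ≤ 1 / ε := by rw [le_div_iff₀ hε]; linarith
    have h4 : 3 / ε = 3 * (1 / ε) := by ring
    linarith
  have hlogn : 0 < Real.log n := Real.log_pos (by exact_mod_cast hn)
  have hL : ((Nat.log 2 n : ℕ) : ℝ) + 1 ≤ 4 * Real.log n := by
    have h1 : (2 : ℝ) ^ Nat.log 2 n ≤ n := by
      exact_mod_cast Nat.pow_log_le_self 2 (by omega)
    have h2 := Real.log_le_log (by positivity) h1
    rw [Real.log_pow] at h2
    have h3 := Real.log_two_gt_d9
    have h4 : (1 : ℝ) ≤ Nat.log 2 n := by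
      exact_mod_cast Nat.le_log_of_pow_le (b := 2) (by norm_num) (by omega : 2 ^ 1 ≤ n)
    nlinarith
  have hlog0 : 0 < Real.log (1 + ε) := Real.log_pos (by linarith)
  have hlog1 : Real.log (1 + ε) ≤ 1 := by
    have := Real.log_le_sub_one_of_pos (show 0 < 1 + ε by linarith)
    linarith
  have h1 : Real.log n / ε ≤ Real.log n / (ε * Real.log (1 + ε)) := by
    apply div_le_div_of_nonneg_left hlogn.le (by positivity)
    nlinarith
  push_cast
  calc (4 : ℝ) * (encodeEps n ε + 1) * (Nat.log 2 n + 1) ≤ 4 * (3 / ε) * (4 * Real.log n) := by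
        gcongr
    _ = 48 * (Real.log n / ε) := by ring
    _ ≤ _ := by linarith

open MeasureTheory in
theorem le_uniformOn_of_card_compl {Ω : Type*} [Fintype Ω] [Nonempty Ω] [MeasurableSpace Ω]
    [MeasurableSingletonClass Ω] {n : ℕ} (hn : 0 < n) {A B : Set Ω} [Fintype B]
    (hB : B.toFinset.card * n ≤ Fintype.card Ω) (hA : Bᶜ ⊆ A) :
    1 - 1 / (n : ℝ) ≤ (ProbabilityTheory.uniformOn (Set.univ : Set Ω)).real A := by
  have : IsProbabilityMeasure (ProbabilityTheory.uniformOn (Set.univ : Set Ω)) :=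
    ProbabilityTheory.isProbabilityMeasure_uniformOn Set.finite_univ Set.univ_nonempty
  refine le_trans ?_ (measureReal_mono hA)
  rw [probReal_compl_eq_one_sub B.toFinite.measurableSet]
  have h1 : (ProbabilityTheory.uniformOn (Set.univ : Set Ω)).real B =
      (B.toFinset.card : ℝ) / Fintype.card Ω := by
    rw [Measure.real, ProbabilityTheory.uniformOn_univ, Measure.count_apply_finite B B.toFinite,
      ENNReal.toReal_div]
    simp [Set.toFinite_toFinset]
  have hΩ : (0 : ℝ) < Fintype.card Ω := by exact_mod_cast Fintype.card_pos
  have hn' : (0 : ℝ) < n := by exact_mod_cast hn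
  have h2 : (B.toFinset.card : ℝ) / Fintype.card Ω ≤ 1 / n := by
    rw [div_le_div_iff₀ hΩ hn', one_mul]
    exact_mod_cast hB
  rw [h1]
  linarith

end PalStream

theorem theorem3 (a : ℕ) :
    ∃ (P : PalStream.Program) (b : ℕ) (C : ℝ),
      ∀ (n : ℕ) (ε : ℝ), 2 ≤ n → 0 < ε → ε ≤ 1 →
        ∃ s T : ℕ,
          (s : ℝ) ≤ C * (Real.log n / (ε * Real.log (1 + ε))) ∧
          (T : ℝ) ≤ C * (n * Real.log n / (ε * Real.log (1 + ε))) ∧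
          ∀ S : List ℕ, S.length = n → (∀ x ∈ S, x < PalStream.wordBound a n) →
            (∀ r : Fin T → Fin (PalStream.wordBound b n),
              ∃ o : List ℕ, PalStream.HaltsWith (PalStream.wordBound b n) s T P ε S
                (List.ofFn fun i => (r i : ℕ)) o) ∧
            1 - 1 / (n : ℝ) ≤
              (ProbabilityTheory.uniformOn
                (Set.univ : Set (Fin T → Fin (PalStream.wordBound b n)))).real
                {r | ∃ o : List ℕ, PalStream.HaltsWith (PalStream.wordBound b n) s T P ε S
                  (List.ofFn fun i => (r i : ℕ)) o ∧ PalStream.Reports S ε o} := by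
  classical
  -- The `65 + 36 * a` pays for the `64 + 9 * a` fixed registers and the `27 * a + 1` registers per
  -- slot, `stepFactor a` for the time; `48` comes from `slots_le`.
  refine ⟨PalStream.program a, a + 10, 48 * (65 + 36 * a + PalStream.stepFactor a : ℕ), ?_⟩
  intro n ε hn hε hε1
  set K := PalStream.encodeEps n ε with hK
  have hslots := PalStream.slots_le hn hε hε1
  rw [← hK] at hslots
  set Y := Real.log n / (ε * Real.log (1 + ε)) with hY
  have hM : 1 ≤ 4 * (K + 1) * (Nat.log 2 n + 1) := Nat.mul_pos (by omega) (by omega)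
  refine ⟨PalStream.space a n K, PalStream.time a n K, ?_, ?_, ?_⟩
  · have h1 : PalStream.space a n K ≤
        (65 + 36 * a + PalStream.stepFactor a) * (4 * (K + 1) * (Nat.log 2 n + 1)) := by
      rw [PalStream.space]
      generalize 4 * (K + 1) * (Nat.log 2 n + 1) = M at *
      nlinarith [Nat.zero_le (PalStream.stepFactor a * M), Nat.mul_le_mul_left a hM]
    calc (PalStream.space a n K : ℝ) ≤ ((65 + 36 * a + PalStream.stepFactor a : ℕ) : ℝ) *
          ((4 * (K + 1) * (Nat.log 2 n + 1) : ℕ) : ℝ) := by exact_mod_cast h1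
      _ ≤ ((65 + 36 * a + PalStream.stepFactor a : ℕ) : ℝ) * (48 * Y) := by gcongr
      _ = _ := by ring
  · have h1 : PalStream.time a n K ≤
        (65 + 36 * a + PalStream.stepFactor a) * (n * (4 * (K + 1) * (Nat.log 2 n + 1))) := by
      rw [PalStream.time, Nat.mul_comm]
      exact Nat.mul_le_mul_right _ (by omega)
    calc (PalStream.time a n K : ℝ) ≤ ((65 + 36 * a + PalStream.stepFactor a : ℕ) : ℝ) *
          (n * ((4 * (K + 1) * (Nat.log 2 n + 1) : ℕ) : ℝ)) := by exact_mod_cast h1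
      _ ≤ ((65 + 36 * a + PalStream.stepFactor a : ℕ) : ℝ) * (n * (48 * Y)) := by gcongr
      _ = _ := by rw [hY]; ring
  intro S hS hSa
  have hr : ∀ r : Fin (PalStream.time a n K) → Fin (PalStream.wordBound (a + 10) n),
      ∀ v ∈ List.ofFn fun i => (r i : ℕ), v < PalStream.wordBound (a + 10) n := by
    intro r v hv
    obtain ⟨i, rfl⟩ := (List.mem_ofFn' _ _).1 hv
    exact (r i).2
  have hhalt := fun r : Fin (PalStream.time a n K) → Fin (PalStream.wordBound (a + 10) n) =>
    PalStream.program_haltsWith (ε := ε) hn hS hSa (hr r) (by simp [hK])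
  refine ⟨fun r => ?_, ?_⟩
  · obtain ⟨best, mid, h, -⟩ := hhalt r
    exact ⟨_, h⟩
  obtain ⟨hg, hnr⟩ := PalStream.fieldG_spec hn
  have hW := PalStream.hundred_mul_le_wordBound a hn
  have hne : Nonempty (Fin (PalStream.wordBound (a + 10) n)) := ⟨⟨0, Nat.two_pow_pos _⟩⟩
  have hvalid := PalStream.runParams_valid (r := []) hn (min_le_right _ _ : K ≤ n) hS hSa
  have hqW : PalStream.fieldP n * PalStream.fieldP n ≤ PalStream.wordBound (a + 10) n :=
    (Nat.le_mul_of_pos_left _ (by norm_num)).trans hvalid.two_q_le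
  refine PalStream.le_uniformOn_of_card_compl (by omega)
    (B := {r | PalStream.Fooled (PalStream.fieldP n) (PalStream.fieldG n) a
      (PalStream.points (PalStream.fieldP n * PalStream.fieldP n) r) S}) ?_ ?_
  · rw [Fintype.card_fun, Fintype.card_fin, Fintype.card_fin]
    have := PalStream.card_fooled_le (PalStream.fieldP_prime n) hg hnr hqW
      (PalStream.le_time K hn)
      (fun v hv => (hSa v hv).trans_le (PalStream.wordBound_le_fieldP_pow a hn)) hS (by omega)
      (PalStream.fieldP_pow_bound n)
    convert this
  · intro r hr'
    obtain ⟨best, mid, h, hsound, hcov⟩ := hhalt r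
    refine ⟨_, h, ?_⟩
    -- The points that the program draws and those in the bad event are the same function of the
    -- random words by definition, so the complement of that event applies directly.
    exact PalStream.reports_of_covers (PalStream.fieldP_prime n).one_lt hε (by rw [hS]) (by omega)
      rfl hsound (by rw [hS]; exact hcov) hr'
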